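/- Let $n\ge 2$ and $\lambda>0$. An $\mathcal H_\lambda$-hypersurface is a smooth immersed hypersurface $f:\Sigma^n\to\mathbb R^{n+1}$, oriented by a unit normal $\eta$ (Gauss map), whose mean curvature (the mean of the principal curvatures, the eigenvalues of the shape operator $S$ given by $df\circ S=-d\eta$) satisfies $H_\Sigma(p)=\langle\eta_p,e_{n+1}\rangle+\lambda$ for every $p\in\Sigma$. It is rotational if it is generated by rotating an arc-length parametrized curve $s\mapsto(x(s),0,\dots,0,z(s))$, defined on an open interval, around the $x_{n+1}$-axis, and complete if its induced metric is complete. Write $C(r)=\{q\in\mathbb R^{n+1}:\ |(q_1,\dots,q_n)|=r\}$ and $r_0=\frac{n-1}{\lambda n}$. Let $\Sigma$ be a complete rotational $\mathcal H_\lambda$-hypersurface that does not meet the $x_{n+1}$-axis. Then $\Sigma$ is properly immersed, and there is a diffeomorphism $\Psi:\mathbb S^{n-1}\times\mathbb R\to\Sigma$ with $f(\Psi(\omega,s))=(x(s)\,\omega,z(s))$, where $x>0$ and $z$ are smooth functions on $\mathbb R$ with $x'^2+z'^2=1$, such that the end $s\to+\infty$ converges to the CMC cylinder $C(r_0)$,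 that is, $x(s)\to r_0$, $x'(s)\to 0$ and $z(s)\to+\infty$ as $s\to+\infty$. If moreover $\Sigma$ is not the cylinder $C(r_0)$ itself, then: 1. If $\lambda>1$, the other end $s\to-\infty$ has infinitely many self-intersections and unbounded distance to the axis: for every $a\in\mathbb R$, on $\Psi(\mathbb S^{n-1}\times(-\infty,a))$ the distance to the axis is unbounded, and infinitely many different rotational orbits consist of self-intersection points of this part. 2. If $\lambda\le 1$, the other end is a graph outside a compact set: for some $a\in\mathbb R$, $f$ maps $\Psi(\mathbb S^{n-1}\times(-\infty,a))$ injectively onto the graph $\{(y,u(y)):\ y\in\mathbb R^n,\ |y|>R\}$ of a smooth function $u$, for some $R>0$. Finally, if $\lambda<1$ and the unit normal $\eta$ equals $-e_{n+1}$ at every point of $\Sigma$ with horizontal tangent hyperplane, then $\Sigma$ is embedded. -/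

import Mathlib

open Set Filter Topology MeasureTheory
open scoped Manifold ContDiff ENNReal EuclideanSpace

noncomputable section

namespace RotHyp

/-- The unit sphere `S^m` of `ℝ^{m+1}`. -/
abbrev USphere (m : ℕ) : Type := Metric.sphere (0 : EuclideanSpace ℝ (Fin (m + 1))) 1

/-- The ambient space `ℝ^{n+1}` of hypersurfaces of dimension `n = m + 1`.
The axis of rotation is the last coordinate axis. -/
abbrev Amb (m : ℕ) : Type := EuclideanSpace ℝ (Fin (m + 2))

/-- The horizontal part `(q_1, …, q_n)` of a point; its norm is the distance to the axis. -/
def hor {m : ℕ} (q : Amb m) : EuclideanSpace ℝ (Fin (m + 1)) :=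
  WithLp.toLp 2 (fun i => q i.castSucc)

/-- The height `q_{n+1}` of a point, that is `⟨q, e_{n+1}⟩`. -/
def height {m : ℕ} (q : Amb m) : ℝ := q (Fin.last (m + 1))

/-- The vertical unit vector `e_{n+1}`, which is also the density vector. -/
def vert (m : ℕ) : Amb m := EuclideanSpace.single (Fin.last (m + 1)) 1

/-- The point `(x w, z)`. For `w ∈ S^{n-1}` these points form the orbit of `(x, 0, …, 0, z)` under
the rotations that fix the last axis. -/
def rotPoint {m : ℕ} (x z : ℝ) (w : EuclideanSpace ℝ (Fin (m + 1))) : Amb m :=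
  WithLp.toLp 2 (Fin.snoc (α := fun _ => ℝ) (fun i => x * w i) z)

/-- The vertical cylinder `C(r)` around the axis of rotation. -/
def cylinder (m : ℕ) (r : ℝ) : Set (Amb m) := {q | ‖hor q‖ = r}

section Hypersurface

variable {m : ℕ} {M : Type*} [TopologicalSpace M]
  [ChartedSpace (EuclideanSpace ℝ (Fin (m + 1))) M]

/-- The differential at `p` of a map from `M` to the ambient space. -/
def diffAt (f : M → Amb m) (p : M) : TangentSpace (𝓡 (m + 1)) p →L[ℝ] Amb m :=
  mfderiv (𝓡 (m + 1)) 𝓘(ℝ, Amb m) f p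

/-- `f` is a smooth immersion, oriented by the smooth unit normal field (Gauss map) `η`. -/
structure IsOrientedImmersion (f η : M → Amb m) : Prop where
  smooth : ContMDiff (𝓡 (m + 1)) 𝓘(ℝ, Amb m) ∞ f
  immersion : ∀ p, Function.Injective (diffAt f p)
  smooth_normal : ContMDiff (𝓡 (m + 1)) 𝓘(ℝ, Amb m) ∞ η
  unit : ∀ p, ‖η p‖ = 1
  normal : ∀ p v, inner ℝ (diffAt f p v) (η p) = 0

/-- `S` is the shape operator at `p`: `df ∘ S = -dη`. -/
def IsShapeOperator (f η : M → Amb m) (p : M)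
    (S : TangentSpace (𝓡 (m + 1)) p →ₗ[ℝ] TangentSpace (𝓡 (m + 1)) p) : Prop :=
  ∀ v, diffAt f p (S v) = -diffAt η p v

/-- The mean curvature at `p` with respect to `η`, i.e. the mean of the `n = m + 1` principal
curvatures, exists and equals `H`. (The shape operator of an immersion is unique.) -/
def HasMeanCurvatureAt (f η : M → Amb m) (p : M) (H : ℝ) : Prop :=
  ∃ S : TangentSpace (𝓡 (m + 1)) p →ₗ[ℝ] TangentSpace (𝓡 (m + 1)) p,
    IsShapeOperator f η p S ∧ H = LinearMap.trace ℝ _ S / ((m : ℝ) + 1)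

/-- `(M, f, η)` is an `H_lam`-hypersurface with density vector `e_{n+1}`:
its mean curvature is `⟨η, e_{n+1}⟩ + lam`. -/
structure IsHHypersurface (lam : ℝ) (f η : M → Amb m) : Prop extends
    IsOrientedImmersion f η where
  meanCurvature : ∀ p, HasMeanCurvatureAt f η p (inner ℝ (η p) (vert m) + lam)

/-- The distance of the metric induced by `f`: the infimum of the lengths (measured through `f`)
of the `C^1` paths in `M` from `p` to `q`. -/
def intrinsicEDist (f : M → Amb m) (p q : M) : ℝ≥0∞ :=
  ⨅ (γ : ℝ → M) (_ : ContMDiffOn 𝓘(ℝ, ℝ) (𝓡 (m + 1)) 1 γ (Icc 0 1)) (_ : γ 0 = p) (_ : γ 1 = q),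
    ∫⁻ t in Icc (0 : ℝ) 1, ‖deriv (fun t => f (γ t)) t‖ₑ

/-- The metric induced by `f` is complete: its Cauchy sequences converge in `M`. -/
def IsCompleteImmersion (f : M → Amb m) : Prop :=
  ∀ u : ℕ → M,
    (∀ ε : ℝ≥0∞, 0 < ε → ∃ N, ∀ j ≥ N, ∀ k ≥ N, intrinsicEDist f (u j) (u k) < ε) →
      ∃ p, Tendsto u atTop (𝓝 p)

/-- `(M, f)` is rotational around the last axis: it is generated by rotating an arc-length
parametrized curve `(x, 0, …, 0, z)` defined on an open interval `I`. The map `Φ` carries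
the rotated curve onto `M`; it need not be injective (the curve may be closed, or meet the axis). -/
def IsRotational (f : M → Amb m) : Prop :=
  ∃ (I : Set ℝ) (x z : ℝ → ℝ) (Φ : USphere m × ℝ → M),
    IsOpen I ∧ I.OrdConnected ∧
    ContDiffOn ℝ ∞ x I ∧ ContDiffOn ℝ ∞ z I ∧
    (∀ s ∈ I, deriv x s ^ 2 + deriv z s ^ 2 = 1) ∧
    ContMDiffOn ((𝓡 m).prod 𝓘(ℝ, ℝ)) (𝓡 (m + 1)) ∞ Φ (univ ×ˢ I) ∧
    Φ '' (univ ×ˢ I) = univ ∧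
    ∀ (w : USphere m), ∀ s ∈ I, f (Φ (w, s)) = rotPoint (x s) (z s) w

/-- The tangent hyperplane at `p` is horizontal. -/
def IsHorizontalAt (f : M → Amb m) (p : M) : Prop :=
  ∀ v, height (diffAt f p v) = 0

/-- On the part `E` of `M`, the immersion `f` has infinitely many self-intersections, where points
of the same orbit of the rotations (points with the same distance to the axis and the same height)
are counted only once. -/
def InfinitelyManySelfIntersections (f : M → Amb m) (E : Set M) : Prop :=
  {c : ℝ × ℝ | ∃ p ∈ E, ∃ p' ∈ E, p ≠ p' ∧ f p = f p' ∧
    c = (‖hor (f p)‖, height (f p))}.Infinite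

/-- The distance to the axis is unbounded on `E`. -/
def UnboundedDistance (f : M → Amb m) (E : Set M) : Prop :=
  ¬ BddAbove ((fun p => ‖hor (f p)‖) '' E)

/-- `f` maps `E` injectively onto the graph of a smooth function over the exterior of a closed
ball of the horizontal hyperplane. -/
def IsExteriorGraph (f : M → Amb m) (E : Set M) : Prop :=
  InjOn f E ∧ ∃ (R : ℝ) (u : EuclideanSpace ℝ (Fin (m + 1)) → ℝ),
    0 < R ∧ ContDiffOn ℝ ∞ u {y | R < ‖y‖} ∧
    f '' E = {q | R < ‖hor q‖ ∧ height q = u (hor q)}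

end Hypersurface

/-- The end `s → ∞` of the hypersurface obtained by rotating the curve `(x, z)` goes to infinity
along the cylinder `C(r)` and converges to it, together with its tangent hyperplanes. -/
def ConvergesToCylinder (x z : ℝ → ℝ) (r : ℝ) : Prop :=
  Tendsto x atTop (𝓝 r) ∧ Tendsto (deriv x) atTop (𝓝 0) ∧ Tendsto z atTop atTop

end RotHyp

end

/-! Write `n = m + 1`. A rotational `H_lam`-hypersurface off the axis amounts to a unit-speed plane
curve with tangent `(u, v)` and curvature `κ = n (u + lam) - m v / x`. The state `(x, u, v)` then
solves an autonomous ODE whose only equilibrium is the cylinder: `x` equal to `radius m lam`, `u =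
0`, `v = 1`.

The flux `x ^ m * v - lam * x ^ (m + 1)` has derivative `n x ^ m u ^ 2 ≥ 0` along the curve, and for
`x ≥ 0`, `v ≤ 1` it attains its maximum only at the equilibrium (`flux_lt`). Since its derivative
degenerates where `u = 0`, it is corrected to a Lyapunov function growing at rate at least `x ^ m (u
^ 2 + (v κ x) ^ 2 / 2)` while `x` is bounded, which vanishes only at the equilibrium. By compactness
a curve spends only a bounded time where `x` is bounded and the flux lies between a lower bound and
a value below its maximum (`exists_dwell_time`). A lower bound on the flux bounds `x`. Hence
forwards in time the flux tends to its maximum and the state to the equilibrium; backwards, unless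
the curve is the cylinder, the flux tends to `-∞`, which forces `x → ∞`.

Far from the axis, `κ` is close to `n (u + lam)`. If `lam > 1` this is bounded below by a positive
constant, so the curve keeps turning; comparison with the limiting planar curve shows that a half
turn forwards and a half turn backwards from an outward horizontal tangent cross, arbitrarily far
away (`exists_self_intersection`). If `lam ≤ 1`, an inward arc far from the axis cannot be followed
and preceded by `u ≥ 0` (`no_inward_arc`), so `u < 0` near `-∞` and the end is a graph. For `lam <
1` with downward normals at horizontal points, `v` crosses zero only upwards, hence at most once;
the branches before and after the lowest point are separated by comparing their slopes at equal
radius (`branches_disjoint`).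

The geometric part reduces the hypersurface to such a curve. The normal agrees with the rotated
normal of the curve after a possible reversal of the parameter, the trace of the shape operator
gives the ODE, strictness of the flux excludes closed curves so that the parametrization is
injective, and completeness makes the parameter interval all of `ℝ` (`exists_profile`). -/

namespace RotHyp

/-! ### Profile curves in phase space and the flux. -/

/-- The curvature of the profile curve of a rotational `H_lam`-hypersurface, as a function of the
distance `x` to the axis and the unit tangent vector `(u, v)`. -/
noncomputable def curv (m : ℕ) (lam x u v : ℝ) : ℝ := ((m : ℝ) + 1) * (u + lam) - m * v / x

/-- The curve `(x, z)` with unit tangent vector `(u, v)` is the profile curve of a rotational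
`H_lam`-hypersurface over `J`. -/
structure IsProfileOn (m : ℕ) (lam : ℝ) (x u v z : ℝ → ℝ) (J : Set ℝ) : Prop where
  pos : ∀ s ∈ J, 0 < x s
  unit : ∀ s ∈ J, u s ^ 2 + v s ^ 2 = 1
  dx : ∀ s ∈ J, HasDerivAt x (u s) s
  dz : ∀ s ∈ J, HasDerivAt z (v s) s
  du : ∀ s ∈ J, HasDerivAt u (-(v s) * curv m lam (x s) (u s) (v s)) s
  dv : ∀ s ∈ J, HasDerivAt v (u s * curv m lam (x s) (u s) (v s)) s

/-- The flux of a point of the phase space. -/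
def flux (m : ℕ) (lam x v : ℝ) : ℝ := x ^ m * v - lam * x ^ (m + 1)

/-- The radius of the cylinder with mean curvature `lam`. -/
noncomputable def radius (m : ℕ) (lam : ℝ) : ℝ := (m : ℝ) / (lam * ((m : ℝ) + 1))

lemma curv_mul {m : ℕ} {lam x u v : ℝ} (hx : x ≠ 0) :
    curv m lam x u v * x = ((m : ℝ) + 1) * (u + lam) * x - m * v := by
  unfold curv; field_simp

lemma radius_pos {m : ℕ} (hm : 1 ≤ m) {lam : ℝ} (hlam : 0 < lam) : 0 < radius m lam := by
  have : (0 : ℝ) < m := by exact_mod_cast hm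
  unfold radius; positivity

lemma lam_mul_radius {m : ℕ} {lam : ℝ} (hlam : 0 < lam) :
    lam * ((m : ℝ) + 1) * radius m lam = m := by
  have : (0 : ℝ) < (m : ℝ) + 1 := by positivity
  unfold radius; field_simp

/-- The term `-m v / x` of the curvature cancels the derivative of `x ^ m`. The angle variable `a`
is kept separate from the speed `u` of `x`, since the comparison of two branches at equal radius
moves the second one with the radial speed of the first. -/
lemma hasDerivAt_monomial {m : ℕ} (hm : 1 ≤ m) {lam : ℝ} {x v : ℝ → ℝ} {s a u : ℝ}
    (hx : 0 < x s) (dx : HasDerivAt x u s)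
    (dv : HasDerivAt v (u * curv m lam (x s) a (v s)) s) :
    HasDerivAt (fun s => x s ^ m * v s) (((m : ℝ) + 1) * x s ^ m * u * (a + lam)) s := by
  obtain ⟨k, rfl⟩ : ∃ k, m = k + 1 := ⟨m - 1, by omega⟩
  refine ((dx.fun_pow (k + 1)).fun_mul dv).congr_deriv ?_
  simp only [curv, Nat.add_sub_cancel]
  push_cast
  field_simp
  ring

lemma hasDerivAt_flux {m : ℕ} (hm : 1 ≤ m) {lam : ℝ} {x v : ℝ → ℝ} {s u : ℝ}
    (hx : 0 < x s) (dx : HasDerivAt x u s)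
    (dv : HasDerivAt v (u * curv m lam (x s) u (v s)) s) :
    HasDerivAt (fun s => flux m lam (x s) (v s)) (((m : ℝ) + 1) * x s ^ m * u ^ 2) s := by
  unfold flux
  refine ((hasDerivAt_monomial hm hx dx dv).fun_sub
    ((dx.fun_pow (m + 1)).const_mul lam)).congr_deriv ?_
  simp only [Nat.add_sub_cancel]
  push_cast
  ring

/-- The flux attains its maximum only on the cylinder. -/
lemma flux_lt {m : ℕ} (hm : 1 ≤ m) {lam : ℝ} (hlam : 0 < lam) {x v : ℝ} (hx : 0 ≤ x)
    (hv : v ≤ 1) (h : ¬(x = radius m lam ∧ v = 1)) :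
    flux m lam x v < flux m lam (radius m lam) 1 := by
  have hr := radius_pos hm hlam
  have hl := lam_mul_radius (m := m) hlam
  have hm0 : (0 : ℝ) < m := by exact_mod_cast hm
  set r := radius m lam
  have key : ∀ y : ℝ, 0 ≤ y → y ≠ r → flux m lam y 1 < flux m lam r 1 := by
    intro y hy hne
    have hconv : StrictConvexOn ℝ (Ici 0) fun x : ℝ => x ^ (m + 1) :=
      strictConvexOn_pow (by omega)
    -- Multiplying by `r` trades `lam * r` for `m / (m + 1)`. The inequality becomes homogeneous in
    -- `r` and `y` and reduces to Bernoulli for `r / y` with exponent `m + 1`.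
    have hfl : ∀ w : ℝ, r * (w ^ m - lam * w ^ (m + 1)) =
        r * w ^ m - m / (m + 1) * w ^ (m + 1) := by
      intro w
      have : lam * r = m / (m + 1) := by field_simp; linarith
      rw [mul_sub, ← mul_assoc, mul_comm r lam, this]
    rcases hy.eq_or_lt with rfl | hy
    · unfold flux
      have : 0 < r * (r ^ m - lam * r ^ (m + 1)) := by
        rw [hfl]
        have : r * r ^ m - m / (m + 1) * r ^ (m + 1) = r ^ (m + 1) / (m + 1) := by
          field_simp; ring
        rw [this]; positivity
      have h2 : 0 < r ^ m - lam * r ^ (m + 1) := (mul_pos_iff_of_pos_left hr).1 this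
      have h0 : (0 : ℝ) ^ m = 0 := zero_pow (by omega)
      simp [h0]
      linarith
    · -- Bernoulli for `r / y`
      have hb : 1 + ((m + 1 : ℕ) : ℝ) * (r / y - 1) < (1 + (r / y - 1)) ^ (m + 1) := by
        have h1 : r / y ≠ 1 := by
          rw [Ne, div_eq_one_iff_eq hy.ne']; exact fun h => hne h.symm
        have hs := StrictConvexOn.lt_slope_of_hasDerivAt hconv (x := 1) (y := r / y)
          (f' := m + 1)
        have hs' := StrictConvexOn.slope_lt_of_hasDerivAt hconv (x := r / y) (y := 1)
          (f' := m + 1)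
        have hd : HasDerivAt (fun x : ℝ => x ^ (m + 1)) (m + 1 : ℝ) 1 := by
          simpa using hasDerivAt_pow (m + 1) (1 : ℝ)
        have hq : 0 < r / y := by positivity
        rcases lt_or_gt_of_ne h1 with h1 | h1
        · have := hs' hq.le (by simp) h1 hd
          rw [slope_def_field, div_lt_iff₀ (by linarith)] at this
          push_cast
          simp only [one_pow, add_sub_cancel] at this ⊢
          nlinarith
        · have := hs (by simp) hq.le h1 hd
          rw [slope_def_field, lt_div_iff₀ (by linarith)] at this
          push_cast
          simp only [one_pow, add_sub_cancel] at this ⊢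
          nlinarith
      rw [add_sub_cancel, div_pow, lt_div_iff₀ (by positivity)] at hb
      have hlt : r * (y ^ m - lam * y ^ (m + 1)) < r * (r ^ m - lam * r ^ (m + 1)) := by
        rw [hfl, hfl]
        have e1 : (1 + ((m + 1 : ℕ) : ℝ) * (r / y - 1)) * y ^ (m + 1) =
            (m + 1) * (r * y ^ m) - m * y ^ (m + 1) := by
          push_cast; field_simp; ring
        rw [e1] at hb
        have e2 : r * y ^ m - m / (m + 1) * y ^ (m + 1) =
            ((m + 1) * (r * y ^ m) - m * y ^ (m + 1)) / (m + 1) := by field_simp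
        have e3 : r * r ^ m - m / (m + 1) * r ^ (m + 1) = r ^ (m + 1) / (m + 1) := by
          field_simp; ring
        rw [e2, e3]
        gcongr
      unfold flux
      have := lt_of_mul_lt_mul_left hlt hr.le
      linarith
  have hle : flux m lam x v ≤ flux m lam x 1 := by
    unfold flux
    have := mul_le_mul_of_nonneg_left hv (pow_nonneg hx m)
    linarith
  by_cases hxr : x = r
  · have hv' : v < 1 := lt_of_le_of_ne hv fun h' => h ⟨hxr, h'⟩
    rw [hxr]
    unfold flux
    have := mul_lt_mul_of_pos_left hv' (pow_pos hr m)
    linarith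
  · exact hle.trans_lt (key x hx hxr)

lemma flux_le {m : ℕ} (hm : 1 ≤ m) {lam : ℝ} (hlam : 0 < lam) {x v : ℝ} (hx : 0 ≤ x)
    (hv : v ≤ 1) : flux m lam x v ≤ flux m lam (radius m lam) 1 := by
  by_cases h : x = radius m lam ∧ v = 1
  · rw [h.1, h.2]
  · exact (flux_lt hm hlam hx hv h).le

namespace IsProfileOn

variable {m : ℕ} {lam : ℝ} {x u v z : ℝ → ℝ} {J : Set ℝ}

lemma abs_u_le (h : IsProfileOn m lam x u v z J) {s : ℝ} (hs : s ∈ J) : |u s| ≤ 1 := by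
  rw [abs_le_one_iff_mul_self_le_one]; nlinarith [h.unit s hs, sq_nonneg (v s)]

lemma abs_v_le (h : IsProfileOn m lam x u v z J) {s : ℝ} (hs : s ∈ J) : |v s| ≤ 1 := by
  rw [abs_le_one_iff_mul_self_le_one]; nlinarith [h.unit s hs, sq_nonneg (u s)]

lemma flux_hasDerivAt (h : IsProfileOn m lam x u v z J) (hm : 1 ≤ m) {s : ℝ} (hs : s ∈ J) :
    HasDerivAt (fun s => flux m lam (x s) (v s)) (((m : ℝ) + 1) * x s ^ m * u s ^ 2) s :=
  hasDerivAt_flux hm (h.pos s hs) (h.dx s hs) (h.dv s hs)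

lemma flux_monotoneOn (h : IsProfileOn m lam x u v z J) (hm : 1 ≤ m) (hJ : J.OrdConnected) :
    MonotoneOn (fun s => flux m lam (x s) (v s)) J := by
  refine monotoneOn_of_hasDerivWithinAt_nonneg hJ.convex
    (fun s hs => (h.flux_hasDerivAt hm hs).continuousAt.continuousWithinAt)
    (fun s hs => (h.flux_hasDerivAt hm (interior_subset hs)).hasDerivWithinAt) fun s hs => ?_
  have := h.pos s (interior_subset hs)
  positivity

/-- A profile curve is not closed. -/
lemma not_closed (h : IsProfileOn m lam x u v z J) (hm : 1 ≤ m) (hlam : 0 < lam)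
    (hJ : J.OrdConnected) {s t : ℝ}
    (hs : s ∈ J) (ht : t ∈ J) (hst : s < t) (hx : x s = x t) (hv : v s = v t)
    (hz : z s = z t) : False := by
  have hsub : Icc s t ⊆ J := hJ.out hs ht
  have hI : IsProfileOn m lam x u v z (Icc s t) :=
    ⟨fun a ha => h.pos a (hsub ha), fun a ha => h.unit a (hsub ha), fun a ha => h.dx a (hsub ha),
      fun a ha => h.dz a (hsub ha), fun a ha => h.du a (hsub ha), fun a ha => h.dv a (hsub ha)⟩
  have hmono := hI.flux_monotoneOn hm ordConnected_Icc
  -- The monotone flux takes the same value at both ends, so it is constant and its derivative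
  -- forces `u = 0` in between.
  have hconst : ∀ a ∈ Icc s t, flux m lam (x a) (v a) = flux m lam (x s) (v s) := by
    intro a ha
    have h1 := hmono (left_mem_Icc.2 hst.le) ha ha.1
    have h2 := hmono ha (right_mem_Icc.2 hst.le) ha.2
    simp only [← hx, ← hv] at h1 h2
    exact le_antisymm h2 h1
  have hu : ∀ a ∈ Ioo s t, u a = 0 := by
    intro a ha
    have hd := hI.flux_hasDerivAt hm (Ioo_subset_Icc_self ha)
    have hz : HasDerivAt (fun s => flux m lam (x s) (v s)) 0 a := by
      refine (hasDerivAt_const a (flux m lam (x s) (v s))).congr_of_eventuallyEq ?_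
      filter_upwards [Ioo_mem_nhds ha.1 ha.2] with b hb
      exact hconst b (Ioo_subset_Icc_self hb)
    have hp := hI.pos a (Ioo_subset_Icc_self ha)
    have := hd.unique hz
    have h3 : 0 < ((m : ℝ) + 1) * x a ^ m := by positivity
    exact pow_eq_zero_iff (two_ne_zero) |>.1 ((mul_eq_zero.1 this).resolve_left h3.ne')
  -- With `u` identically zero the curvature vanishes too, so `m v / x = (m + 1) lam > 0`. The curve
  -- rises vertically and cannot return to its height.
  have hv1 : ∀ a ∈ Ioo s t, 0 < v a := by
    intro a ha
    have hd := hI.du a (Ioo_subset_Icc_self ha)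
    have hz : HasDerivAt u 0 a := by
      refine (hasDerivAt_const a (0 : ℝ)).congr_of_eventuallyEq ?_
      filter_upwards [Ioo_mem_nhds ha.1 ha.2] with b hb
      exact hu b hb
    have hp := hI.pos a (Ioo_subset_Icc_self ha)
    have hun := hI.unit a (Ioo_subset_Icc_self ha)
    have h0 := hd.unique hz
    have hv0 : v a ≠ 0 := by
      intro h0; rw [h0, hu a ha] at hun; norm_num at hun
    have hK : curv m lam (x a) (u a) (v a) = 0 := by
      rcases mul_eq_zero.1 h0 with h0 | h0
      · exact absurd (neg_eq_zero.1 h0) hv0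
      · exact h0
    rw [curv, hu a ha, zero_add, sub_eq_zero] at hK
    by_contra hneg
    have : (m : ℝ) * v a / x a ≤ 0 :=
      div_nonpos_of_nonpos_of_nonneg
        (mul_nonpos_of_nonneg_of_nonpos (Nat.cast_nonneg m) (not_lt.1 hneg)) hp.le
    have h4 : 0 < ((m : ℝ) + 1) * lam := by positivity
    linarith
  have : StrictMonoOn z (Icc s t) :=
    strictMonoOn_of_hasDerivWithinAt_pos (convex_Icc s t)
      (fun a ha => (hI.dz a ha).continuousAt.continuousWithinAt)
      (fun a ha => (hI.dz a (interior_subset ha)).hasDerivWithinAt)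
      (fun a ha => hv1 a (by rwa [interior_Icc] at ha))
  have := this (left_mem_Icc.2 hst.le) (right_mem_Icc.2 hst.le) hst
  linarith

end IsProfileOn

/-! ### The Lyapunov function. -/

/-- The curvature times the distance to the axis. -/
def scaledCurv (m : ℕ) (lam x u v : ℝ) : ℝ := ((m : ℝ) + 1) * (u + lam) * x - m * v

/-- A lower bound for the growth of the Lyapunov function. -/
noncomputable def dissipation (m : ℕ) (lam x u v : ℝ) : ℝ :=
  x ^ m * (u ^ 2 + (v * scaledCurv m lam x u v) ^ 2 / 2)

/-- The Lyapunov function with parameter `N`. -/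
def lyapunov (m : ℕ) (lam N x u v : ℝ) : ℝ :=
  N * flux m lam x v - x ^ (m + 1) * u * v * scaledCurv m lam x u v

lemma abs_scaledCurv_le {m : ℕ} {lam x u v X : ℝ} (hlam : 0 < lam) (hx : 0 < x) (hX : x ≤ X)
    (hu : |u| ≤ 1) (hv : |v| ≤ 1) :
    |scaledCurv m lam x u v| ≤ ((m : ℝ) + 1) * (1 + lam) * X + m := by
  have h1 : |((m : ℝ) + 1) * (u + lam) * x| ≤ ((m : ℝ) + 1) * (1 + lam) * X := by
    rw [abs_mul, abs_mul, abs_of_pos hx, abs_of_pos (by positivity : (0 : ℝ) < (m : ℝ) + 1)]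
    have : |u + lam| ≤ 1 + lam := (abs_add_le _ _).trans (by rw [abs_of_pos hlam]; linarith)
    gcongr
  have h2 : |(m : ℝ) * v| ≤ m := by
    rw [abs_mul, Nat.abs_cast]
    exact mul_le_of_le_one_right (Nat.cast_nonneg m) hv
  exact (abs_sub _ _).trans (add_le_add h1 h2)

lemma dissipation_nonneg {m : ℕ} {lam x u v : ℝ} (hx : 0 < x) : 0 ≤ dissipation m lam x u v := by
  unfold dissipation; positivity

/-- Pure algebra, with `P = x ^ m`, curvature `k` and scaled curvature `q`. The point is the square
`(v * q) ^ 2` with a positive sign, produced by differentiating `u` in the correction term; all else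
is a multiple of `u ^ 2`, except one mixed term. -/
lemma lyapunov_deriv_eq {N P x u v k q lam m n : ℝ} (hn : n = m + 1) (hkq : k * x = q)
    (hq : n * (u + lam) * x = q + m * v) :
    N * (n * P * u ^ 2) -
      (((n * P * u * u + P * x * (-v * k)) * v + P * x * u * (u * k)) * q +
        P * x * u * v * (n * (-v * k) * x + n * (u + lam) * u - m * (u * k))) =
      P * (u ^ 2 * (N * n - 2 * (v * q) - q ^ 2 - m * v ^ 2) + (v * q) ^ 2 +
        n * x * u * v * (v * q)) := by
  linear_combination (P * (v ^ 2 * q - u ^ 2 * q + n * x * u * v ^ 2 + m * u ^ 2 * v)) * hkq -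
    (P * u ^ 2 * v) * hq - (P * u ^ 2 * v * q) * hn

/-- Young's inequality, absorbing the mixed term into half of `(v * q) ^ 2` and a multiple of `u ^
2`. -/
lemma neg_young_le {n x X u v y : ℝ} (hx : x ^ 2 ≤ X ^ 2) (hv : v ^ 2 ≤ 1) :
    -(n ^ 2 * X ^ 2 / 2 * u ^ 2) - y ^ 2 / 2 ≤ n * x * u * v * y := by
  have h1 : x ^ 2 * v ^ 2 ≤ X ^ 2 := by nlinarith [sq_nonneg x, sq_nonneg v]
  have h2 : n ^ 2 * (x ^ 2 * v ^ 2) * u ^ 2 ≤ n ^ 2 * X ^ 2 * u ^ 2 := by gcongr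
  have h3 : 0 ≤ n ^ 2 * (x ^ 2 * v ^ 2) * u ^ 2 + 2 * (n * x * u * v * y) + y ^ 2 := by
    linarith [sq_nonneg (n * x * u * v + y)]
  linarith

/-- The flux alone controls only `u ^ 2`; the correction term supplies `(v * q) ^ 2`. While `x ≤ X`
all error terms are bounded multiples of `u ^ 2`, which a large multiple of the flux dominates. -/
lemma exists_lyapunov (m : ℕ) (hm : 1 ≤ m) {lam : ℝ} (hlam : 0 < lam) (X : ℝ) :
    ∃ N : ℝ, ∀ {x u v z : ℝ → ℝ} {J : Set ℝ}, IsProfileOn m lam x u v z J → ∀ s ∈ J, x s ≤ X →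
      ∃ d, HasDerivAt (fun s => lyapunov m lam N (x s) (u s) (v s)) d s ∧
        dissipation m lam (x s) (u s) (v s) ≤ d := by
  set n : ℝ := (m : ℝ) + 1 with hn
  have hn1 : 1 ≤ n := by simp [hn]
  set C : ℝ := n * (1 + lam) * X + m with hC
  -- `C` bounds the scaled curvature. The summands pay, in order, for the `u ^ 2` in the
  -- dissipation, for `2 v q`, `q ^ 2` and `m v ^ 2`, and for the Young term.
  set N : ℝ := 1 + 2 * C + C ^ 2 + m + n ^ 2 * X ^ 2 / 2 with hN
  refine ⟨N, fun {x u v z J} h s hs hX => ?_⟩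
  have hx := h.pos s hs
  set k := curv m lam (x s) (u s) (v s) with hk
  set q := scaledCurv m lam (x s) (u s) (v s) with hq
  have hkq : k * x s = q := curv_mul hx.ne'
  have dq : HasDerivAt (fun s => scaledCurv m lam (x s) (u s) (v s))
      (n * (-(v s) * k) * x s + n * (u s + lam) * u s - m * (u s * k)) s := by
    unfold scaledCurv
    exact (((((h.du s hs).add_const lam).const_mul n).fun_mul (h.dx s hs)).fun_sub
      ((h.dv s hs).const_mul (m : ℝ)))
  have dF := h.flux_hasDerivAt hm hs
  have dP := (((h.dx s hs).fun_pow (m + 1)).fun_mul (h.du s hs)).fun_mul (h.dv s hs)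
  have dG := (dF.const_mul N).fun_sub (dP.fun_mul dq)
  refine ⟨_, dG, ?_⟩
  have hq' : n * (u s + lam) * x s = q + m * v s := by rw [hq, scaledCurv]; ring
  have e := lyapunov_deriv_eq (N := N) (P := x s ^ m) hn hkq hq'
  simp only [Nat.add_sub_cancel, pow_succ (x s) m, Nat.cast_add, Nat.cast_one]
  rw [← hn, e, dissipation]
  refine mul_le_mul_of_nonneg_left ?_ (by positivity)
  have hv := h.abs_v_le hs
  have hu := h.abs_u_le hs
  have hqC : |q| ≤ C := abs_scaledCurv_le hlam hx hX hu hv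
  have hvq : |v s * q| ≤ C := by
    rw [abs_mul]; exact (mul_le_of_le_one_left (abs_nonneg _) hv).trans hqC
  have hvq' := (abs_le.1 hvq).2
  have hq2 : q ^ 2 ≤ C ^ 2 := sq_le_sq' (by linarith [(abs_le.1 hqC).1]) (abs_le.1 hqC).2
  have hv2 : v s ^ 2 ≤ 1 := by nlinarith [h.unit s hs, sq_nonneg (u s)]
  have hx2 : x s ^ 2 ≤ X ^ 2 := by gcongr
  have hmv : (m : ℝ) * v s ^ 2 ≤ m := mul_le_of_le_one_right (Nat.cast_nonneg m) hv2
  have h1 := neg_young_le (n := n) (u := u s) (y := v s * q) hx2 hv2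
  have hN1 : 1 + n ^ 2 * X ^ 2 / 2 ≤ N * n - 2 * (v s * q) - q ^ 2 - m * v s ^ 2 := by
    have hC0 : 0 ≤ C := (abs_nonneg _).trans hqC
    have : N ≤ N * n := le_mul_of_one_le_right (by positivity) hn1
    linarith
  have := mul_le_mul_of_nonneg_left hN1 (sq_nonneg (u s))
  linarith

/-! ### Dwell time estimates and bounds from the flux. -/

/-- Below this distance to the axis, the distance is a uniformly convex function. -/
noncomputable def inner_radius (m : ℕ) (lam : ℝ) : ℝ := 1 / (2 * (((m : ℝ) + 1) * (1 + lam)))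

lemma inner_radius_pos (m : ℕ) {lam : ℝ} (hlam : 0 < lam) : 0 < inner_radius m lam := by
  unfold inner_radius; positivity

namespace IsProfileOn

variable {m : ℕ} {lam : ℝ} {x u v z : ℝ → ℝ}

/-- While `x` is below the inner radius `δ`, the derivative of `x * u` is at least `1 - 1 / 2`,
because `u ^ 2 + m v ^ 2 ≥ 1`. But `|x * u| ≤ δ`, so this lasts at most a time `4 δ`. -/
lemma exists_inner_radius_le (h : IsProfileOn m lam x u v z univ) (hm : 1 ≤ m) (hlam : 0 < lam)
    (a : ℝ) : ∃ s ∈ Icc a (a + (4 * inner_radius m lam + 1)), inner_radius m lam ≤ x s := by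
  set δ := inner_radius m lam with hδ
  have hδ0 : 0 < δ := inner_radius_pos m hlam
  by_contra! hcon
  have hd : ∀ s, HasDerivAt (fun s => x s * u s)
      (u s * u s + x s * (-(v s) * curv m lam (x s) (u s) (v s))) s := fun s =>
    (h.dx s trivial).fun_mul (h.du s trivial)
  have hmono : MonotoneOn (fun s => x s * u s - s / 2) (Icc a (a + (4 * δ + 1))) := by
    refine monotoneOn_of_hasDerivWithinAt_nonneg (convex_Icc _ _)
      (fun s _ => ((hd s).sub ((hasDerivAt_id s).div_const 2)).continuousAt.continuousWithinAt)
      (fun s _ => ((hd s).sub ((hasDerivAt_id s).div_const 2)).hasDerivWithinAt) fun s hs => ?_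
    rw [interior_Icc] at hs
    have hxs := hcon s (Ioo_subset_Icc_self hs)
    have hp := h.pos s trivial
    have hun := h.unit s trivial
    have hk : curv m lam (x s) (u s) (v s) * x s = _ := curv_mul hp.ne'
    have e : u s * u s + x s * (-(v s) * curv m lam (x s) (u s) (v s)) =
        u s ^ 2 + m * v s ^ 2 - ((m : ℝ) + 1) * (u s + lam) * v s * x s := by
      linear_combination (-(v s)) * hk
    rw [e]
    have hm' : (1 : ℝ) ≤ m := by exact_mod_cast hm
    have h1 : (u s + lam) * v s ≤ 1 + lam := by
      have := h.abs_v_le (mem_univ s)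
      have h2 := h.abs_u_le (mem_univ s)
      rw [abs_le] at this h2
      nlinarith
    have h2 : ((m : ℝ) + 1) * (u s + lam) * v s * x s ≤ 1 / 2 := by
      calc ((m : ℝ) + 1) * (u s + lam) * v s * x s
          = ((m : ℝ) + 1) * ((u s + lam) * v s) * x s := by ring
        _ ≤ ((m : ℝ) + 1) * (1 + lam) * x s := by gcongr
        _ ≤ ((m : ℝ) + 1) * (1 + lam) * δ := by gcongr
        _ = 1 / 2 := by rw [hδ, inner_radius]; field_simp
    nlinarith [sq_nonneg (v s)]
  have hle : a ≤ a + (4 * δ + 1) := by linarith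
  have h1 := hmono (left_mem_Icc.2 hle) (right_mem_Icc.2 hle) hle
  have hb : ∀ s ∈ Icc a (a + (4 * δ + 1)), |x s * u s| ≤ δ := by
    intro s hs
    rw [abs_mul, abs_of_pos (h.pos s trivial)]
    have := h.abs_u_le (mem_univ s)
    have hp := h.pos s trivial
    nlinarith [hcon s hs]
  have h2 := abs_le.1 (hb _ (left_mem_Icc.2 hle))
  have h3 := abs_le.1 (hb _ (right_mem_Icc.2 hle))
  simp only at h1
  linarith

lemma abs_x_sub_le (h : IsProfileOn m lam x u v z univ) (s t : ℝ) : |x t - x s| ≤ |t - s| := by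
  have := Convex.norm_image_sub_le_of_norm_hasDerivWithin_le (f := x) (f' := u) (C := 1)
    (s := univ) (x := s) (y := t) (fun a _ => (h.dx a trivial).hasDerivWithinAt)
    (fun a _ => h.abs_u_le (mem_univ a)) convex_univ trivial trivial
  simpa using this

end IsProfileOn

/-- Compactness. Zero dissipation with `x > 0` means `u = 0` and zero scaled curvature; `v = -1` is
impossible there, and `v = 1` gives the cylinder, where the flux is maximal. The lower bound on `x`
is essential because dissipation carries the factor `x ^ m`. -/
lemma exists_dissipation_bound (m : ℕ) {lam : ℝ} (hlam : 0 < lam) (X ε : ℝ) (hε : 0 < ε) :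
    ∃ c > 0, ∀ x u v : ℝ, inner_radius m lam / 2 ≤ x → x ≤ X → u ^ 2 + v ^ 2 = 1 →
      flux m lam x v ≤ flux m lam (radius m lam) 1 - ε → c ≤ dissipation m lam x u v := by
  set δ := inner_radius m lam with hδ
  have hδ0 : 0 < δ := inner_radius_pos m hlam
  set K : Set (ℝ × ℝ × ℝ) := {p | δ / 2 ≤ p.1 ∧ p.1 ≤ X ∧ p.2.1 ^ 2 + p.2.2 ^ 2 = 1 ∧
      flux m lam p.1 p.2.2 ≤ flux m lam (radius m lam) 1 - ε}
  have hcl : IsClosed K := by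
    have hf : Continuous fun p : ℝ × ℝ × ℝ => flux m lam p.1 p.2.2 := by
      unfold flux; fun_prop
    refine (isClosed_le continuous_const continuous_fst).inter
      ((isClosed_le continuous_fst continuous_const).inter
      ((isClosed_eq (by fun_prop) continuous_const).inter (isClosed_le hf continuous_const)))
  have hK : IsCompact K := by
    refine IsCompact.of_isClosed_subset
      ((isCompact_Icc (a := δ / 2) (b := X)).prod
        ((isCompact_Icc (a := (-1 : ℝ)) (b := 1)).prod (isCompact_Icc (a := (-1 : ℝ)) (b := 1))))
      hcl ?_
    rintro ⟨x, u, v⟩ ⟨h1, h2, h3, -⟩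
    simp only at h1 h2 h3
    refine ⟨⟨h1, h2⟩, ⟨?_, ?_⟩, ⟨?_, ?_⟩⟩ <;> simp only <;> nlinarith [sq_nonneg u, sq_nonneg v]
  have hpos : ∀ p ∈ K, 0 < dissipation m lam p.1 p.2.1 p.2.2 := by
    rintro ⟨x, u, v⟩ ⟨h1, h2, h3, h4⟩
    simp only at h1 h2 h3 h4 ⊢
    have hx : 0 < x := by linarith
    refine (dissipation_nonneg hx).lt_of_ne fun h0 => ?_
    rw [dissipation, eq_comm, mul_eq_zero] at h0
    have h0 := h0.resolve_left (by positivity)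
    have hu : u = 0 := by
      have : u ^ 2 = 0 := by
        nlinarith [sq_nonneg u, sq_nonneg (v * scaledCurv m lam x u v)]
      exact pow_eq_zero_iff two_ne_zero |>.1 this
    have hq : v * scaledCurv m lam x u v = 0 := by
      have : (v * scaledCurv m lam x u v) ^ 2 = 0 := by
        nlinarith [sq_nonneg u, sq_nonneg (v * scaledCurv m lam x u v)]
      exact pow_eq_zero_iff two_ne_zero |>.1 this
    subst hu
    have hv0 : v ≠ 0 := by rintro rfl; norm_num at h3
    have hq := (mul_eq_zero.1 hq).resolve_left hv0
    rw [scaledCurv, zero_add] at hq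
    have hv : v = 1 := by
      have : (v - 1) * (v + 1) = 0 := by nlinarith
      rcases mul_eq_zero.1 this with h | h
      · linarith
      · have hv : v = -1 := by linarith
        rw [hv] at hq
        have : 0 < ((m : ℝ) + 1) * lam * x := by positivity
        have := Nat.cast_nonneg (α := ℝ) m
        linarith
    have hx' : x = radius m lam := by
      rw [radius, eq_div_iff (by positivity)]
      rw [hv] at hq; linarith
    rw [hv, hx'] at h4
    linarith
  have hcont : Continuous fun p : ℝ × ℝ × ℝ => dissipation m lam p.1 p.2.1 p.2.2 := by
    unfold dissipation scaledCurv; fun_prop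
  rcases K.eq_empty_or_nonempty with hE | hne
  · exact ⟨1, one_pos, fun x u v h1 h2 h3 h4 =>
      absurd (show (x, u, v) ∈ K from ⟨h1, h2, h3, h4⟩) (by rw [hE]; exact notMem_empty _)⟩
  · obtain ⟨p, hp, hmin⟩ := hK.exists_isMinOn hne hcont.continuousOn
    exact ⟨_, hpos p hp, fun x u v h1 h2 h3 h4 => hmin (show (x, u, v) ∈ K from ⟨h1, h2, h3, h4⟩)⟩

/-- The time that a profile curve spends in a region of the phase space in which the distance to
the axis is bounded and the flux stays away from its maximum is bounded. -/
lemma exists_dwell_time (m : ℕ) (hm : 1 ≤ m) {lam : ℝ} (hlam : 0 < lam) (X c ε : ℝ)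
    (hε : 0 < ε) : ∃ T > 0, ∀ {x u v z : ℝ → ℝ}, IsProfileOn m lam x u v z univ → ∀ a : ℝ,
      ¬ ∀ s ∈ Icc a (a + T), x s ≤ X ∧ c ≤ flux m lam (x s) (v s) ∧
        flux m lam (x s) (v s) ≤ flux m lam (radius m lam) 1 - ε := by
  obtain ⟨N, hN⟩ := exists_lyapunov m hm hlam X
  obtain ⟨κ, hκ, hdis⟩ := exists_dissipation_bound m hlam X ε hε
  set δ := inner_radius m lam with hδ
  have hδ0 : 0 < δ := inner_radius_pos m hlam
  -- A window of length `L` contains a time with `x ≥ δ`, followed by a further time `δ / 2` inside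
  -- the window; there `x ≥ δ / 2`, as `x` is `1`-Lipschitz. Each window thus raises the Lyapunov
  -- function by at least `κ * (δ / 2)`.
  set L := 4 * δ + 1 + δ / 2 with hL
  have hL0 : 0 < L := by positivity
  set B := |N| * (|c| + |flux m lam (radius m lam) 1 - ε|) +
    X ^ (m + 1) * (((m : ℝ) + 1) * (1 + lam) * X + m) with hB
  -- After `k` windows the accumulated gain exceeds `2 * B`, the largest possible oscillation of the
  -- Lyapunov function.
  obtain ⟨k, hk⟩ := exists_nat_gt (2 * B / (κ * (δ / 2)))
  refine ⟨(k + 1) * L, by positivity, fun {x u v z} h a hcon => ?_⟩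
  set G := fun s => lyapunov m lam N (x s) (u s) (v s) with hG
  have hbound : ∀ s ∈ Icc a (a + (k + 1) * L), |G s| ≤ B := by
    intro s hs
    obtain ⟨h1, h2, h3⟩ := hcon s hs
    have hp := h.pos s trivial
    have hf : |flux m lam (x s) (v s)| ≤ |c| + |flux m lam (radius m lam) 1 - ε| := by
      rw [abs_le]
      constructor
      · linarith [neg_abs_le c, abs_nonneg (flux m lam (radius m lam) 1 - ε)]
      · linarith [le_abs_self (flux m lam (radius m lam) 1 - ε), abs_nonneg c]
    refine (abs_sub _ _).trans (add_le_add ?_ ?_)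
    · rw [abs_mul]; gcongr
    · rw [abs_mul, abs_mul, abs_mul, abs_of_pos (pow_pos hp _)]
      have e1 := h.abs_u_le (mem_univ s)
      have e2 := h.abs_v_le (mem_univ s)
      have e3 := abs_scaledCurv_le (m := m) hlam hp h1 e1 e2
      have e4 : x s ^ (m + 1) ≤ X ^ (m + 1) := by gcongr
      have hX0 : 0 < X := hp.trans_le h1
      calc x s ^ (m + 1) * |u s| * |v s| * |scaledCurv m lam (x s) (u s) (v s)|
          ≤ X ^ (m + 1) * 1 * 1 * (((m : ℝ) + 1) * (1 + lam) * X + m) := by gcongr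
        _ = _ := by ring
  have hder : ∀ s ∈ Icc a (a + (k + 1) * L), ∃ d, HasDerivAt G d s ∧
      dissipation m lam (x s) (u s) (v s) ≤ d := fun s hs => hN h s trivial (hcon s hs).1
  choose! d hd hdd using hder
  have hmono : MonotoneOn G (Icc a (a + (k + 1) * L)) := by
    refine monotoneOn_of_hasDerivWithinAt_nonneg (convex_Icc _ _)
      (fun s hs => (hd s hs).continuousAt.continuousWithinAt)
      (fun s hs => (hd s (interior_subset hs)).hasDerivWithinAt) fun s hs => ?_
    exact (dissipation_nonneg (h.pos s trivial)).trans (hdd s (interior_subset hs))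
  have hstep : ∀ b, a ≤ b → b + L ≤ a + (k + 1) * L → G b + κ * (δ / 2) ≤ G (b + L) := by
    intro b hb hbL
    obtain ⟨t, ht, hxt⟩ := h.exists_inner_radius_le hm hlam b
    have ht1 : b ≤ t := ht.1
    have ht2 : t + δ / 2 ≤ b + L := by rw [hL]; linarith [ht.2]
    have hsub : Icc t (t + δ / 2) ⊆ Icc a (a + (k + 1) * L) :=
      Icc_subset_Icc (hb.trans ht1) (ht2.trans hbL)
    have hm2 : MonotoneOn (fun s => G s - κ * s) (Icc t (t + δ / 2)) := by
      refine monotoneOn_of_hasDerivWithinAt_nonneg (convex_Icc _ _)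
        (f' := fun s => d s - κ)
        (fun s hs => (((hd s (hsub hs)).continuousAt).sub (by fun_prop)).continuousWithinAt)
        (fun s hs => ?_) fun s hs => ?_
      · have := (hd s (hsub (interior_subset hs))).fun_sub ((hasDerivAt_id' s).const_mul κ)
        rw [mul_one] at this
        exact this.hasDerivWithinAt
      · have hs' := interior_subset hs
        obtain ⟨h1, -, h3⟩ := hcon s (hsub hs')
        have hxs : δ / 2 ≤ x s := by
          have h4 := abs_le.1 (h.abs_x_sub_le t s)
          rw [abs_of_nonneg (by linarith [hs'.1])] at h4
          linarith [h4.1, hs'.2]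
        linarith [hdd s (hsub hs'), hdis _ _ _ hxs h1 (h.unit s trivial) h3]
    have h1 := hm2 (left_mem_Icc.2 (by linarith)) (right_mem_Icc.2 (by linarith))
      (by linarith : t ≤ t + δ / 2)
    have h2 := hmono (a := b) (b := t) ⟨hb, by linarith⟩ (hsub (left_mem_Icc.2 (by linarith))) ht1
    have h3 := hmono (a := t + δ / 2) (b := b + L) (hsub (right_mem_Icc.2 (by linarith)))
      ⟨by linarith, hbL⟩ ht2
    simp only at h1
    linarith
  have hind : ∀ j : ℕ, j ≤ k + 1 → G a + j * (κ * (δ / 2)) ≤ G (a + j * L) := by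
    intro j
    induction j with
    | zero => simp
    | succ j ih =>
      intro hj
      have hj' : (j : ℝ) + 1 ≤ k + 1 := by exact_mod_cast hj
      have h1 := ih (by omega)
      have h2 := hstep (a + j * L) (by have : 0 ≤ (j : ℝ) * L := by positivity
                                       linarith)
        (by have := mul_le_mul_of_nonneg_right hj' hL0.le
            linarith)
      have e : a + j * L + L = a + ((j + 1 : ℕ) : ℝ) * L := by push_cast; ring
      rw [e] at h2
      push_cast at h2 ⊢
      linarith
  have h1 := hind k (by omega)
  have hkL : (k : ℝ) * L ≤ (k + 1) * L := by nlinarith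
  have hkL0 : 0 ≤ (k : ℝ) * L := by positivity
  have h2 := abs_le.1 (hbound a ⟨le_rfl, by linarith⟩)
  have h3 := abs_le.1 (hbound (a + k * L) ⟨by linarith, by linarith⟩)
  rw [div_lt_iff₀ (by positivity)] at hk
  linarith

/-- For `x > 1` and `lam * x > 1 + |c|`, the flux is at most `x ^ m * (1 - lam * x) < -|c|`. -/
lemma le_of_le_flux {m : ℕ} {lam x v c : ℝ} (hlam : 0 < lam) (hx : 0 < x) (hv : v ≤ 1)
    (h : c ≤ flux m lam x v) : x ≤ max 1 ((1 + |c|) / lam) := by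
  by_contra! hcon
  obtain ⟨h1, h2⟩ := max_lt_iff.1 hcon
  rw [div_lt_iff₀ hlam] at h2
  have hp : 1 ≤ x ^ m := one_le_pow₀ h1.le
  have hv' : x ^ m * v ≤ x ^ m := mul_le_of_le_one_right (by positivity) hv
  have h3 : (1 + |c|) * x ^ m < x * lam * x ^ m := by gcongr
  have h4 : |c| ≤ |c| * x ^ m := le_mul_of_one_le_right (abs_nonneg c) hp
  rw [flux, pow_succ] at h
  nlinarith [neg_abs_le c]

lemma flux_ge {m : ℕ} {lam x v X : ℝ} (hlam : 0 < lam) (hx : 0 < x) (hX : x ≤ X) (hv : -1 ≤ v) :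
    -(X ^ m + lam * X ^ (m + 1)) ≤ flux m lam x v := by
  have h1 : x ^ m ≤ X ^ m := by gcongr
  have h2 : lam * x ^ (m + 1) ≤ lam * X ^ (m + 1) := by gcongr
  have h3 : -x ^ m ≤ x ^ m * v := by
    have := mul_le_mul_of_nonneg_left hv (pow_nonneg hx.le m)
    linarith
  rw [flux]; linarith

lemma continuous_flux (m : ℕ) (lam : ℝ) : Continuous fun p : ℝ × ℝ => flux m lam p.1 p.2 := by
  unfold flux; fun_prop

/-! ### Asymptotics of profile curves at both ends. -/

namespace IsProfileOn

variable {m : ℕ} {lam : ℝ} {x u v z : ℝ → ℝ}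

lemma flux_monotone (h : IsProfileOn m lam x u v z univ) (hm : 1 ≤ m) :
    Monotone fun s => flux m lam (x s) (v s) :=
  monotoneOn_univ.1 (h.flux_monotoneOn hm ordConnected_univ)

lemma flux_le_max (h : IsProfileOn m lam x u v z univ) (hm : 1 ≤ m) (hlam : 0 < lam) (s : ℝ) :
    flux m lam (x s) (v s) ≤ flux m lam (radius m lam) 1 :=
  flux_le hm hlam (h.pos s trivial).le (abs_le.1 (h.abs_v_le (mem_univ s))).2

/-- Otherwise the increasing flux stays a fixed amount below its maximum for all time. It is bounded
below on `[0, ∞)`, so `x` is bounded there, contradicting the dwell time estimate. -/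
lemma tendsto_flux_atTop (h : IsProfileOn m lam x u v z univ) (hm : 1 ≤ m) (hlam : 0 < lam) :
    Tendsto (fun s => flux m lam (x s) (v s)) atTop (𝓝 (flux m lam (radius m lam) 1)) := by
  refine tendsto_order.2 ⟨fun a ha => ?_, fun b hb =>
    Eventually.of_forall fun s => (h.flux_le_max hm hlam s).trans_lt hb⟩
  have hmono := h.flux_monotone hm
  obtain ⟨s, hs⟩ : ∃ s, a < flux m lam (x s) (v s) := by
    by_contra! hcon
    set c := flux m lam (x 0) (v 0) with hc
    obtain ⟨T, -, hT⟩ := exists_dwell_time m hm hlam (max 1 ((1 + |c|) / lam)) c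
      (flux m lam (radius m lam) 1 - a) (by linarith)
    refine hT h 0 fun s hs => ?_
    have hcs : c ≤ flux m lam (x s) (v s) := hmono hs.1
    exact ⟨le_of_le_flux hlam (h.pos s trivial) (abs_le.1 (h.abs_v_le (mem_univ s))).2 hcs, hcs,
      by linarith [hcon s]⟩
  filter_upwards [eventually_ge_atTop s] with t ht using hs.trans_le (hmono ht)

/-- The forward orbit is relatively compact, and the limit of the flux is a value taken only at the
equilibrium, so no other cluster point exists. -/
lemma tendsto_state_atTop (h : IsProfileOn m lam x u v z univ) (hm : 1 ≤ m) (hlam : 0 < lam) :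
    Tendsto (fun s => (x s, v s)) atTop (𝓝 (radius m lam, 1)) := by
  set c := flux m lam (x 0) (v 0) with hc
  have hmono := h.flux_monotone hm
  have hK : IsCompact (Icc (0 : ℝ) (max 1 ((1 + |c|) / lam)) ×ˢ Icc (-1 : ℝ) 1) :=
    isCompact_Icc.prod isCompact_Icc
  refine hK.tendsto_nhds_of_unique_mapClusterPt ?_ ?_
  · filter_upwards [eventually_ge_atTop 0] with s hs
    have hv := abs_le.1 (h.abs_v_le (mem_univ s))
    exact ⟨⟨(h.pos s trivial).le, le_of_le_flux hlam (h.pos s trivial) hv.2 (hmono hs)⟩, hv⟩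
  · rintro ⟨a, b⟩ ⟨ha, hb⟩ hcl
    have h1 : MapClusterPt (flux m lam a b) atTop (fun s => flux m lam (x s) (v s)) :=
      hcl.continuousAt_comp (continuous_flux m lam).continuousAt
    by_contra hne
    obtain ⟨c, hc1, hc2⟩ := exists_between
      (flux_lt hm hlam ha.1 hb.2 fun h' => hne (Prod.ext h'.1 h'.2))
    obtain ⟨s, hs1, hs2⟩ := ((h1.frequently (gt_mem_nhds hc1)).and_eventually
      ((h.tendsto_flux_atTop hm hlam).eventually (lt_mem_nhds hc2))).exists
    exact lt_asymm hs1 hs2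

lemma tendsto_x_atTop (h : IsProfileOn m lam x u v z univ) (hm : 1 ≤ m) (hlam : 0 < lam) :
    Tendsto x atTop (𝓝 (radius m lam)) :=
  (continuous_fst.tendsto _).comp (h.tendsto_state_atTop hm hlam)

lemma tendsto_v_atTop (h : IsProfileOn m lam x u v z univ) (hm : 1 ≤ m) (hlam : 0 < lam) :
    Tendsto v atTop (𝓝 1) :=
  (continuous_snd.tendsto _).comp (h.tendsto_state_atTop hm hlam)

lemma tendsto_u_atTop (h : IsProfileOn m lam x u v z univ) (hm : 1 ≤ m) (hlam : 0 < lam) :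
    Tendsto u atTop (𝓝 0) := by
  have h1 : Tendsto (fun s => √(1 - v s ^ 2)) atTop (𝓝 0) := by
    have := (((h.tendsto_v_atTop hm hlam).pow 2).const_sub 1).sqrt
    simpa using this
  refine squeeze_zero_norm (fun s => ?_) h1
  rw [Real.norm_eq_abs]
  exact Real.abs_le_sqrt (by linarith [h.unit s trivial])

lemma tendsto_z_atTop (h : IsProfileOn m lam x u v z univ) (hm : 1 ≤ m) (hlam : 0 < lam) :
    Tendsto z atTop atTop := by
  obtain ⟨a, ha⟩ := eventually_atTop.1 ((h.tendsto_v_atTop hm hlam).eventually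
    (lt_mem_nhds (by norm_num : (1 / 2 : ℝ) < 1)))
  have hmono : MonotoneOn (fun s => z s - 1 / 2 * s) (Ici a) := by
    refine monotoneOn_of_hasDerivWithinAt_nonneg (convex_Ici a) (f' := fun s => v s - 1 / 2 * 1)
      (fun s _ => ((h.dz s trivial).continuousAt.sub (by fun_prop)).continuousWithinAt)
      (fun s _ => ((h.dz s trivial).fun_sub
        ((hasDerivAt_id' s).const_mul (1 / 2))).hasDerivWithinAt) fun s hs => ?_
    linarith [ha s (interior_subset hs : s ∈ Ici a)]
  refine tendsto_atTop_mono' atTop (f₁ := fun s => (z a - 1 / 2 * a) + 1 / 2 * s) ?_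
    (tendsto_atTop_add_const_left _ _ (tendsto_id.const_mul_atTop (by norm_num)))
  filter_upwards [eventually_ge_atTop a] with s hs
  have := hmono (self_mem_Ici (a := a)) hs hs
  simp only at this
  linarith

/-- A profile curve whose flux attains the maximal value generates the cylinder. -/
lemma eq_radius_of_flux_eq (h : IsProfileOn m lam x u v z univ) (hm : 1 ≤ m) (hlam : 0 < lam)
    {a : ℝ} (ha : flux m lam (x a) (v a) = flux m lam (radius m lam) 1) (s : ℝ) :
    x s = radius m lam ∧ v s = 1 := by
  have hstate : ∀ t, flux m lam (x t) (v t) = flux m lam (radius m lam) 1 →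
      x t = radius m lam ∧ v t = 1 := by
    intro t ht
    by_contra hne
    have := flux_lt hm hlam (h.pos t trivial).le (abs_le.1 (h.abs_v_le (mem_univ t))).2 hne
    linarith
  rcases le_total a s with has | hsa
  · refine hstate s (le_antisymm (h.flux_le_max hm hlam s) ?_)
    rw [← ha]
    exact h.flux_monotone hm has
  · set r := radius m lam with hr
    have hr0 : 0 < r := radius_pos hm hlam
    obtain ⟨δ, hδ, hxδ⟩ : ∃ δ > 0, ∀ t ∈ Icc s a, δ ≤ x t := by
      obtain ⟨t, ht, hmin⟩ := (isCompact_Icc (a := s) (b := a)).exists_isMinOn ⟨s, le_rfl, hsa⟩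
        (fun t _ => (h.dx t trivial).continuousAt.continuousWithinAt)
      exact ⟨x t, h.pos t trivial, hmin⟩
    -- Backward uniqueness at the equilibrium by Gronwall. On the unit circle, `E` equals the
    -- squared distance `(x - r) ^ 2 + u ^ 2 + (1 - v) ^ 2`, and `E' ≥ -C * E`; hence `exp (C t) *
    -- E` increases to the value `0` at `a`.
    set E : ℝ → ℝ := fun t => (x t - r) ^ 2 + (2 - 2 * v t) with hE
    set C : ℝ := 1 + 2 * ((m : ℝ) + 1) + m / (r * δ) + m / δ with hC
    have hdE : ∀ t, HasDerivAt E (2 * (x t - r) * u t -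
        2 * (u t * curv m lam (x t) (u t) (v t))) t := by
      intro t
      refine ((((h.dx t trivial).sub_const r).fun_pow 2).fun_add
        (((h.dv t trivial).const_mul 2).const_sub 2)).congr_deriv ?_
      push_cast
      ring
    have hEbound : ∀ t ∈ Icc s a, -(C * E t) ≤ 2 * (x t - r) * u t -
        2 * (u t * curv m lam (x t) (u t) (v t)) := by
      intro t ht
      have hx0 := h.pos t trivial
      have hxt := hxδ t ht
      have hun := h.unit t trivial
      have hEt : E t = (x t - r) ^ 2 + u t ^ 2 + (1 - v t) ^ 2 := by
        simp only [hE]; linarith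
      have hlr : ((m : ℝ) + 1) * lam = m / r := by
        rw [eq_div_iff hr0.ne', mul_comm ((m : ℝ) + 1) lam]; exact lam_mul_radius hlam
      -- An exact expression of the curvature through the deviations from the equilibrium, so `E'`
      -- is bounded by a quadratic form in them.
      have hK : curv m lam (x t) (u t) (v t) = ((m : ℝ) + 1) * u t +
          (m / (r * x t)) * (x t - r) + (m / x t) * (1 - v t) := by
        rw [curv, mul_add, hlr]; field_simp; ring
      have hm0 : (0 : ℝ) ≤ m := Nat.cast_nonneg m
      have hA : (m : ℝ) / (r * x t) ≤ m / (r * δ) := by gcongr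
      have hB : (m : ℝ) / x t ≤ m / δ := by gcongr
      have hA0 : (0 : ℝ) ≤ m / (r * x t) := by positivity
      have hB0 : (0 : ℝ) ≤ m / x t := by positivity
      rw [hK, hEt, hC]
      set A := (m : ℝ) / (r * x t)
      set B := (m : ℝ) / x t
      set A' := (m : ℝ) / (r * δ)
      set B' := (m : ℝ) / δ
      set p := x t - r
      set w := u t
      set y := 1 - v t
      have e1 : 2 * p * w ≥ -(p ^ 2 + w ^ 2 + y ^ 2) := by
        nlinarith [sq_nonneg (p + w), sq_nonneg y]
      have e2 : A * (2 * (w * p)) ≤ A' * (p ^ 2 + w ^ 2 + y ^ 2) :=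
        (mul_le_mul_of_nonneg_left (by nlinarith [sq_nonneg (p - w), sq_nonneg y]) hA0).trans
          (mul_le_mul_of_nonneg_right hA (by positivity))
      have e3 : B * (2 * (w * y)) ≤ B' * (p ^ 2 + w ^ 2 + y ^ 2) :=
        (mul_le_mul_of_nonneg_left (by nlinarith [sq_nonneg (w - y), sq_nonneg p]) hB0).trans
          (mul_le_mul_of_nonneg_right hB (by positivity))
      have e4 : 2 * ((m : ℝ) + 1) * w ^ 2 ≤ 2 * ((m : ℝ) + 1) * (p ^ 2 + w ^ 2 + y ^ 2) := by
        gcongr; nlinarith [sq_nonneg p, sq_nonneg y]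
      linarith
    have hmono : MonotoneOn (fun t => Real.exp (C * t) * E t) (Icc s a) := by
      have hd : ∀ t, HasDerivAt (fun t => Real.exp (C * t) * E t)
          (Real.exp (C * t) * (C * 1) * E t + Real.exp (C * t) * (2 * (x t - r) * u t -
            2 * (u t * curv m lam (x t) (u t) (v t)))) t := fun t =>
        (((hasDerivAt_id' t).const_mul C).exp).fun_mul (hdE t)
      refine monotoneOn_of_hasDerivWithinAt_nonneg (convex_Icc s a)
        (fun t _ => (hd t).continuousAt.continuousWithinAt)
        (fun t _ => (hd t).hasDerivWithinAt) fun t ht => ?_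
      have := hEbound t (interior_subset ht)
      have h2 := Real.exp_pos (C * t)
      nlinarith
    have h1 := hmono (left_mem_Icc.2 hsa) (right_mem_Icc.2 hsa) hsa
    obtain ⟨ha1, ha2⟩ := hstate a ha
    have hEa : E a = 0 := by simp [hE, ha1, ha2]
    simp only [hEa, mul_zero] at h1
    have hvs := (abs_le.1 (h.abs_v_le (mem_univ s))).2
    have hEs : E s ≤ 0 := by
      by_contra! hpos
      have := mul_pos (Real.exp_pos (C * s)) hpos
      linarith
    simp only [hE] at hEs
    constructor
    · have : (x s - r) ^ 2 = 0 := by nlinarith [sq_nonneg (x s - r)]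
      linarith [pow_eq_zero_iff two_ne_zero |>.1 this]
    · nlinarith [sq_nonneg (x s - r)]

/-- Before time `a` the flux keeps its gap to the maximum. A lower bound for all time would
contradict the dwell time estimate on the window ending at `a`. -/
lemma tendsto_flux_atBot (h : IsProfileOn m lam x u v z univ) (hm : 1 ≤ m) (hlam : 0 < lam)
    {a : ℝ} (ha : flux m lam (x a) (v a) < flux m lam (radius m lam) 1) :
    Tendsto (fun s => flux m lam (x s) (v s)) atBot atBot := by
  have hmono := h.flux_monotone hm
  refine tendsto_atBot.2 fun c => ?_
  obtain ⟨s, hs⟩ : ∃ s, flux m lam (x s) (v s) < c := by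
    by_contra! hcon
    obtain ⟨T, hT0, hT⟩ := exists_dwell_time m hm hlam (max 1 ((1 + |c|) / lam)) c
      (flux m lam (radius m lam) 1 - flux m lam (x a) (v a)) (by linarith)
    refine hT h (a - T) fun s hs => ?_
    refine ⟨le_of_le_flux hlam (h.pos s trivial) (abs_le.1 (h.abs_v_le (mem_univ s))).2 (hcon s),
      hcon s, ?_⟩
    have : flux m lam (x s) (v s) ≤ flux m lam (x a) (v a) := hmono (by linarith [hs.2])
    linarith
  filter_upwards [eventually_le_atBot s] with t ht using (hmono ht).trans hs.le

lemma tendsto_x_atBot (h : IsProfileOn m lam x u v z univ) (hm : 1 ≤ m) (hlam : 0 < lam)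
    {a : ℝ} (ha : flux m lam (x a) (v a) < flux m lam (radius m lam) 1) :
    Tendsto x atBot atTop := by
  refine tendsto_atTop.2 fun X => ?_
  filter_upwards [(h.tendsto_flux_atBot hm hlam ha).eventually
    (eventually_lt_atBot (-(X ^ m + lam * X ^ (m + 1))))] with s hs
  by_contra! hcon
  have := flux_ge (m := m) hlam (h.pos s trivial) hcon.le (abs_le.1 (h.abs_v_le (mem_univ s))).1
  linarith

end IsProfileOn

/-! ### One-variable calculus: zeros, differential inequalities, smooth inverses. -/

section Calculus

lemma eventually_pos_right {f : ℝ → ℝ} {d s : ℝ} (hd : HasDerivAt f d s) (h0 : 0 < d)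
    (hs : f s = 0) : ∀ᶠ t in 𝓝[>] s, 0 < f t := by
  have h := eventually_nhdsWithin_sign_eq_of_deriv_pos (by rwa [hd.deriv]) hs
  filter_upwards [nhdsWithin_le_nhds h,
    self_mem_nhdsWithin] with t ht (hst : s < t)
  rwa [sign_pos (sub_pos.2 hst), sign_eq_one_iff] at ht

lemma eventually_neg_left {f : ℝ → ℝ} {d s : ℝ} (hd : HasDerivAt f d s) (h0 : 0 < d)
    (hs : f s = 0) : ∀ᶠ t in 𝓝[<] s, f t < 0 := by
  have h := eventually_nhdsWithin_sign_eq_of_deriv_pos (by rwa [hd.deriv]) hs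
  filter_upwards [nhdsWithin_le_nhds h,
    self_mem_nhdsWithin] with t ht (hst : t < s)
  rwa [sign_neg (sub_neg.2 hst), sign_eq_neg_one_iff] at ht

/-- The last point of a closed set before a point that does not belong to it. -/
lemma exists_last_mem {A : Set ℝ} {a b : ℝ} (hA : IsClosed A) (ha : a ∈ A) (hab : a ≤ b)
    (hb : b ∉ A) : ∃ c ∈ A, a ≤ c ∧ c < b ∧ ∀ t ∈ Ioc c b, t ∉ A := by
  obtain ⟨c, ⟨hcA, hc⟩, hmax⟩ := ((isCompact_Icc (a := a) (b := b)).inter_left hA).exists_isGreatest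
    ⟨a, ha, le_rfl, hab⟩
  refine ⟨c, hcA, hc.1, lt_of_le_of_ne hc.2 fun h => hb (h ▸ hcA), fun t ht htA => ?_⟩
  exact absurd (hmax ⟨htA, hc.1.trans ht.1.le, ht.2⟩) (not_le.2 ht.1)

/-- The first point of a closed set after a point that does not belong to it. -/
lemma exists_first_mem {A : Set ℝ} {a b : ℝ} (hA : IsClosed A) (ha : a ∉ A) (hab : a ≤ b)
    (hb : b ∈ A) : ∃ c ∈ A, a < c ∧ c ≤ b ∧ ∀ t ∈ Ico a c, t ∉ A := by
  obtain ⟨c, ⟨hcA, hc⟩, hmin⟩ := ((isCompact_Icc (a := a) (b := b)).inter_left hA).exists_isLeast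
    ⟨b, hb, hab, le_rfl⟩
  refine ⟨c, hcA, lt_of_le_of_ne hc.1 fun h => ha (h ▸ hcA), hc.2, fun t ht htA => ?_⟩
  exact absurd (hmin ⟨htA, ht.1, ht.2.le.trans hc.2⟩) (not_le.2 ht.2)

lemma nonneg_of_pos_right {f : ℝ → ℝ} {c b : ℝ} (hf : ContinuousAt f c) (hcb : c < b)
    (h : ∀ t ∈ Ioc c b, 0 ≤ f t) : 0 ≤ f c :=
  ge_of_tendsto (hf.tendsto.mono_left (nhdsWithin_le_nhds (s := Ioi c)))
    (by filter_upwards [Ioc_mem_nhdsGT hcb] with t ht using h t ht)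

lemma nonneg_of_pos_left {f : ℝ → ℝ} {c a : ℝ} (hf : ContinuousAt f c) (hac : a < c)
    (h : ∀ t ∈ Ico a c, 0 ≤ f t) : 0 ≤ f c :=
  ge_of_tendsto (hf.tendsto.mono_left (nhdsWithin_le_nhds (s := Iio c)))
    (by filter_upwards [Ico_mem_nhdsLT hac] with t ht using h t ht)

/-- A function that crosses zero only upwards stays positive. -/
lemma pos_of_zeros_upward {f : ℝ → ℝ} {a b : ℝ} (hf : ∀ t ∈ Icc a b, ContinuousAt f t)
    (ha : 0 ≤ f a) (hz : ∀ t ∈ Icc a b, f t = 0 → ∃ d > 0, HasDerivAt f d t) :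
    ∀ t ∈ Ioc a b, 0 < f t := by
  intro t ht
  by_contra! hneg
  obtain ⟨a', ha', hfa'⟩ : ∃ a' ∈ Ico a t, 0 < f a' := by
    rcases ha.lt_or_eq with h | h
    · exact ⟨a, ⟨le_rfl, ht.1⟩, h⟩
    · obtain ⟨d, hd, hda⟩ := hz a ⟨le_rfl, ht.1.le.trans ht.2⟩ h.symm
      obtain ⟨s, hs1, hs2⟩ := ((eventually_pos_right hda hd h.symm).and
        (Ioo_mem_nhdsGT ht.1)).exists
      exact ⟨s, ⟨hs2.1.le, hs2.2⟩, hs1⟩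
  have hsub : Icc a' t ⊆ Icc a b := Icc_subset_Icc ha'.1 ht.2
  have hA : IsClosed (Icc a' t ∩ f ⁻¹' Iic 0) :=
    ContinuousOn.preimage_isClosed_of_isClosed
      (fun s hs => (hf s (hsub hs)).continuousWithinAt) isClosed_Icc isClosed_Iic
  obtain ⟨c, ⟨hc1, hc2⟩, hac, hct, hmin⟩ := exists_first_mem hA
    (fun h => absurd h.2 (not_le.2 hfa')) ha'.2.le ⟨right_mem_Icc.2 ha'.2.le, hneg⟩
  have hpos : ∀ s ∈ Ico a' c, 0 < f s := fun s hs => by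
    by_contra! h
    exact hmin s hs ⟨⟨hs.1, hs.2.le.trans hct⟩, h⟩
  have h0 : f c = 0 := le_antisymm hc2
    (nonneg_of_pos_left (hf c (hsub hc1)) hac fun s hs => (hpos s hs).le)
  obtain ⟨d, hd, hdc⟩ := hz c (hsub hc1) h0
  obtain ⟨s, hs1, hs2⟩ := ((eventually_neg_left hdc hd h0).and (Ico_mem_nhdsLT hac)).exists
  exact lt_asymm hs1 (hpos s hs2)

/-- A positive function that decreases at most exponentially stays positive. -/
lemma pos_of_deriv_ge {f f' : ℝ → ℝ} {C a b : ℝ} (hf : ∀ t ∈ Icc a b, HasDerivAt f (f' t) t)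
    (ha : 0 < f a) (hz : ∀ t ∈ Ioo a b, 0 ≤ f t → -(C * f t) ≤ f' t) :
    ∀ t ∈ Icc a b, 0 < f t := by
  intro t ht
  by_contra! hneg
  have hsub : Icc a t ⊆ Icc a b := Icc_subset_Icc le_rfl ht.2
  have hA : IsClosed (Icc a t ∩ f ⁻¹' Iic 0) :=
    ContinuousOn.preimage_isClosed_of_isClosed
      (fun s hs => (hf s (hsub hs)).continuousAt.continuousWithinAt) isClosed_Icc isClosed_Iic
  obtain ⟨c, ⟨hc1, hc2⟩, hac, hct, hmin⟩ := exists_first_mem hA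
    (fun h => absurd h.2 (not_le.2 ha)) ht.1 ⟨right_mem_Icc.2 ht.1, hneg⟩
  have hsub' : Icc a c ⊆ Icc a b := Icc_subset_Icc le_rfl (hct.trans ht.2)
  have hmono : MonotoneOn (fun s => Real.exp (C * s) * f s) (Icc a c) := by
    have hd : ∀ s ∈ Icc a c, HasDerivAt (fun s => Real.exp (C * s) * f s)
        (Real.exp (C * s) * (C * 1) * f s + Real.exp (C * s) * f' s) s := fun s hs =>
      (((hasDerivAt_id' s).const_mul C).exp).fun_mul (hf s (hsub' hs))
    refine monotoneOn_of_hasDerivWithinAt_nonneg (convex_Icc a c)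
      (fun s hs => (hd s hs).continuousAt.continuousWithinAt)
      (fun s hs => (hd s (interior_subset hs)).hasDerivWithinAt) fun s hs => ?_
    rw [interior_Icc] at hs
    have hfs : 0 ≤ f s := by
      by_contra! h
      exact hmin s ⟨hs.1.le, hs.2⟩ ⟨⟨hs.1.le, hs.2.le.trans hct⟩, h.le⟩
    have h1 := hz s ⟨hs.1, hs.2.trans_le (hct.trans ht.2)⟩ hfs
    have h2 := Real.exp_pos (C * s)
    nlinarith
  have h1 := hmono (left_mem_Icc.2 hac.le) (right_mem_Icc.2 hac.le) hac.le
  have h2 := mul_pos (Real.exp_pos (C * a)) ha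
  have h3 : Real.exp (C * c) * f c ≤ 0 :=
    mul_nonpos_of_nonneg_of_nonpos (Real.exp_pos _).le hc2
  simp only at h1
  linarith

/-- The smooth inverse of a decreasing smooth function. -/
lemma exists_smooth_inverse {x : ℝ → ℝ} {a : ℝ} (hx : ContDiff ℝ ∞ x)
    (hneg : ∀ s ≤ a, deriv x s < 0) (hlim : Tendsto x atBot atTop) :
    ∃ l : ℝ → ℝ, (∀ y > x a, l y < a ∧ x (l y) = y) ∧ (∀ s < a, l (x s) = s) ∧
      (∀ y > x a, ContDiffAt ℝ ∞ l y) ∧ ∀ y > x a, HasDerivAt l (deriv x (l y))⁻¹ y := by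
  have hd : ∀ s, HasDerivAt x (deriv x s) s := fun s =>
    (hx.differentiable (by simp) s).hasDerivAt
  have hanti : StrictAntiOn x (Iic a) :=
    strictAntiOn_of_deriv_neg (convex_Iic a) hx.continuous.continuousOn
      fun s hs => hneg s (interior_subset hs : s ∈ Iic a)
  -- The condition on `y` sits inside the existential so that `choose` yields a total function, with
  -- junk value `0` outside the range.
  have hsurj : ∀ y, ∃ s, x a < y → s < a ∧ x s = y := by
    intro y
    by_cases hy : x a < y
    · obtain ⟨b, hb1, hb2⟩ := ((hlim.eventually_gt_atTop y).and (eventually_lt_atBot a)).exists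
      obtain ⟨s, hs, hsy⟩ := intermediate_value_Icc' hb2.le hx.continuous.continuousOn
        ⟨hy.le, hb1.le⟩
      exact ⟨s, fun _ => ⟨lt_of_le_of_ne hs.2 fun h => by rw [h] at hsy; linarith, hsy⟩⟩
    · exact ⟨0, fun h => absurd h hy⟩
  choose l hl using hsurj
  have hl' : ∀ y > x a, l y < a ∧ x (l y) = y := hl
  have hleft : ∀ s < a, l (x s) = s := fun s hs => by
    have h1 := hl' (x s) (hanti hs.le (self_mem_Iic) hs)
    exact hanti.injOn h1.1.le hs.le h1.2
  have hsm : ∀ y > x a, ContDiffAt ℝ ∞ l y := by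
    intro y hy
    obtain ⟨hla, hxl⟩ := hl' y hy
    have hc : ContDiffAt ℝ ∞ x (l y) := hx.contDiffAt
    have hne : deriv x (l y) ≠ 0 := (hneg _ hla.le).ne
    have hF := (hd (l y)).hasFDerivAt_equiv hne
    have hg := hc.to_localInverse hF (by simp)
    have hstrict := hc.hasStrictFDerivAt' hF (by simp)
    have hright := hstrict.eventually_right_inverse
    rw [hxl] at hg hright
    refine hg.congr_of_eventuallyEq ?_
    have hg0 : hc.localInverse hF (by simp) y = l y := by
      have := hc.localInverse_apply_image hF (by simp)
      rwa [hxl] at this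
    have hlt : ∀ᶠ w in 𝓝 y, hc.localInverse hF (by simp) w < a :=
      hg.continuousAt.eventually_lt continuousAt_const (by rw [hg0]; exact hla)
    filter_upwards [hright, hlt] with w hw1 hw2
    change x (hc.localInverse hF (by simp) w) = w at hw1
    conv_lhs => rw [← hw1]
    exact hleft _ hw2
  refine ⟨l, hl', hleft, hsm, fun y hy => ?_⟩
  obtain ⟨hla, hxl⟩ := hl' y hy
  refine HasDerivAt.of_local_left_inverse (hsm y hy).continuousAt (hd (l y)) (hneg _ hla.le).ne ?_
  filter_upwards [lt_mem_nhds hy] with w hw using (hl' w hw).2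

end Calculus

/-! ### The case `lam ≤ 1`: the end far from the axis moves inwards. -/

namespace IsProfileOn

variable {m : ℕ} {lam : ℝ} {x u v z : ℝ → ℝ}

lemma continuous_x (h : IsProfileOn m lam x u v z univ) : Continuous x :=
  continuous_iff_continuousAt.2 fun s => (h.dx s trivial).continuousAt

lemma continuous_z (h : IsProfileOn m lam x u v z univ) : Continuous z :=
  continuous_iff_continuousAt.2 fun s => (h.dz s trivial).continuousAt

lemma continuous_u (h : IsProfileOn m lam x u v z univ) : Continuous u :=
  continuous_iff_continuousAt.2 fun s => (h.du s trivial).continuousAt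

lemma continuous_v (h : IsProfileOn m lam x u v z univ) : Continuous v :=
  continuous_iff_continuousAt.2 fun s => (h.dv s trivial).continuousAt

lemma v_eq_of_u_eq_zero (h : IsProfileOn m lam x u v z univ) {s : ℝ} (hu : u s = 0) :
    v s = 1 ∨ v s = -1 := by
  have := h.unit s trivial
  rw [hu] at this
  exact mul_self_eq_one_iff.1 (by linarith)

lemma curv_pos_of_v_neg (h : IsProfileOn m lam x u v z univ) (hlam : 0 < lam) {s : ℝ}
    (hu : u s = 0) (hv : v s = -1) : 0 < curv m lam (x s) (u s) (v s) := by
  have := h.pos s trivial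
  rw [curv, hu, hv, mul_neg, neg_div, sub_neg_eq_add]
  positivity

lemma curv_pos_of_radius_lt (hlam : 0 < lam) {r : ℝ} (hm : 1 ≤ m)
    (hr : radius m lam < r) : 0 < curv m lam r 0 1 := by
  have h0 := (radius_pos hm hlam).trans hr
  rw [radius, div_lt_iff₀ (by positivity)] at hr
  rw [curv, sub_pos, div_lt_iff₀ h0]
  linarith

/-- If `lam ≤ 1`, far from the axis the radial velocity cannot become negative and nonnegative
again. -/
lemma no_inward_arc (h : IsProfileOn m lam x u v z univ) (hm : 1 ≤ m) (hlam : 0 < lam)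
    (hlam1 : lam ≤ 1) {t1 t2 t3 : ℝ} (h12 : t1 ≤ t2) (h23 : t2 ≤ t3)
    (hx : ∀ s ≤ t3, radius m lam < x s) (h1 : 0 ≤ u t1) (h2 : u t2 < 0) (h3 : 0 ≤ u t3) :
    False := by
  have hA : IsClosed {s | 0 ≤ u s} := isClosed_le continuous_const h.continuous_u
  obtain ⟨a, ha, -, hat, ha'⟩ := exists_last_mem hA h1 h12 (not_le.2 h2)
  obtain ⟨b, hb, htb, hbt, hb'⟩ := exists_first_mem hA (not_le.2 h2) h23 h3
  have hneg : ∀ s ∈ Ioo a b, u s < 0 := by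
    intro s hs
    rcases le_total s t2 with hst | hst
    · exact not_le.1 (ha' s ⟨hs.1, hst⟩)
    · exact not_le.1 (hb' s ⟨hst, hs.2⟩)
  have hab : a < b := hat.trans htb
  have hua : u a = 0 := le_antisymm (neg_nonneg.1 (nonneg_of_pos_right (f := fun s => -u s)
    h.continuous_u.neg.continuousAt hat fun s hs =>
      (neg_pos.2 (hneg s ⟨hs.1, hs.2.trans_lt htb⟩)).le)) ha
  have hub : u b = 0 := le_antisymm (neg_nonneg.1 (nonneg_of_pos_left (f := fun s => -u s)
    h.continuous_u.neg.continuousAt htb fun s hs =>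
      (neg_pos.2 (hneg s ⟨hat.trans_le hs.1, hs.2⟩)).le)) hb
  -- On the maximal inward arc `(a, b)` the tangent is vertical at both ends. Since the curvature is
  -- positive at either possible end state, `u' = -v * κ` has the sign of `-v`; so `u` can become
  -- negative only with `v = 1` and return to zero only with `v = -1`.
  have hva : v a = 1 := by
    refine (h.v_eq_of_u_eq_zero hua).resolve_right fun hva => ?_
    have hd := h.du a trivial
    have hK := h.curv_pos_of_v_neg hlam hua hva
    obtain ⟨s, hs1, hs2⟩ := ((eventually_pos_right hd (by rw [hva] at hK ⊢; linarith) hua).and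
      (Ioo_mem_nhdsGT hab)).exists
    exact lt_asymm hs1 (hneg s hs2)
  have hvb : v b = -1 := by
    refine (h.v_eq_of_u_eq_zero hub).resolve_left fun hvb => ?_
    have hd := h.du b trivial
    have hK : 0 < curv m lam (x b) (u b) (v b) := by
      rw [hub, hvb]; exact curv_pos_of_radius_lt hlam hm (hx b hbt)
    obtain ⟨s, hs1, hs2⟩ := ((eventually_neg_left (f := fun s => -u s) hd.fun_neg
      (by rw [hvb] at hK ⊢; linarith) (by rw [hub, neg_zero])).and (Ioo_mem_nhdsLT hab)).exists
    exact lt_asymm (neg_lt_zero.1 hs1) (hneg s hs2)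
  -- Yet `v` cannot leave the positive side. While `u < 0` and `v ≥ 0`, the bound `lam ≤ 1` gives
  -- `v' ≥ n * u * (u + 1) ≥ -n * v`, with `n = m + 1`.
  have := pos_of_deriv_ge (C := (m : ℝ) + 1) (fun t _ => h.dv t trivial)
    (show 0 < v a by rw [hva]; exact one_pos) (b := b) (fun t ht hvt => ?_) b
    (right_mem_Icc.2 hab.le)
  · rw [hvb] at this; linarith
  · have hut := hneg t ht
    have hun := h.unit t trivial
    have hp := h.pos t trivial
    have hv1 := (abs_le.1 (h.abs_v_le (mem_univ t))).2
    have hq : 0 ≤ (m : ℝ) * v t / x t := by positivity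
    have hn : (0 : ℝ) < (m : ℝ) + 1 := by positivity
    have e1 : u t * (((m : ℝ) + 1) * (u t + 1)) ≤ u t * curv m lam (x t) (u t) (v t) := by
      refine mul_le_mul_of_nonpos_left ?_ hut.le
      rw [curv]
      nlinarith
    have e2 : -(v t) ≤ u t * (u t + 1) := by nlinarith
    nlinarith

/-- If `lam ≤ 1` and the distance to the axis is unbounded, the curve finally moves inwards. -/
lemma exists_forall_u_neg (h : IsProfileOn m lam x u v z univ) (hm : 1 ≤ m) (hlam : 0 < lam)
    (hlam1 : lam ≤ 1) (hlim : Tendsto x atBot atTop) : ∃ a, ∀ s ≤ a, u s < 0 := by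
  obtain ⟨b, hb⟩ := eventually_atBot.1 (hlim.eventually_gt_atTop (radius m lam))
  have hexists : ∀ a, ∃ s ≤ a, u s < 0 := by
    intro a
    by_contra! hcon
    have hmono : MonotoneOn x (Iic a) :=
      monotoneOn_of_hasDerivWithinAt_nonneg (convex_Iic a) h.continuous_x.continuousOn
        (fun s _ => (h.dx s trivial).hasDerivWithinAt) fun s hs => hcon s (interior_subset hs : s ∈ Iic a)
    obtain ⟨s, hs1, hs2⟩ := ((hlim.eventually_gt_atTop (x a)).and (eventually_le_atBot a)).exists
    exact absurd (hmono hs2 self_mem_Iic hs2) (not_le.2 hs1)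
  by_contra! hcon
  obtain ⟨t3, h3b, h3⟩ := hcon b
  obtain ⟨t2, h23, h2⟩ := hexists t3
  obtain ⟨t1, h12, h1⟩ := hcon t2
  exact h.no_inward_arc hm hlam hlam1 h12 h23 (fun s hs => hb s (hs.trans h3b)) h1 h2 h3

end IsProfileOn

/-! ### The case `lam < 1` with downward normals: embeddedness. -/

namespace IsProfileOn

variable {m : ℕ} {lam : ℝ} {x u v z : ℝ → ℝ}

/-- At every zero of `v` the hypothesis gives `u = -1`, hence `v' = n * (1 - lam) > 0` with `n = m +
1`: zeros are crossed upwards only. -/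
lemma v_pos_of_gt (h : IsProfileOn m lam x u v z univ) (hlam1 : lam < 1)
    (hhor : ∀ s, v s = 0 → u s = -1) {a b : ℝ} (ha : v a = 0) (hab : a < b) : 0 < v b := by
  refine pos_of_zeros_upward (fun t _ => h.continuous_v.continuousAt) ha.ge (fun t _ ht => ?_) b
    (right_mem_Ioc.2 hab)
  refine ⟨_, ?_, h.dv t trivial⟩
  rw [hhor t ht, ht, curv]
  have : (0 : ℝ) < (m : ℝ) + 1 := by positivity
  simp only [mul_zero, zero_div, sub_zero]
  nlinarith

lemma v_neg_of_lt (h : IsProfileOn m lam x u v z univ) (hlam1 : lam < 1)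
    (hhor : ∀ s, v s = 0 → u s = -1) {a b : ℝ} (ha : v a = 0) (hab : b < a) : v b < 0 := by
  by_contra! hb
  have := pos_of_zeros_upward (fun t _ => h.continuous_v.continuousAt) hb (fun t _ ht => ?_) a
    (right_mem_Ioc.2 hab)
  · linarith
  · refine ⟨_, ?_, h.dv t trivial⟩
    rw [hhor t ht, ht, curv]
    have : (0 : ℝ) < (m : ℝ) + 1 := by positivity
    simp only [mul_zero, zero_div, sub_zero]
    nlinarith

/-- Before the lowest point, the curve moves towards the axis. -/
lemma u_neg_of_le (h : IsProfileOn m lam x u v z univ) (hlam : 0 < lam) (hlam1 : lam < 1)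
    (hhor : ∀ s, v s = 0 → u s = -1) {a b : ℝ} (ha : v a = 0) (hab : b ≤ a) : u b < 0 := by
  by_contra! hb
  have hba : b < a := lt_of_le_of_ne hab fun h' => by
    rw [h', hhor a ha] at hb; linarith
  have := pos_of_zeros_upward (fun t _ => h.continuous_u.continuousAt) hb (fun t ht hut => ?_) a
    (right_mem_Ioc.2 hba)
  · rw [hhor a ha] at this; linarith
  · have hvt : v t ≤ 0 := by
      rcases ht.2.lt_or_eq with h' | h'
      · exact (h.v_neg_of_lt hlam1 hhor ha h').le
      · rw [h', ha]
    have hv : v t = -1 := (h.v_eq_of_u_eq_zero hut).resolve_left fun h' => by linarith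
    have hK := h.curv_pos_of_v_neg hlam hut hv
    exact ⟨_, by rw [hv] at hK ⊢; linarith, h.du t trivial⟩

/-- The branch after the lowest point is steeper than the branch before it. -/
lemma steeper_branch (h : IsProfileOn m lam x u v z univ) (hm : 1 ≤ m) (hlam : 0 < lam)
    (hlam1 : lam < 1) (hhor : ∀ s, v s = 0 → u s = -1) {a a' : ℝ} (ha : v a = 0) (haa : a < a')
    {l : ℝ → ℝ} (hl1 : ∀ y > x a', l y < a' ∧ x (l y) = y) (hl2 : ∀ s < a', l (x s) = s)
    (hl3 : ∀ y > x a', HasDerivAt l (u (l y))⁻¹ y)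
    (hneg : ∀ s ≤ a', u s < 0)
    {t : ℝ} (hat : a < t) (hut : 0 < u t) (hxt : x a < x t) : 0 < v t + v (l (x t)) := by
  have hanti : StrictAntiOn x (Iic a') :=
    strictAntiOn_of_hasDerivWithinAt_neg (convex_Iic a') h.continuous_x.continuousOn
      (fun s _ => (h.dx s trivial).hasDerivWithinAt)
      fun s hs => hneg s (interior_subset hs : s ∈ Iic a')
  have hxaa : x a' < x a := hanti haa.le self_mem_Iic haa
  have hlx : ∀ s, x a < x s → l (x s) < a := fun s hs => by
    by_contra! hle
    obtain ⟨h1, h2⟩ := hl1 (x s) (hxaa.trans hs)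
    have := hanti.antitoneOn haa.le h1.le hle
    linarith
  have hA : IsClosed {s | u s ≤ 0 ∨ x s ≤ x a} :=
    (isClosed_le h.continuous_u continuous_const).union
      (isClosed_le h.continuous_x continuous_const)
  -- From `b` on, the later branch moves outwards beyond the radius of the lowest point. At `b`
  -- itself either its tangent is vertical or it is at exactly that radius.
  obtain ⟨b, hb, hab, hbt, hb'⟩ := exists_last_mem hA (Or.inr le_rfl) hat.le
    (show t ∉ {s | u s ≤ 0 ∨ x s ≤ x a} from not_or.2 ⟨not_le.2 hut, not_le.2 hxt⟩)
  have hgood : ∀ s ∈ Ioc b t, 0 < u s ∧ x a < x s := fun s hs =>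
    (not_or.1 (hb' s hs)).imp not_le.1 not_le.1
  have hub : 0 ≤ u b := nonneg_of_pos_right h.continuous_u.continuousAt hbt
    fun s hs => (hgood s hs).1.le
  have hxb : x a ≤ x b := sub_nonneg.1 (nonneg_of_pos_right (f := fun s => x s - x a)
    (h.continuous_x.sub continuous_const).continuousAt hbt
    fun s hs => (sub_pos.2 (hgood s hs).2).le)
  have hab' : a < b := lt_of_le_of_ne hab fun h' => by
    rw [← h', hhor a ha] at hub; linarith
  have hvb := h.v_pos_of_gt hlam1 hhor ha hab'
  have hgt : ∀ s ∈ Icc b t, x a' < x s := fun s hs => by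
    rcases hs.1.lt_or_eq with h' | h'
    · exact hxaa.trans (hgood s ⟨h', hs.2⟩).2
    · rw [← h']; exact hxaa.trans_le hxb
  -- The sum of `x ^ m * v` over the two branches at equal radius. The singular terms cancel in both
  -- derivatives, leaving only the angles and `lam`.
  have hSd : ∀ s ∈ Icc b t, HasDerivAt (fun s => x s ^ m * v s + x s ^ m * v (l (x s)))
      (((m : ℝ) + 1) * x s ^ m * u s * (u s + lam) +
        ((m : ℝ) + 1) * x s ^ m * u s * (u (l (x s)) + lam)) s := by
    intro s hs
    have hp := h.pos s trivial
    obtain ⟨hl, hxl⟩ := hl1 _ (hgt s hs)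
    have hdl : HasDerivAt (fun s => v (l (x s)))
        (u s * curv m lam (x s) (u (l (x s))) (v (l (x s)))) s := by
      have h1 := (h.dv (l (x s)) trivial).comp s ((hl3 _ (hgt s hs)).comp s (h.dx s trivial))
      refine h1.congr_deriv ?_
      rw [hxl]
      have := (hneg _ hl.le).ne
      field_simp
    exact (hasDerivAt_monomial hm hp (h.dx s trivial) (h.dv s trivial)).fun_add
      (hasDerivAt_monomial (v := fun s => v (l (x s))) hm hp (h.dx s trivial) hdl)
  have hpx : 0 < x b ^ m := pow_pos (h.pos b trivial) m
  -- With a vertical tangent at `b`, `v b = 1` while the earlier branch has `v > -1` because its `u`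
  -- is negative. Otherwise the earlier branch is at the lowest point, where `v = 0`, and `v b > 0`.
  have hSb : 0 < x b ^ m * v b + x b ^ m * v (l (x b)) := by
    rw [← mul_add]
    refine mul_pos hpx ?_
    rcases hxb.lt_or_eq with h' | h'
    · have hub0 : u b = 0 := le_antisymm (hb.resolve_right (not_le.2 h')) hub
      have hvb1 : v b = 1 := (h.v_eq_of_u_eq_zero hub0).resolve_right fun h'' => by linarith
      have h1 := h.unit (l (x b)) trivial
      have h2 := hneg _ (hl1 _ (hgt b (left_mem_Icc.2 hbt.le))).1.le
      nlinarith
    · rw [← h', hl2 a haa, ha]; linarith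
  have key := pos_of_zeros_upward (fun s hs => (hSd s hs).continuousAt) hSb.le
    (fun s hs h0 => ?_) t (right_mem_Ioc.2 hbt)
  · rw [← mul_add] at key
    exact pos_of_mul_pos_right key (pow_pos (h.pos t trivial) m).le
  · refine ⟨_, ?_, hSd s hs⟩
    have hsb : b < s := lt_of_le_of_ne hs.1 fun h' => by
      rw [← h'] at h0; linarith
    have hus := (hgood s ⟨hsb, hs.2⟩).1
    have hp : 0 < x s ^ m := pow_pos (h.pos s trivial) m
    rw [← mul_add] at h0
    have hv : v s = -v (l (x s)) := by
      have := (mul_eq_zero.1 h0).resolve_left hp.ne'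
      linarith
    have hul := hneg _ (hl1 _ (hgt s hs)).1.le
    -- At a zero of the sum the two tangents have opposite vertical parts, hence opposite radial
    -- parts by their signs. The derivative then reduces to a positive multiple of `2 * lam`, so
    -- zeros are crossed upwards.
    have hu : u s = -u (l (x s)) := by
      have h1 := h.unit s trivial
      have h2 := h.unit (l (x s)) trivial
      rw [hv] at h1
      have h3 : (u s + u (l (x s))) * (u s - u (l (x s))) = 0 := by nlinarith
      rcases mul_eq_zero.1 h3 with h4 | h4 <;> linarith
    have : ((m : ℝ) + 1) * x s ^ m * u s * (u s + lam) +
        ((m : ℝ) + 1) * x s ^ m * u s * (u (l (x s)) + lam) =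
        ((m : ℝ) + 1) * x s ^ m * u s * (2 * lam) := by rw [hu]; ring
    rw [this]
    positivity

/-- The branches before and after the lowest point do not meet. -/
lemma branches_disjoint (h : IsProfileOn m lam x u v z univ) (hm : 1 ≤ m) (hlam : 0 < lam)
    (hlam1 : lam < 1) (hsm : ContDiff ℝ ∞ x) (hhor : ∀ s, v s = 0 → u s = -1)
    {s a t : ℝ} (ha : v a = 0) (hsa : s < a) (hat : a < t) (hx : x s = x t) (hz : z s = z t) :
    False := by
  have hdx : ∀ s, deriv x s = u s := fun s => (h.dx s trivial).deriv
  have hlim : Tendsto x atBot atTop := by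
    refine h.tendsto_x_atBot hm hlam (a := a) (flux_lt hm hlam (h.pos a trivial).le ?_ ?_)
    · rw [ha]; exact zero_le_one
    · rw [ha]; exact fun h' => zero_ne_one h'.2
  -- Going slightly past the lowest point makes the inverse of `x` differentiable at `x a` as well.
  obtain ⟨a', haa, hneg⟩ : ∃ a' > a, ∀ s ≤ a', u s < 0 := by
    have h1 : u a < 0 := h.u_neg_of_le hlam hlam1 hhor ha le_rfl
    obtain ⟨ε, hε, hball⟩ := Metric.eventually_nhds_iff.1
      (h.continuous_u.continuousAt.eventually (gt_mem_nhds h1))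
    refine ⟨a + ε / 2, by linarith, fun s hs => ?_⟩
    rcases le_total s a with h' | h'
    · exact h.u_neg_of_le hlam hlam1 hhor ha h'
    · refine hball ?_
      rw [Real.dist_eq, abs_of_nonneg (by linarith)]
      linarith
  obtain ⟨l, hl1, hl2, -, hl3⟩ := exists_smooth_inverse hsm
    (a := a') (fun s hs => (hdx s).symm ▸ hneg s hs) hlim
  simp only [hdx] at hl3
  have hanti : StrictAntiOn x (Iic a') :=
    strictAntiOn_of_hasDerivWithinAt_neg (convex_Iic a') h.continuous_x.continuousOn
      (fun s _ => (h.dx s trivial).hasDerivWithinAt)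
      fun s hs => hneg s (interior_subset hs : s ∈ Iic a')
  have hxaa : x a' < x a := hanti haa.le self_mem_Iic haa
  have hxt : x a < x t := by
    rw [← hx]; exact hanti (hsa.trans haa).le haa.le hsa
  obtain ⟨b, hb, hab, hbt, hb'⟩ := exists_last_mem (A := {s | x s ≤ x a})
    (isClosed_le h.continuous_x continuous_const) (le_refl (x a)) hat.le (not_le.2 hxt)
  have hgood : ∀ s ∈ Ioc b t, x a < x s := fun s hs => not_le.1 (hb' s hs)
  have hxb : x b = x a := le_antisymm hb (sub_nonneg.1 (nonneg_of_pos_right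
    (f := fun s => x s - x a) (h.continuous_x.sub continuous_const).continuousAt hbt
    fun s hs => (sub_pos.2 (hgood s hs)).le))
  have hgt : ∀ s ∈ Icc b t, x a' < x s := fun s hs => by
    rcases hs.1.lt_or_eq with h' | h'
    · exact hxaa.trans (hgood s ⟨h', hs.2⟩)
    · rw [← h', hxb]; exact hxaa
  have hDd : ∀ s ∈ Icc b t, HasDerivAt (fun s => z s - z (l (x s)))
      (v s - v (l (x s)) * ((u (l (x s)))⁻¹ * u s)) s := fun s hs =>
    (h.dz s trivial).fun_sub
      ((h.dz (l (x s)) trivial).comp s ((hl3 _ (hgt s hs)).comp s (h.dx s trivial)))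
  -- The height gap at equal radius is nonnegative at `b`, where the earlier branch is at its lowest
  -- point, and would be zero at a meeting time `t`. Its strict growth is the contradiction.
  have hmono : StrictMonoOn (fun s => z s - z (l (x s))) (Icc b t) := by
    refine strictMonoOn_of_hasDerivWithinAt_pos (convex_Icc b t)
      (fun s hs => (hDd s hs).continuousAt.continuousWithinAt)
      (fun s hs => (hDd s (interior_subset hs)).hasDerivWithinAt) fun s hs => ?_
    rw [interior_Icc] at hs
    have has : a < s := hab.trans_lt hs.1
    have hxs := hgood s ⟨hs.1, hs.2.le⟩
    have hvs := h.v_pos_of_gt hlam1 hhor ha has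
    obtain ⟨hla', hxl⟩ := hl1 _ (hgt s (Ioo_subset_Icc_self hs))
    have hla : l (x s) < a := by
      by_contra! hle
      have := hanti.antitoneOn haa.le hla'.le hle
      linarith
    have hvl := h.v_neg_of_lt hlam1 hhor ha hla
    have hul := hneg _ hla'.le
    have e : v s - v (l (x s)) * ((u (l (x s)))⁻¹ * u s) =
        (v s * u (l (x s)) - v (l (x s)) * u s) / u (l (x s)) := by
      have := hul.ne
      field_simp
    rw [e]
    refine div_pos_of_neg_of_neg ?_ hul
    -- For `u ≤ 0` the signs alone suffice. For `u > 0`, the later branch has the larger `|v|`,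
    -- hence the smaller `|u|`, and so the steeper slope.
    rcases le_or_gt (u s) 0 with hus | hus
    · nlinarith
    · have hS := h.steeper_branch hm hlam hlam1 hhor ha haa hl1 hl2 hl3 hneg has hus hxs
      have h1 := h.unit s trivial
      have h2 := h.unit (l (x s)) trivial
      have h3 : u s < -u (l (x s)) := by
        refine lt_of_pow_lt_pow_left₀ 2 (by linarith) ?_
        nlinarith
      nlinarith
  have h1 := hmono (left_mem_Icc.2 hbt.le) (right_mem_Icc.2 hbt.le) hbt
  simp only [hxb, hl2 a haa, ← hx, hl2 s (hsa.trans haa), hz, sub_self] at h1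
  have hmonoz : MonotoneOn z (Icc a b) :=
    monotoneOn_of_hasDerivWithinAt_nonneg (convex_Icc a b) h.continuous_z.continuousOn
      (fun s _ => (h.dz s trivial).hasDerivWithinAt) fun s hs => by
        rw [interior_Icc] at hs
        exact (h.v_pos_of_gt hlam1 hhor ha hs.1).le
  have := hmonoz (left_mem_Icc.2 hab) (right_mem_Icc.2 hab) hab
  linarith

/-- If `lam < 1` and the curve is horizontal only where it moves towards the axis, then it has no
self-intersections. -/
lemma eq_of_horizontal_inward (h : IsProfileOn m lam x u v z univ) (hm : 1 ≤ m) (hlam : 0 < lam)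
    (hlam1 : lam < 1) (hsm : ContDiff ℝ ∞ x) (hhor : ∀ s, v s = 0 → u s = -1)
    {s t : ℝ} (hx : x s = x t) (hz : z s = z t) : s = t := by
  wlog hst : s < t generalizing s t
  · rcases eq_or_lt_of_le (not_lt.1 hst) with h' | h'
    · exact h'.symm
    · exact (this hx.symm hz.symm h').symm
  exfalso
  by_cases hex : ∃ a, v a = 0
  · obtain ⟨a, ha⟩ := hex
    rcases le_or_gt a s with has | hsa
    · have hmono : StrictMonoOn z (Icc s t) :=
        strictMonoOn_of_hasDerivWithinAt_pos (convex_Icc s t) h.continuous_z.continuousOn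
          (fun b _ => (h.dz b trivial).hasDerivWithinAt) fun b hb => by
            rw [interior_Icc] at hb
            exact h.v_pos_of_gt hlam1 hhor ha (has.trans_lt hb.1)
      exact (hmono (left_mem_Icc.2 hst.le) (right_mem_Icc.2 hst.le) hst).ne hz
    rcases le_or_gt t a with hta | hat
    · have hmono : StrictAntiOn z (Icc s t) :=
        strictAntiOn_of_hasDerivWithinAt_neg (convex_Icc s t) h.continuous_z.continuousOn
          (fun b _ => (h.dz b trivial).hasDerivWithinAt) fun b hb => by
            rw [interior_Icc] at hb
            exact h.v_neg_of_lt hlam1 hhor ha (hb.2.trans_le hta)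
      exact (hmono (left_mem_Icc.2 hst.le) (right_mem_Icc.2 hst.le) hst).ne hz.symm
    · exact h.branches_disjoint hm hlam hlam1 hsm hhor ha hsa hat hx hz
  · push Not at hex
    obtain ⟨b, hb⟩ := ((h.tendsto_v_atTop hm hlam).eventually (lt_mem_nhds zero_lt_one)).exists
    have hpos : ∀ c, 0 < v c := by
      intro c
      by_contra! hc
      obtain ⟨d, -, hd⟩ := (isPreconnected_univ.image v h.continuous_v.continuousOn).ordConnected.out
        ⟨c, trivial, rfl⟩ ⟨b, trivial, rfl⟩ ⟨hc, hb.le⟩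
      exact hex d hd
    have hmono : StrictMonoOn z (Icc s t) :=
      strictMonoOn_of_hasDerivWithinAt_pos (convex_Icc s t) h.continuous_z.continuousOn
        (fun b _ => (h.dz b trivial).hasDerivWithinAt) fun b _ => hpos b
    exact (hmono (left_mem_Icc.2 hst.le) (right_mem_Icc.2 hst.le) hst).ne hz

end IsProfileOn

/-! ### The case `lam > 1`: loops and self-intersections. -/

section Loops

/-- The sum of the horizontal positions of the two arcs at equal height is positive at a low height
and negative at `q`, so it vanishes in between. The second arc is to be read as mirrored, so a zero
sum means that the original arcs cross. Working with closed sets of heights and connectedness avoids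
inverting `Z₁` and `Z₂`. -/
lemma exists_meeting_height {X₁ Z₁ X₂ Z₂ : ℝ → ℝ} {a₁ b₁ a₂ b₂ q : ℝ}
    (hX₁ : Continuous X₁) (hZ₁ : Continuous Z₁) (hX₂ : Continuous X₂) (hZ₂ : Continuous Z₂)
    (ha₁ : 0 < a₁) (hab₁ : a₁ < b₁) (ha₂ : 0 < a₂) (hab₂ : a₂ < b₂)
    (hm₁ : StrictMonoOn Z₁ (Icc 0 b₁)) (hm₂ : StrictMonoOn Z₂ (Icc 0 b₂))
    (h0₁ : Z₁ 0 = 0) (h0₂ : Z₂ 0 = 0) (hq₁ : q ≤ Z₁ b₁) (hq₂ : q ≤ Z₂ b₂)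
    (hn₁ : ∀ t ∈ Icc 0 b₁, q ≤ Z₁ t → X₁ t < 0) (hn₂ : ∀ t ∈ Icc 0 b₂, q ≤ Z₂ t → X₂ t < 0)
    (hp₁ : ∀ t ∈ Ioc 0 a₁, 0 < X₁ t) (hp₂ : ∀ t ∈ Ioc 0 a₂, 0 < X₂ t) :
    ∃ t₁ ∈ Ioc 0 b₁, ∃ t₂ ∈ Ioc 0 b₂, X₁ t₁ + X₂ t₂ = 0 ∧ Z₁ t₁ = Z₂ t₂ := by
  set h := min (Z₁ a₁) (Z₂ a₂) with hh
  have hI₁ : a₁ ∈ Icc 0 b₁ := ⟨ha₁.le, hab₁.le⟩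
  have hI₂ : a₂ ∈ Icc 0 b₂ := ⟨ha₂.le, hab₂.le⟩
  have hz₁ : (0 : ℝ) ∈ Icc 0 b₁ := ⟨le_rfl, (ha₁.trans hab₁).le⟩
  have hz₂ : (0 : ℝ) ∈ Icc 0 b₂ := ⟨le_rfl, (ha₂.trans hab₂).le⟩
  have hpos : 0 < h := lt_min (h0₁ ▸ hm₁ hz₁ hI₁ ha₁) (h0₂ ▸ hm₂ hz₂ hI₂ ha₂)
  have hhq : h ≤ q := by
    by_contra! hlt
    have h1 := hn₁ a₁ hI₁ (hlt.le.trans (min_le_left _ _))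
    exact lt_asymm h1 (hp₁ a₁ ⟨ha₁, le_rfl⟩)
  set D : Set (ℝ × ℝ) := {p | p ∈ Icc 0 b₁ ×ˢ Icc 0 b₂ ∧ Z₁ p.1 = Z₂ p.2} with hD
  have hDc : IsCompact D := (isCompact_Icc.prod isCompact_Icc).inter_right
    (isClosed_eq (hZ₁.comp continuous_fst) (hZ₂.comp continuous_snd))
  have hS : Continuous fun p : ℝ × ℝ => X₁ p.1 + X₂ p.2 := by fun_prop
  have hcl : ∀ s : Set ℝ, IsClosed s →
      IsClosed ((fun p : ℝ × ℝ => Z₁ p.1) '' (D ∩ (fun p : ℝ × ℝ => X₁ p.1 + X₂ p.2) ⁻¹' s)) :=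
    fun s hs => ((hDc.inter_right (hs.preimage hS)).image (by fun_prop)).isClosed
  have hex : ∀ y ∈ Icc h q, ∃ p ∈ D, Z₁ p.1 = y := by
    intro y hy
    obtain ⟨t₁, ht₁, e₁⟩ := intermediate_value_Icc hz₁.2 hZ₁.continuousOn
      (show y ∈ Icc (Z₁ 0) (Z₁ b₁) from ⟨by rw [h0₁]; exact hpos.le.trans hy.1, hy.2.trans hq₁⟩)
    obtain ⟨t₂, ht₂, e₂⟩ := intermediate_value_Icc hz₂.2 hZ₂.continuousOn
      (show y ∈ Icc (Z₂ 0) (Z₂ b₂) from ⟨by rw [h0₂]; exact hpos.le.trans hy.1, hy.2.trans hq₂⟩)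
    exact ⟨(t₁, t₂), ⟨⟨ht₁, ht₂⟩, e₁.trans e₂.symm⟩, e₁⟩
  obtain ⟨y, hy, ⟨p, ⟨hpD, hp⟩, hpy⟩, ⟨p', ⟨hpD', hp'⟩, hpy'⟩⟩ :=
    isPreconnected_closed_iff.1 (isPreconnected_Icc (a := h) (b := q)) _ _
      (hcl (Ici 0) isClosed_Ici) (hcl (Iic 0) isClosed_Iic) (fun y hy => by
        obtain ⟨p, hp, hpy⟩ := hex y hy
        rcases le_total 0 (X₁ p.1 + X₂ p.2) with h' | h'
        · exact Or.inl ⟨p, ⟨hp, h'⟩, hpy⟩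
        · exact Or.inr ⟨p, ⟨hp, h'⟩, hpy⟩)
      (by
        obtain ⟨p, ⟨⟨hp1, hp2⟩, hpe⟩, hpy⟩ := hex h ⟨le_rfl, hhq⟩
        refine ⟨h, ⟨le_rfl, hhq⟩, p, ⟨⟨⟨hp1, hp2⟩, hpe⟩, ?_⟩, hpy⟩
        have e1 : p.1 ≤ a₁ := (hm₁.le_iff_le hp1 hI₁).1 (hpy.trans_le (min_le_left _ _))
        have e2 : p.2 ≤ a₂ :=
          (hm₂.le_iff_le hp2 hI₂).1 ((hpe.symm.trans hpy).trans_le (min_le_right _ _))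
        have e3 : 0 < p.1 := lt_of_le_of_ne hp1.1 fun h' => by
          rw [← h', h0₁] at hpy; exact hpos.ne hpy
        have e4 : 0 < p.2 := lt_of_le_of_ne hp2.1 fun h' => by
          rw [hpe, ← h', h0₂] at hpy; exact hpos.ne hpy
        exact (add_pos (hp₁ _ ⟨e3, e1⟩) (hp₂ _ ⟨e4, e2⟩)).le)
      (by
        obtain ⟨p, ⟨⟨hp1, hp2⟩, hpe⟩, hpy⟩ := hex q ⟨hhq, le_rfl⟩
        refine ⟨q, ⟨hhq, le_rfl⟩, p, ⟨⟨⟨hp1, hp2⟩, hpe⟩, ?_⟩, hpy⟩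
        exact (add_neg (hn₁ _ hp1 hpy.ge) (hn₂ _ hp2 (hpe.symm.trans hpy).ge)).le)
  change Z₁ p.1 = y at hpy
  have e1 : p.1 = p'.1 := hm₁.injOn hpD.1.1 hpD'.1.1 (hpy.trans hpy'.symm)
  have e2 : p.2 = p'.2 := hm₂.injOn hpD.1.2 hpD'.1.2
    (by rw [← hpD.2, ← hpD'.2]; exact hpy.trans hpy'.symm)
  have h0 : X₁ p.1 + X₂ p.2 = 0 := by
    refine le_antisymm ?_ hp
    rw [e1, e2]; exact hp'
  refine ⟨p.1, ⟨lt_of_le_of_ne hpD.1.1.1 fun h' => ?_, hpD.1.1.2⟩, p.2,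
    ⟨lt_of_le_of_ne hpD.1.2.1 fun h' => ?_, hpD.1.2.2⟩, h0, hpD.2⟩
  · rw [← h', h0₁] at hpy
    exact (hpos.trans_le hy.1).ne hpy
  · rw [hpD.2, ← h', h0₂] at hpy
    exact (hpos.trans_le hy.1).ne hpy

lemma le_of_deriv_le {f g f' g' : ℝ → ℝ} {e t b : ℝ} (hf : ∀ s, HasDerivAt f (f' s) s)
    (hg : ∀ s ∈ Icc 0 b, HasDerivAt g (g' s) s) (h : ∀ s ∈ Icc 0 b, f' s ≤ g' s + e)
    (h0 : f 0 ≤ g 0) (ht : t ∈ Icc 0 b) : f t ≤ g t + e * t := by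
  have hmono : MonotoneOn (fun s => g s + e * s - f s) (Icc 0 b) := by
    have hd : ∀ s ∈ Icc 0 b, HasDerivAt (fun s => g s + e * s - f s) (g' s + e * 1 - f' s) s :=
      fun s hs => ((hg s hs).fun_add ((hasDerivAt_id' s).const_mul e)).fun_sub (hf s)
    refine monotoneOn_of_hasDerivWithinAt_nonneg (convex_Icc _ _)
      (fun s hs => (hd s hs).continuousAt.continuousWithinAt)
      (fun s hs => (hd s (interior_subset hs)).hasDerivWithinAt) fun s hs => ?_
    linarith [h s (interior_subset hs)]
  have := hmono ⟨le_rfl, ht.1.trans ht.2⟩ ht ht.1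
  simp only [mul_zero] at this
  linarith

/-- A curve whose curvature is close to `n (cos θ + lam)` with `lam > 1`, where `θ` is the angle of
its tangent with the horizontal, starts to the right and ends its half turn on the left. -/
lemma exists_half_turn {n lam : ℝ} (hn : 0 < n) (hlam : 1 < lam) :
    ∃ ε > 0, ∃ q T : ℝ, 0 < T ∧ ∀ X Z Θ k : ℝ → ℝ, X 0 = 0 → Z 0 = 0 → Θ 0 = 0 →
      (∀ t, HasDerivAt X (Real.cos (Θ t)) t) → (∀ t, HasDerivAt Z (Real.sin (Θ t)) t) →
      (∀ t, HasDerivAt Θ (k t) t) →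
      (∀ t ∈ Icc 0 T, |k t - n * (Real.cos (Θ t) + lam)| ≤ ε) →
      ∃ a b, 0 < a ∧ a < b ∧ b ≤ T ∧ StrictMonoOn Z (Icc 0 b) ∧ q ≤ Z b ∧
        (∀ t ∈ Icc 0 b, q ≤ Z t → X t < 0) ∧ ∀ t ∈ Ioc 0 a, 0 < X t := by
  have hpi := Real.pi_pos
  -- Half the least curvature of the model curve. An error at most `κ` leaves curvature at least
  -- `κ`, so a half turn is completed within time `π / κ`.
  set κ := n * (lam - 1) / 2 with hκ
  have hκ0 : 0 < κ := by have := sub_pos.2 hlam; positivity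
  set T := Real.pi / κ with hT
  have hT0 : 0 < T := by positivity
  -- As functions of the angle, `Q` is the exact height of the model curve, and `P` bounds its
  -- horizontal position from above: `cos φ / (cos φ + lam) ≤ cos φ / lam - cos φ ^ 2 / (lam * (1 +
  -- lam))`. The linear part of this bound integrates to zero over a half turn, so `P π < 0`.
  set P : ℝ → ℝ := fun φ => Real.sin φ / (n * lam) -
    (φ / 2 + Real.sin φ * Real.cos φ / 2) / (n * lam * (1 + lam)) with hP
  set Q : ℝ → ℝ := fun φ => (Real.log (1 + lam) - Real.log (Real.cos φ + lam)) / n with hQ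
  have hcl : ∀ φ, lam - 1 ≤ Real.cos φ + lam := fun φ => by linarith [Real.neg_one_le_cos φ]
  have hcl0 : ∀ φ, 0 < Real.cos φ + lam := fun φ => by linarith [hcl φ]
  have hPd : ∀ φ, HasDerivAt P (Real.cos φ / (n * lam) -
      Real.cos φ ^ 2 / (n * lam * (1 + lam))) φ := by
    intro φ
    have h1 := (((hasDerivAt_id' φ).div_const 2).fun_add (((Real.hasDerivAt_sin φ).fun_mul
      (Real.hasDerivAt_cos φ)).div_const 2)).div_const (n * lam * (1 + lam))
    refine (((Real.hasDerivAt_sin φ).div_const (n * lam)).fun_sub h1).congr_deriv ?_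
    have : Real.cos φ * Real.cos φ + Real.sin φ * -Real.sin φ = 2 * Real.cos φ ^ 2 - 1 := by
      nlinarith [Real.sin_sq_add_cos_sq φ]
    rw [this]; ring
  have hQd : ∀ φ, HasDerivAt Q (Real.sin φ / (n * (Real.cos φ + lam))) φ := by
    intro φ
    refine (((((Real.hasDerivAt_cos φ).add_const lam).log (hcl0 φ).ne').const_sub
      (Real.log (1 + lam))).div_const n).congr_deriv ?_
    have := (hcl0 φ).ne'
    field_simp
  set p := Real.pi / 2 / (n * lam * (1 + lam)) with hp
  have hp0 : 0 < p := by positivity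
  have hPpi : P Real.pi = -p := by simp [hP, hp]
  have hPc : Continuous P := continuous_iff_continuousAt.2 fun φ => (hPd φ).continuousAt
  -- Beyond the angle `ψ` the arc is safely on the left. Since `Q ψ < Q π`, a height near `Q π` can
  -- be reached only beyond `ψ`.
  obtain ⟨ψ, hψ, hψP⟩ : ∃ ψ ∈ Ioo 0 Real.pi, ∀ φ ∈ Icc ψ Real.pi, P φ < -(p / 2) := by
    obtain ⟨δ, hδ, hball⟩ := Metric.eventually_nhds_iff.1 (hPc.continuousAt.eventually
      (gt_mem_nhds (show P Real.pi < -(p / 2) by rw [hPpi]; linarith)))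
    refine ⟨max (Real.pi / 2) (Real.pi - δ / 2), ⟨?_, ?_⟩, fun φ hφ => hball ?_⟩
    · exact lt_max_of_lt_left (by positivity)
    · exact max_lt (by linarith) (by linarith)
    · have := (max_le_iff.1 hφ.1).2
      rw [Real.dist_eq, abs_of_nonpos (by linarith [hφ.2])]
      linarith
  have hQmono : ∀ φ ∈ Icc 0 ψ, Q φ ≤ Q ψ := by
    intro φ hφ
    have h1 : Real.cos ψ ≤ Real.cos φ :=
      Real.cos_le_cos_of_nonneg_of_le_pi hφ.1 hψ.2.le hφ.2
    have h2 : Real.log (Real.cos ψ + lam) ≤ Real.log (Real.cos φ + lam) :=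
      Real.log_le_log (hcl0 ψ) (by linarith)
    simp only [hQ]
    gcongr
  have hQlt : Q ψ < Q Real.pi := by
    have h1 : Real.cos Real.pi < Real.cos ψ :=
      Real.cos_lt_cos_of_nonneg_of_le_pi hψ.1.le le_rfl hψ.2
    have h2 : Real.log (Real.cos Real.pi + lam) < Real.log (Real.cos ψ + lam) :=
      Real.log_lt_log (hcl0 _) (by linarith)
    simp only [hQ]
    gcongr
  set e := min (p / 4) ((Q Real.pi - Q ψ) / 4) with he
  have he0 : 0 < e := lt_min (by positivity) (by linarith)
  have he1 : e ≤ p / 4 := min_le_left _ _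
  have he2 : e ≤ (Q Real.pi - Q ψ) / 4 := min_le_right _ _
  -- The second entry keeps the accumulated error in `X` and `Z` over time `T` below `e`, since the
  -- model curvature is at least `2 * κ`.
  set ε := min κ (e * (2 * κ) / T) with hε
  have hε0 : 0 < ε := lt_min hκ0 (by positivity)
  refine ⟨ε, hε0, Q Real.pi - e, T, hT0, fun X Z Θ k hX0 hZ0 hΘ0 hX hZ hΘ hk => ?_⟩
  have hK0 : ∀ t, 2 * κ ≤ n * (Real.cos (Θ t) + lam) := fun t => by
    have := mul_le_mul_of_nonneg_left (hcl (Θ t)) hn.le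
    rw [hκ]; linarith
  have hkκ : ∀ t ∈ Icc 0 T, κ ≤ k t := fun t ht => by
    have h1 := (abs_le.1 (hk t ht)).1
    have h2 : ε ≤ κ := min_le_left _ _
    linarith [hK0 t]
  have hΘc : Continuous Θ := continuous_iff_continuousAt.2 fun t => (hΘ t).continuousAt
  have hΘm : StrictMonoOn Θ (Icc 0 T) :=
    strictMonoOn_of_hasDerivWithinAt_pos (convex_Icc 0 T) hΘc.continuousOn
      (fun t _ => (hΘ t).hasDerivWithinAt)
      fun t ht => hκ0.trans_le (hkκ t (interior_subset ht))
  have hΘT : Real.pi ≤ Θ T := by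
    have := le_of_deriv_le (f := fun t => κ * t) (f' := fun _ => κ * 1) (g := Θ) (g' := k) (e := 0)
      (fun s => (hasDerivAt_id' s).const_mul κ) (fun s _ => hΘ s) (fun s hs => by
        linarith [hkκ s hs]) (by simp [hΘ0]) (right_mem_Icc.2 hT0.le)
    have h2 : κ * T = Real.pi := by rw [hT]; field_simp
    linarith
  obtain ⟨b, hb, hΘb⟩ := intermediate_value_Icc hT0.le hΘc.continuousOn
    (show Real.pi ∈ Icc (Θ 0) (Θ T) from ⟨by rw [hΘ0]; exact hpi.le, hΘT⟩)
  obtain ⟨a, ha, hΘa⟩ := intermediate_value_Icc hb.1 hΘc.continuousOn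
    (show Real.pi / 2 ∈ Icc (Θ 0) (Θ b) from ⟨by rw [hΘ0]; positivity, by rw [hΘb]; linarith⟩)
  have ha0 : 0 < a := lt_of_le_of_ne ha.1 fun h => by rw [← h, hΘ0] at hΘa; linarith
  have hab : a < b := lt_of_le_of_ne ha.2 fun h => by rw [h, hΘb] at hΘa; linarith
  have hsub : Icc 0 b ⊆ Icc 0 T := Icc_subset_Icc le_rfl hb.2
  have hΘI : ∀ t ∈ Icc 0 b, Θ t ∈ Icc 0 Real.pi := fun t ht =>
    ⟨by rw [← hΘ0]; exact hΘm.monotoneOn ⟨le_rfl, hT0.le⟩ (hsub ht) ht.1,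
      by rw [← hΘb]; exact hΘm.monotoneOn (hsub ht) hb ht.2⟩
  have herr : ∀ t ∈ Icc 0 b, ∀ w, |w| ≤ 1 →
      |w - w / (n * (Real.cos (Θ t) + lam)) * k t| ≤ ε / (2 * κ) := by
    intro t ht w hw
    have h0 : 0 < n * (Real.cos (Θ t) + lam) := mul_pos hn (hcl0 _)
    have e1 : w - w / (n * (Real.cos (Θ t) + lam)) * k t =
        w * (n * (Real.cos (Θ t) + lam) - k t) / (n * (Real.cos (Θ t) + lam)) := by
      rw [eq_div_iff h0.ne', sub_mul, mul_right_comm, div_mul_cancel₀ _ h0.ne']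
      ring
    rw [e1, abs_div, abs_mul, abs_of_pos h0, abs_sub_comm]
    have h1 := hk t (hsub ht)
    have h2 := hK0 t
    gcongr
    calc |w| * _ ≤ 1 * ε := by gcongr
      _ = ε := one_mul _
  have heT : ε / (2 * κ) * T ≤ e := by
    have h1 : ε ≤ e * (2 * κ) / T := min_le_right _ _
    rw [le_div_iff₀ hT0] at h1
    rw [div_mul_eq_mul_div, div_le_iff₀ (by positivity)]
    exact h1
  have hel : ∀ t ∈ Icc 0 b, ε / (2 * κ) * t ≤ e := fun t ht =>
    (mul_le_mul_of_nonneg_left (hsub ht).2 (by positivity)).trans heT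
  have hXP : ∀ t ∈ Icc 0 b, X t ≤ P (Θ t) + e := by
    intro t ht
    have := le_of_deriv_le (g := fun t => P (Θ t)) (e := ε / (2 * κ)) hX
      (fun s _ => (hPd (Θ s)).comp s (hΘ s)) (fun s hs => ?_) (by simp [hX0, hΘ0, hP]) ht
    · linarith [hel t ht]
    · have h1 := (abs_le.1 (herr s hs _ (Real.abs_cos_le_one (Θ s)))).2
      have h2 : Real.cos (Θ s) / (n * (Real.cos (Θ s) + lam)) ≤
          Real.cos (Θ s) / (n * lam) - Real.cos (Θ s) ^ 2 / (n * lam * (1 + lam)) := by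
        have h3 := hcl0 (Θ s)
        have h4 : Real.cos (Θ s) / (n * (Real.cos (Θ s) + lam)) = Real.cos (Θ s) / (n * lam) -
            Real.cos (Θ s) ^ 2 / (n * lam * (Real.cos (Θ s) + lam)) := by
          field_simp; ring
        rw [h4]
        have := Real.cos_le_one (Θ s)
        gcongr
      have h3 := mul_le_mul_of_nonneg_right h2 (hκ0.le.trans (hkκ s (hsub hs)))
      linarith
  have hZQ : ∀ t ∈ Icc 0 b, Z t ≤ Q (Θ t) + e := by
    intro t ht
    have := le_of_deriv_le (g := fun t => Q (Θ t)) (e := ε / (2 * κ)) hZ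
      (fun s _ => (hQd (Θ s)).comp s (hΘ s)) (fun s hs => ?_) (by simp [hZ0, hΘ0, hQ]) ht
    · linarith [hel t ht]
    · linarith [(abs_le.1 (herr s hs _ (Real.abs_sin_le_one (Θ s)))).2]
  have hQZ : ∀ t ∈ Icc 0 b, Q (Θ t) - e ≤ Z t := by
    intro t ht
    have := le_of_deriv_le (f := fun t => Q (Θ t)) (e := ε / (2 * κ))
      (fun s => (hQd (Θ s)).comp s (hΘ s)) (fun s _ => hZ s) (fun s hs => ?_)
      (by simp [hZ0, hΘ0, hQ]) ht
    · linarith [hel t ht]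
    · linarith [(abs_le.1 (herr s hs _ (Real.abs_sin_le_one (Θ s)))).1]
  have hXc : Continuous X := continuous_iff_continuousAt.2 fun t => (hX t).continuousAt
  have hZc : Continuous Z := continuous_iff_continuousAt.2 fun t => (hZ t).continuousAt
  have hb0 : 0 ≤ b := hb.1
  refine ⟨a, b, ha0, hab, hb.2, ?_, ?_, fun t ht htq => ?_, fun t ht => ?_⟩
  · refine strictMonoOn_of_hasDerivWithinAt_pos (convex_Icc 0 b) hZc.continuousOn
      (fun t _ => (hZ t).hasDerivWithinAt) fun t ht => ?_
    rw [interior_Icc] at ht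
    refine Real.sin_pos_of_pos_of_lt_pi ?_ ?_
    · rw [← hΘ0]; exact hΘm ⟨le_rfl, hT0.le⟩ (hsub (Ioo_subset_Icc_self ht)) ht.1
    · rw [← hΘb]; exact hΘm (hsub (Ioo_subset_Icc_self ht)) hb ht.2
  · have := hQZ b (right_mem_Icc.2 hb0)
    rwa [hΘb] at this
  · have h1 := hZQ t ht
    have hψt : ψ ≤ Θ t := by
      by_contra! h
      have := hQmono (Θ t) ⟨(hΘI t ht).1, h.le⟩
      linarith
    have h2 := hψP (Θ t) ⟨hψt, (hΘI t ht).2⟩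
    linarith [hXP t ht]
  · have haT : Icc 0 a ⊆ Icc 0 T := Icc_subset_Icc le_rfl (ha.2.trans hb.2)
    have hXm : StrictMonoOn X (Icc 0 a) := by
      refine strictMonoOn_of_hasDerivWithinAt_pos (convex_Icc 0 a) hXc.continuousOn
        (fun t _ => (hX t).hasDerivWithinAt) fun t ht => ?_
      rw [interior_Icc] at ht
      refine Real.cos_pos_of_mem_Ioo ⟨?_, ?_⟩
      · have : Θ 0 < Θ t := hΘm ⟨le_rfl, hT0.le⟩ (haT (Ioo_subset_Icc_self ht)) ht.1
        rw [hΘ0] at this; linarith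
      · rw [← hΘa]; exact hΘm (haT (Ioo_subset_Icc_self ht)) (haT (right_mem_Icc.2 ha0.le)) ht.2
    rw [← hX0]
    exact hXm (left_mem_Icc.2 ha0.le) ⟨ht.1.le, ht.2⟩ ht.1

end Loops

namespace IsProfileOn

variable {m : ℕ} {lam : ℝ} {x u v z : ℝ → ℝ}

/-- Integrate the curvature. The inner product of `(u, v)` with `(cos Θ, sin Θ)` has zero derivative
and initial value `1`, and unit vectors with inner product `1` coincide. -/
lemma exists_angle (h : IsProfileOn m lam x u v z univ) :
    ∃ Θ : ℝ → ℝ, (∀ s, HasDerivAt Θ (curv m lam (x s) (u s) (v s)) s) ∧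
      (∀ s, Real.cos (Θ s) = u s) ∧ ∀ s, Real.sin (Θ s) = v s := by
  have hc : Continuous fun s => curv m lam (x s) (u s) (v s) := by
    have h1 := h.continuous_x
    have h2 := h.continuous_u
    have h3 := h.continuous_v
    unfold curv
    exact (continuous_const.mul (h2.add continuous_const)).sub
      ((continuous_const.mul h3).div h1 fun s => (h.pos s trivial).ne')
  obtain ⟨θ₀, hθu, hθv⟩ : ∃ θ, Real.cos θ = u 0 ∧ Real.sin θ = v 0 := by
    have hu := h.unit 0 trivial
    have hn : ‖(⟨u 0, v 0⟩ : ℂ)‖ = 1 := by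
      rw [Complex.norm_eq_sqrt_sq_add_sq, hu, Real.sqrt_one]
    refine ⟨Complex.arg ⟨u 0, v 0⟩, ?_, ?_⟩
    · rw [Complex.cos_arg (by intro h0; rw [h0] at hn; simp at hn), hn, div_one]
    · rw [Complex.sin_arg, hn, div_one]
  set Θ : ℝ → ℝ := fun s => (∫ t in (0 : ℝ)..s, curv m lam (x t) (u t) (v t)) + θ₀ with hΘ
  have hd : ∀ s, HasDerivAt Θ (curv m lam (x s) (u s) (v s)) s := fun s =>
    (intervalIntegral.integral_hasDerivAt_right (hc.intervalIntegrable _ _)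
      (hc.stronglyMeasurableAtFilter _ _) hc.continuousAt).add_const θ₀
  have hΘ0 : Θ 0 = θ₀ := by simp [hΘ]
  have hcd : ∀ s, HasDerivAt (fun s => u s * Real.cos (Θ s) + v s * Real.sin (Θ s)) 0 s := by
    intro s
    refine (((h.du s trivial).fun_mul (hd s).cos).fun_add
      ((h.dv s trivial).fun_mul (hd s).sin)).congr_deriv ?_
    ring
  have hconst : ∀ s, u s * Real.cos (Θ s) + v s * Real.sin (Θ s) = 1 := by
    intro s
    have := is_const_of_deriv_eq_zero (f := fun s => u s * Real.cos (Θ s) + v s * Real.sin (Θ s))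
      (fun s => (hcd s).differentiableAt) (fun s => (hcd s).deriv) s 0
    rw [this, hΘ0, hθu, hθv]
    linarith [h.unit 0 trivial]
  have hsq : ∀ s, (Real.cos (Θ s) - u s) ^ 2 + (Real.sin (Θ s) - v s) ^ 2 = 0 := fun s => by
    nlinarith [hconst s, h.unit s trivial, Real.sin_sq_add_cos_sq (Θ s)]
  refine ⟨Θ, hd, fun s => ?_, fun s => ?_⟩
  · have : (Real.cos (Θ s) - u s) ^ 2 = 0 := by
      nlinarith [hsq s, sq_nonneg (Real.cos (Θ s) - u s), sq_nonneg (Real.sin (Θ s) - v s)]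
    linarith [pow_eq_zero_iff two_ne_zero |>.1 this]
  · have : (Real.sin (Θ s) - v s) ^ 2 = 0 := by
      nlinarith [hsq s, sq_nonneg (Real.cos (Θ s) - u s), sq_nonneg (Real.sin (Θ s) - v s)]
    linarith [pow_eq_zero_iff two_ne_zero |>.1 this]

/-- If `lam > 1`, the curve has self-intersections arbitrarily far from the axis. -/
lemma exists_self_intersection (h : IsProfileOn m lam x u v z univ) (hlam1 : 1 < lam)
    (hlim : Tendsto x atBot atTop) (Y a : ℝ) :
    ∃ s t, s < t ∧ t < a ∧ x s = x t ∧ z s = z t ∧ Y < x s := by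
  have hn : (0 : ℝ) < (m : ℝ) + 1 := by positivity
  obtain ⟨ε, hε, q, T, hT, harc⟩ := exists_half_turn hn hlam1
  obtain ⟨Θ, hΘ, hcos, hsin⟩ := h.exists_angle
  set κ := ((m : ℝ) + 1) * (lam - 1) / 2 with hκ
  have hκ0 : 0 < κ := by have := sub_pos.2 hlam1; positivity
  obtain ⟨b, hb⟩ := eventually_atBot.1 ((hlim.eventually_gt_atTop
    (max Y (max (m / ε) (m / κ)))).and (eventually_lt_atBot a))
  have hcurv : ∀ s ≤ b, ∀ e > 0, m / e < x s →
      |curv m lam (x s) (u s) (v s) - ((m : ℝ) + 1) * (u s + lam)| ≤ e := by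
    intro s hs e he hxe
    have hp := h.pos s trivial
    rw [div_lt_iff₀ he] at hxe
    have : curv m lam (x s) (u s) (v s) - ((m : ℝ) + 1) * (u s + lam) = -(m * v s / x s) := by
      rw [curv]; ring
    rw [this, abs_neg, abs_div, abs_mul, abs_of_pos hp, Nat.abs_cast, div_le_iff₀ hp]
    have := mul_le_mul_of_nonneg_left (h.abs_v_le (mem_univ s)) (Nat.cast_nonneg (α := ℝ) m)
    linarith
  have hbig : ∀ s ≤ b, Y < x s ∧ m / ε < x s ∧ m / κ < x s ∧ s < a := by
    intro s hs
    obtain ⟨h1, h2⟩ := hb s hs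
    simp only [max_lt_iff] at h1
    exact ⟨h1.1, h1.2.1, h1.2.2, h2⟩
  set c := b - T with hc
  -- The angle gains at least `2 π` over a time `2 π / κ`, so it passes a multiple of `2 π`, where
  -- the tangent is horizontal and outward. Stopping before `b - T` leaves room for the forward half
  -- turn.
  obtain ⟨s₀, hs₀, j, hj⟩ : ∃ s₀ ≤ c, ∃ j : ℤ, Θ s₀ = j * (2 * Real.pi) := by
    have hpi := Real.two_pi_pos
    set d := c - 2 * Real.pi / κ with hd
    have hdc : d ≤ c := by rw [hd]; have : 0 < 2 * Real.pi / κ := by positivity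
                           linarith
    have hmono : MonotoneOn (fun s => Θ s - κ * s) (Iic b) := by
      refine monotoneOn_of_hasDerivWithinAt_nonneg (convex_Iic b)
        (f' := fun s => curv m lam (x s) (u s) (v s) - κ * 1)
        (fun s _ => ((hΘ s).continuousAt.sub (by fun_prop)).continuousWithinAt)
        (fun s _ => ((hΘ s).fun_sub ((hasDerivAt_id' s).const_mul κ)).hasDerivWithinAt)
        fun s hs => ?_
      have hsb : s ≤ b := (interior_subset hs : s ∈ Iic b)
      have h1 := (abs_le.1 (hcurv s hsb κ hκ0 (hbig s hsb).2.2.1)).1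
      have h2 := (abs_le.1 (h.abs_u_le (mem_univ s))).1
      have h3 : 2 * κ ≤ ((m : ℝ) + 1) * (u s + lam) := by
        have : ((m : ℝ) + 1) * (lam - 1) ≤ ((m : ℝ) + 1) * (u s + lam) := by gcongr; linarith
        rw [hκ]; linarith
      linarith
    have hcb : c ≤ b := by rw [hc]; linarith
    have h1 := hmono (hdc.trans hcb : d ∈ Iic b) hcb hdc
    have h2 : κ * c - κ * d = 2 * Real.pi := by rw [hd]; field_simp; ring
    simp only at h1
    have hfl := Int.floor_le (Θ c / (2 * Real.pi))
    have hfl' := Int.lt_floor_add_one (Θ c / (2 * Real.pi))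
    rw [le_div_iff₀ hpi] at hfl
    rw [div_lt_iff₀ hpi] at hfl'
    obtain ⟨s₀, hs₀, hs₀'⟩ := intermediate_value_Icc hdc
      (continuous_iff_continuousAt.2 fun t => (hΘ t).continuousAt).continuousOn
      (show (⌊Θ c / (2 * Real.pi)⌋ : ℝ) * (2 * Real.pi) ∈ Icc (Θ d) (Θ c) from
        ⟨by linarith, hfl⟩)
    exact ⟨s₀, hs₀.2, _, hs₀'⟩
  have hadd : ∀ t : ℝ, HasDerivAt (fun t => s₀ + t) 1 t := fun t => (hasDerivAt_id' t).const_add s₀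
  have hsub : ∀ t : ℝ, HasDerivAt (fun t => s₀ - t) (-1) t := fun t =>
    (hasDerivAt_id' t).const_sub s₀
  obtain ⟨a₁, b₁, ha₁, hab₁, hbT₁, hm₁, hq₁, hn₁, hp₁⟩ := harc (fun t => x (s₀ + t) - x s₀)
    (fun t => z (s₀ + t) - z s₀) (fun t => Θ (s₀ + t) - j * (2 * Real.pi))
    (fun t => curv m lam (x (s₀ + t)) (u (s₀ + t)) (v (s₀ + t)))
    (by simp) (by simp) (by simp [hj])
    (fun t => (((h.dx _ trivial).comp t (hadd t)).sub_const _).congr_deriv (by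
      rw [Real.cos_sub_int_mul_two_pi, hcos, mul_one]))
    (fun t => (((h.dz _ trivial).comp t (hadd t)).sub_const _).congr_deriv (by
      rw [Real.sin_sub_int_mul_two_pi, hsin, mul_one]))
    (fun t => (((hΘ _).comp t (hadd t)).sub_const _).congr_deriv (mul_one _))
    (fun t ht => by
      rw [Real.cos_sub_int_mul_two_pi, hcos]
      have hsb : s₀ + t ≤ b := by rw [hc] at hs₀; linarith [ht.2]
      exact hcurv _ hsb ε hε (hbig _ hsb).2.1)
  -- Reversing time and reflecting `x` about `x s₀` preserves the curvature equation, so the same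
  -- half-turn estimate applies to the backward arc.
  obtain ⟨a₂, b₂, ha₂, hab₂, hbT₂, hm₂, hq₂, hn₂, hp₂⟩ := harc (fun t => x s₀ - x (s₀ - t))
    (fun t => z (s₀ - t) - z s₀) (fun t => -(Θ (s₀ - t) - j * (2 * Real.pi)))
    (fun t => curv m lam (x (s₀ - t)) (u (s₀ - t)) (v (s₀ - t)))
    (by simp) (by simp) (by simp [hj])
    (fun t => (((h.dx _ trivial).comp t (hsub t)).const_sub _).congr_deriv (by
      rw [Real.cos_neg, Real.cos_sub_int_mul_two_pi, hcos]; ring))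
    (fun t => (((h.dz _ trivial).comp t (hsub t)).sub_const _).congr_deriv (by
      rw [Real.sin_neg, Real.sin_sub_int_mul_two_pi, hsin]; ring))
    (fun t => (((hΘ _).comp t (hsub t)).sub_const _).fun_neg.congr_deriv (by ring))
    (fun t ht => by
      rw [Real.cos_neg, Real.cos_sub_int_mul_two_pi, hcos]
      have hsb : s₀ - t ≤ b := by rw [hc] at hs₀; linarith [ht.1]
      exact hcurv _ hsb ε hε (hbig _ hsb).2.1)
  have hxc := h.continuous_x
  have hzc := h.continuous_z
  obtain ⟨t₁, ht₁, t₂, ht₂, hX, hZ⟩ := exists_meeting_height (by fun_prop) (by fun_prop)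
    (by fun_prop) (by fun_prop) ha₁ hab₁ ha₂ hab₂ hm₁ hm₂ (by simp) (by simp) hq₁ hq₂ hn₁ hn₂
    hp₁ hp₂
  have h1 := ht₁.1
  have h2 := ht₂.1
  have h3 := ht₁.2.trans hbT₁
  have hb1 : s₀ + t₁ ≤ b := by rw [hc] at hs₀; linarith
  have hb2 : s₀ - t₂ ≤ b := by linarith
  refine ⟨s₀ - t₂, s₀ + t₁, by linarith, (hbig _ hb1).2.2.2, by linarith, by linarith,
    (hbig _ hb2).1⟩

end IsProfileOn

/-! ### Inverse functions on manifolds and the trace of a split operator. -/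

section InverseFunction

variable {E F H H' : Type*} [NormedAddCommGroup E] [NormedSpace ℝ E] [CompleteSpace E]
  [NormedAddCommGroup F] [NormedSpace ℝ F] [CompleteSpace F] [TopologicalSpace H]
  [TopologicalSpace H'] {I : ModelWithCorners ℝ E H} {J : ModelWithCorners ℝ F H'}
  [I.Boundaryless]
  {N M : Type*} [TopologicalSpace N] [ChartedSpace H N] [IsManifold I ∞ N]
  [TopologicalSpace M] [ChartedSpace H' M]

/-- The inverse function theorem on manifolds without boundary. -/
lemma exists_local_inverse {f : N → M} {q : N} (hf : ContMDiffAt I J ∞ f q)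
    (hbij : Function.Bijective (mfderiv I J f q)) :
    ∃ g : M → N, ContMDiffAt J I ∞ g (f q) ∧ g (f q) = q ∧ ∀ᶠ y in 𝓝 (f q), f (g y) = y := by
  obtain ⟨hcont, hdiff⟩ := contMDiffAt_iff.1 hf
  rw [I.range_eq_univ, contDiffWithinAt_univ] at hdiff
  set F₀ : E → F := extChartAt J (f q) ∘ f ∘ (extChartAt I q).symm with hF₀
  have hq : (extChartAt I q).symm (extChartAt I q q) = q := extChartAt_to_inv q
  have hF₀q : F₀ (extChartAt I q q) = extChartAt J (f q) (f q) := by simp [hF₀]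
  have hder := (hf.mdifferentiableAt (by simp)).hasMFDerivAt.2
  let L : E →L[ℝ] F := mfderiv I J f q
  have hL : HasFDerivAt F₀ L (extChartAt I q q) := by
    have h : HasFDerivWithinAt F₀ L (range I) (extChartAt I q q) := hder
    rwa [I.range_eq_univ, hasFDerivWithinAt_univ] at h
  have hLb : Function.Bijective L := hbij
  let e : E ≃L[ℝ] F := ContinuousLinearEquiv.ofBijective L
    (LinearMap.ker_eq_bot.2 hLb.1) (LinearMap.range_eq_top.2 hLb.2)
  have hLe : HasFDerivAt F₀ (e : E →L[ℝ] F) (extChartAt I q q) := by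
    rwa [ContinuousLinearEquiv.coe_ofBijective]
  set g₀ : F → E := hdiff.localInverse hLe (by simp) with hg₀
  have hg₀s : ContDiffAt ℝ ∞ g₀ (extChartAt J (f q) (f q)) := by
    rw [← hF₀q]; exact hdiff.to_localInverse hLe (by simp)
  have hg₀q : g₀ (extChartAt J (f q) (f q)) = extChartAt I q q := by
    rw [← hF₀q]; exact hdiff.localInverse_apply_image hLe (by simp)
  have hright : ∀ᶠ w in 𝓝 (extChartAt J (f q) (f q)), F₀ (g₀ w) = w := by
    rw [← hF₀q]
    exact (hdiff.hasStrictFDerivAt' hLe (by simp)).eventually_right_inverse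
  have hψ : ContMDiffAt J 𝓘(ℝ, F) ∞ (extChartAt J (f q)) (f q) := contMDiffAt_extChartAt
  have hφ : ContMDiffAt 𝓘(ℝ, E) I ∞ (extChartAt I q).symm (extChartAt I q q) :=
    (contMDiffOn_extChartAt_symm q).contMDiffAt (extChartAt_target_mem_nhds q)
  set g : M → N := fun y => (extChartAt I q).symm (g₀ (extChartAt J (f q) y)) with hg
  have hgs : ContMDiffAt J I ∞ g (f q) := by
    refine ContMDiffAt.comp (f q) (g := (extChartAt I q).symm) (by rw [hg₀q]; exact hφ) ?_
    exact ContMDiffAt.comp (f q) (g := g₀) hg₀s.contMDiffAt hψ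
  have hgq : g (f q) = q := by simp only [hg, hg₀q, hq]
  refine ⟨g, hgs, hgq, ?_⟩
  have h1 : ∀ᶠ y in 𝓝 (f q), F₀ (g₀ (extChartAt J (f q) y)) = extChartAt J (f q) y :=
    hψ.continuousAt.eventually hright
  have h2 : ∀ᶠ y in 𝓝 (f q), f (g y) ∈ (extChartAt J (f q)).source := by
    have hc : ContinuousAt (f ∘ g) (f q) :=
      ContinuousAt.comp (by rw [hgq]; exact hcont) hgs.continuousAt
    refine hc.eventually_mem ?_
    rw [Function.comp_apply, hgq]
    exact extChartAt_source_mem_nhds (f q)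
  have h3 : ∀ᶠ y in 𝓝 (f q), y ∈ (extChartAt J (f q)).source :=
    extChartAt_source_mem_nhds (f q)
  filter_upwards [h1, h2, h3] with y hy1 hy2 hy3
  exact (extChartAt J (f q)).injOn hy2 hy3 hy1

end InverseFunction

/-- Used with `V` the tangent space of the sphere: `k₁` is the principal curvature along the orbits,
of multiplicity `dim V`, and `k₂` is the one along the profile curve. -/
lemma trace_eq_of_splitting {V W : Type*} [AddCommGroup V] [Module ℝ V] [AddCommGroup W]
    [Module ℝ W] [FiniteDimensional ℝ V] [FiniteDimensional ℝ W]
    (A : V × ℝ →ₗ[ℝ] W) (hA : Function.Bijective A) (S : W →ₗ[ℝ] W) {k₁ k₂ : ℝ}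
    (h : ∀ y t, S (A (y, t)) = A (k₁ • y, k₂ * t)) :
    LinearMap.trace ℝ W S = Module.finrank ℝ V * k₁ + k₂ := by
  let e : (V × ℝ) ≃ₗ[ℝ] W := LinearEquiv.ofBijective A hA
  have he : S = e.conj ((k₁ • LinearMap.id).prodMap (k₂ • LinearMap.id)) := by
    ext w
    obtain ⟨⟨y, t⟩, rfl⟩ := e.surjective w
    simp [LinearEquiv.conj_apply, e, h]
  rw [he, LinearMap.trace_conj', LinearMap.trace_prodMap']
  simp [mul_comm]

/-! ### Polar coordinates in the ambient space. -/

section Ambient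

variable {m : ℕ}

/-- The inclusion of the horizontal hyperplane. -/
noncomputable def horIncl (m : ℕ) : EuclideanSpace ℝ (Fin (m + 1)) →L[ℝ] Amb m :=
  LinearMap.toContinuousLinearMap
    { toFun := fun w => WithLp.toLp 2 (Fin.snoc (α := fun _ => ℝ) (fun i => w i) 0)
      map_add' := fun w w' => by
        ext i
        refine Fin.lastCases ?_ (fun j => ?_) i <;> simp
      map_smul' := fun c w => by
        ext i
        refine Fin.lastCases ?_ (fun j => ?_) i <;> simp }

lemma horIncl_castSucc (w : EuclideanSpace ℝ (Fin (m + 1))) (i : Fin (m + 1)) :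
    horIncl m w i.castSucc = w i := by
  simp [horIncl]

lemma horIncl_last (w : EuclideanSpace ℝ (Fin (m + 1))) :
    horIncl m w (Fin.last (m + 1)) = 0 := by
  simp [horIncl]

lemma vert_castSucc (i : Fin (m + 1)) : vert m i.castSucc = 0 := by
  simp [vert]

lemma vert_last : vert m (Fin.last (m + 1)) = 1 := by
  simp [vert]

lemma amb_ext {p q : Amb m} (h : hor p = hor q) (hz : height p = height q) : p = q := by
  ext i
  refine Fin.lastCases hz (fun j => ?_) i
  exact congrArg (fun w : EuclideanSpace ℝ (Fin (m + 1)) => w j) h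

lemma rotPoint_eq (x z : ℝ) (w : EuclideanSpace ℝ (Fin (m + 1))) :
    rotPoint x z w = x • horIncl m w + z • vert m := by
  ext i
  refine Fin.lastCases ?_ (fun j => ?_) i <;>
    simp [rotPoint, horIncl_castSucc, horIncl_last, vert_castSucc, vert_last]

lemma hor_rotPoint (x z : ℝ) (w : EuclideanSpace ℝ (Fin (m + 1))) :
    hor (rotPoint x z w) = x • w := by
  ext i
  simp [hor, rotPoint]

lemma height_rotPoint (x z : ℝ) (w : EuclideanSpace ℝ (Fin (m + 1))) :
    height (rotPoint x z w) = z := by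
  simp [height, rotPoint]

lemma rotPoint_neg (x z : ℝ) (w : EuclideanSpace ℝ (Fin (m + 1))) :
    rotPoint x z (-w) = rotPoint (-x) z w := by
  simp [rotPoint_eq]

lemma inner_horIncl (w w' : EuclideanSpace ℝ (Fin (m + 1))) :
    inner ℝ (horIncl m w) (horIncl m w') = inner ℝ w w' := by
  simp [PiLp.inner_apply, Fin.sum_univ_castSucc, horIncl_castSucc, horIncl_last]

lemma inner_horIncl_vert (w : EuclideanSpace ℝ (Fin (m + 1))) :
    inner ℝ (horIncl m w) (vert m) = 0 := by
  simp [PiLp.inner_apply, Fin.sum_univ_castSucc, horIncl_castSucc, horIncl_last, vert_castSucc]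

lemma inner_vert_horIncl (w : EuclideanSpace ℝ (Fin (m + 1))) :
    inner ℝ (vert m) (horIncl m w) = 0 := by
  rw [real_inner_comm, inner_horIncl_vert]

lemma inner_vert_vert : inner ℝ (vert m) (vert m) = 1 := by
  rw [PiLp.inner_apply, Fin.sum_univ_castSucc]
  simp [vert_castSucc, vert_last]

lemma inner_rotPoint (a b c d : ℝ) (w w' : EuclideanSpace ℝ (Fin (m + 1))) :
    inner ℝ (rotPoint a b w) (rotPoint c d w') = a * c * inner ℝ w w' + b * d := by
  simp only [rotPoint_eq, inner_add_left, inner_add_right, inner_smul_left, inner_smul_right,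
    inner_horIncl, inner_horIncl_vert, inner_vert_horIncl, inner_vert_vert]
  simp
  ring

lemma eq_horIncl_add_vert (q : Amb m) : q = horIncl m (hor q) + height q • vert m := by
  ext i
  refine Fin.lastCases ?_ (fun j => ?_) i
  · simp [horIncl_last, vert_last, height]
  · simp [horIncl_castSucc, vert_castSucc, hor]

lemma height_vert : height (vert m) = 1 := vert_last

lemma height_horIncl (w : EuclideanSpace ℝ (Fin (m + 1))) : height (horIncl m w) = 0 :=
  horIncl_last w

lemma continuous_hor : Continuous (hor : Amb m → _) := by
  unfold hor
  fun_prop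

lemma continuous_height : Continuous (height : Amb m → ℝ) := by
  unfold height
  fun_prop

lemma norm_sphere (w : USphere m) : ‖(w : EuclideanSpace ℝ (Fin (m + 1)))‖ = 1 := by
  simp

lemma inner_sphere_self (w : USphere m) :
    inner ℝ (w : EuclideanSpace ℝ (Fin (m + 1))) (w : EuclideanSpace ℝ (Fin (m + 1))) = 1 := by
  rw [real_inner_self_eq_norm_sq, norm_sphere, one_pow]

lemma norm_hor_rotPoint {x : ℝ} (hx : 0 < x) (z : ℝ) (w : USphere m) :
    ‖hor (rotPoint x z (w : EuclideanSpace ℝ (Fin (m + 1))))‖ = x := by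
  rw [hor_rotPoint, norm_smul, norm_sphere, mul_one, Real.norm_of_nonneg hx.le]

/-- Polar coordinates are unique. -/
lemma rotPoint_inj {x z x' z' : ℝ} (hx : 0 < x) (hx' : 0 < x') {w w' : USphere m}
    (h : rotPoint x z (w : EuclideanSpace ℝ (Fin (m + 1))) = rotPoint x' z' w') :
    x = x' ∧ z = z' ∧ w = w' := by
  have h1 : x = x' := by
    rw [← norm_hor_rotPoint hx z w, h, norm_hor_rotPoint hx']
  subst h1
  refine ⟨rfl, by rw [← height_rotPoint x z w.1, h, height_rotPoint], Subtype.ext ?_⟩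
  have h2 := congrArg hor h
  rw [hor_rotPoint, hor_rotPoint] at h2
  exact smul_right_injective _ hx.ne' h2

/-- The differential of the inclusion of the sphere. -/
noncomputable def sphereDiff (w : USphere m) :
    EuclideanSpace ℝ (Fin m) →L[ℝ] EuclideanSpace ℝ (Fin (m + 1)) :=
  mfderiv (𝓡 m) 𝓘(ℝ, EuclideanSpace ℝ (Fin (m + 1)))
    ((↑) : USphere m → EuclideanSpace ℝ (Fin (m + 1))) w

lemma sphereDiff_injective (w : USphere m) : Function.Injective (sphereDiff w) :=
  injective_mvfderiv_subtypeVal_sphere w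

lemma inner_sphereDiff (w : USphere m) (y : EuclideanSpace ℝ (Fin m)) :
    inner ℝ (w : EuclideanSpace ℝ (Fin (m + 1))) (sphereDiff w y) = 0 := by
  have h := range_mvfderiv_subtypeVal (n := m) w
  have h1 : sphereDiff w y ∈ (Submodule.span ℝ {(w : EuclideanSpace ℝ (Fin (m + 1)))})ᗮ := by
    rw [← h]; exact ⟨y, rfl⟩
  exact Submodule.mem_orthogonal_singleton_iff_inner_right.1 h1

lemma exists_sphereDiff_eq (w : USphere m) {y : EuclideanSpace ℝ (Fin (m + 1))}
    (hy : inner ℝ (w : EuclideanSpace ℝ (Fin (m + 1))) y = 0) : ∃ t, sphereDiff w t = y := by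
  have h := range_mvfderiv_subtypeVal (n := m) w
  have h1 : y ∈ (Submodule.span ℝ {(w : EuclideanSpace ℝ (Fin (m + 1)))})ᗮ :=
    Submodule.mem_orthogonal_singleton_iff_inner_right.2 hy
  rw [← h] at h1
  exact h1

/-- The differential of a map `(w, s) ↦ rotPoint (a s) (b s) w`. -/
noncomputable def rotDiff (w : USphere m) (a a' b' : ℝ) :
    EuclideanSpace ℝ (Fin m) × ℝ →L[ℝ] Amb m :=
  (a • (horIncl m).comp (sphereDiff w)).comp (ContinuousLinearMap.fst ℝ _ ℝ) +
    (ContinuousLinearMap.snd ℝ (EuclideanSpace ℝ (Fin m)) ℝ).smulRight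
      (rotPoint a' b' (w : EuclideanSpace ℝ (Fin (m + 1))))

lemma rotDiff_apply (w : USphere m) (a a' b' : ℝ) (y : EuclideanSpace ℝ (Fin m)) (t : ℝ) :
    rotDiff w a a' b' (y, t) = a • horIncl m (sphereDiff w y) + t • rotPoint a' b' w := by
  simp [rotDiff]

lemma hasMFDerivAt_rotPoint {a b : ℝ → ℝ} {a' b' s : ℝ} (ha : HasDerivAt a a' s)
    (hb : HasDerivAt b b' s) (w : USphere m) :
    HasMFDerivAt ((𝓡 m).prod 𝓘(ℝ, ℝ)) 𝓘(ℝ, Amb m)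
      (fun q : USphere m × ℝ =>
        rotPoint (a q.2) (b q.2) (q.1 : EuclideanSpace ℝ (Fin (m + 1)))) (w, s)
      (rotDiff w (a s) a' b') := by
  have h1 : HasMFDerivAt ((𝓡 m).prod 𝓘(ℝ, ℝ)) 𝓘(ℝ, EuclideanSpace ℝ (Fin (m + 1)))
      (fun q : USphere m × ℝ => (q.1 : EuclideanSpace ℝ (Fin (m + 1)))) (w, s)
      ((sphereDiff w).comp (ContinuousLinearMap.fst ℝ (EuclideanSpace ℝ (Fin m)) ℝ)) :=
    HasMFDerivAt.comp (w, s)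
      (((contMDiff_coe_sphere (m := 1)) w).mdifferentiableAt one_ne_zero).hasMFDerivAt
      (hasMFDerivAt_fst (w, s))
  have h2 : HasMFDerivAt ((𝓡 m).prod 𝓘(ℝ, ℝ)) 𝓘(ℝ, ℝ)
      (fun q : USphere m × ℝ => q.2) (w, s)
      (ContinuousLinearMap.snd ℝ (EuclideanSpace ℝ (Fin m)) ℝ) := hasMFDerivAt_snd (w, s)
  have h3 : HasMFDerivAt ((𝓡 m).prod 𝓘(ℝ, ℝ)) 𝓘(ℝ, EuclideanSpace ℝ (Fin (m + 1)) × ℝ)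
      (fun q : USphere m × ℝ => ((q.1 : EuclideanSpace ℝ (Fin (m + 1))), q.2)) (w, s)
      (((sphereDiff w).comp (ContinuousLinearMap.fst ℝ (EuclideanSpace ℝ (Fin m)) ℝ)).prod
        (ContinuousLinearMap.snd ℝ (EuclideanSpace ℝ (Fin m)) ℝ)) :=
    ⟨h1.1.prodMk h2.1, h1.2.prodMk h2.2⟩
  have h4 : HasFDerivAt (fun p : EuclideanSpace ℝ (Fin (m + 1)) × ℝ => rotPoint (a p.2) (b p.2) p.1)
      ((a s • horIncl m).comp (ContinuousLinearMap.fst ℝ _ ℝ) +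
        (ContinuousLinearMap.snd ℝ (EuclideanSpace ℝ (Fin (m + 1))) ℝ).smulRight
          (rotPoint a' b' (w : EuclideanSpace ℝ (Fin (m + 1)))))
      ((w : EuclideanSpace ℝ (Fin (m + 1))), s) := by
    have hs : HasFDerivAt (fun p : EuclideanSpace ℝ (Fin (m + 1)) × ℝ => p.2)
      (ContinuousLinearMap.snd ℝ (EuclideanSpace ℝ (Fin (m + 1))) ℝ) ((w : EuclideanSpace ℝ (Fin (m + 1))), s) := hasFDerivAt_snd
    have hf : HasFDerivAt (fun p : EuclideanSpace ℝ (Fin (m + 1)) × ℝ => horIncl m p.1)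
      ((horIncl m).comp (ContinuousLinearMap.fst ℝ (EuclideanSpace ℝ (Fin (m + 1))) ℝ)) ((w : EuclideanSpace ℝ (Fin (m + 1))), s) :=
      (horIncl m).hasFDerivAt.comp _ hasFDerivAt_fst
    have ha2 := HasDerivAt.comp_hasFDerivAt ((w : EuclideanSpace ℝ (Fin (m + 1))), s) ha hs
    have hb2 := HasDerivAt.comp_hasFDerivAt ((w : EuclideanSpace ℝ (Fin (m + 1))), s) hb hs
    simp only [rotPoint_eq]
    refine ((ha2.fun_smul hf).fun_add (hb2.smul_const (vert m))).congr_fderiv ?_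
    ext p
    all_goals simp [smul_smul, mul_comm]
  have h5 := HasMFDerivAt.comp (w, s) h4.hasMFDerivAt h3
  have e : rotDiff w (a s) a' b' = ((a s • horIncl m).comp (ContinuousLinearMap.fst ℝ _ ℝ) +
        (ContinuousLinearMap.snd ℝ (EuclideanSpace ℝ (Fin (m + 1))) ℝ).smulRight
          (rotPoint a' b' (w : EuclideanSpace ℝ (Fin (m + 1))))).comp
      (((sphereDiff w).comp (ContinuousLinearMap.fst ℝ (EuclideanSpace ℝ (Fin m)) ℝ)).prod
        (ContinuousLinearMap.snd ℝ (EuclideanSpace ℝ (Fin m)) ℝ)) := by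
    rfl
  rw [e]
  exact h5

end Ambient

/-! ### Parametrizations by rotated curves: differential and normal. -/

section Generating

variable {m : ℕ} {M : Type*} [TopologicalSpace M]
  [ChartedSpace (EuclideanSpace ℝ (Fin (m + 1))) M]

/-- The rotation of the curve `(x, z)` over `I`, which does not meet the axis, is carried onto the
hypersurface by `Φ`. -/
structure IsGenerating (f : M → Amb m) (I : Set ℝ) (x z : ℝ → ℝ) (Φ : USphere m × ℝ → M) :
    Prop where
  isOpen : IsOpen I
  ordConnected : I.OrdConnected
  smooth_x : ContDiffOn ℝ ∞ x I
  smooth_z : ContDiffOn ℝ ∞ z I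
  pos : ∀ s ∈ I, 0 < x s
  unit : ∀ s ∈ I, deriv x s ^ 2 + deriv z s ^ 2 = 1
  smooth : ContMDiffOn ((𝓡 m).prod 𝓘(ℝ, ℝ)) (𝓡 (m + 1)) ∞ Φ (univ ×ˢ I)
  onto : ∀ p, ∃ w, ∃ s ∈ I, Φ (w, s) = p
  apply_eq : ∀ (w : USphere m), ∀ s ∈ I, f (Φ (w, s)) = rotPoint (x s) (z s) w

/-- The normal vector of the rotated curve that is obtained by turning the tangent vector of the
curve by a right angle. -/
noncomputable def curveNormal (x z : ℝ → ℝ) (s : ℝ) (w : USphere m) : Amb m :=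
  rotPoint (-deriv z s) (deriv x s) (w : EuclideanSpace ℝ (Fin (m + 1)))

/-- The differential of the parametrization, between the model spaces. -/
noncomputable def genDiff (Φ : USphere m × ℝ → M) (w : USphere m) (s : ℝ) :
    EuclideanSpace ℝ (Fin m) × ℝ →L[ℝ] EuclideanSpace ℝ (Fin (m + 1)) :=
  mfderiv ((𝓡 m).prod 𝓘(ℝ, ℝ)) (𝓡 (m + 1)) Φ (w, s)

lemma hasDerivAt_of_contDiffOn {x : ℝ → ℝ} {I : Set ℝ} (hI : IsOpen I) (hx : ContDiffOn ℝ ∞ x I)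
    {s : ℝ} (hs : s ∈ I) : HasDerivAt x (deriv x s) s :=
  ((hx.differentiableOn (by simp)).differentiableAt (hI.mem_nhds hs)).hasDerivAt

lemma contDiffOn_deriv {x : ℝ → ℝ} {I : Set ℝ} (hI : IsOpen I) (hx : ContDiffOn ℝ ∞ x I) :
    ContDiffOn ℝ ∞ (deriv x) I :=
  ((contDiffOn_infty_iff_deriv_of_isOpen hI).1 hx).2

namespace IsGenerating

variable {f η : M → Amb m} {I : Set ℝ} {x z : ℝ → ℝ} {Φ : USphere m × ℝ → M}

lemma isOpen_dom (g : IsGenerating f I x z Φ) : IsOpen (univ ×ˢ I : Set (USphere m × ℝ)) :=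
  isOpen_univ.prod g.isOpen

lemma contMDiffAt (g : IsGenerating f I x z Φ) (w : USphere m) {s : ℝ} (hs : s ∈ I) :
    ContMDiffAt ((𝓡 m).prod 𝓘(ℝ, ℝ)) (𝓡 (m + 1)) ∞ Φ (w, s) :=
  g.smooth.contMDiffAt (g.isOpen_dom.mem_nhds ⟨trivial, hs⟩)

lemma dx (g : IsGenerating f I x z Φ) {s : ℝ} (hs : s ∈ I) : HasDerivAt x (deriv x s) s :=
  hasDerivAt_of_contDiffOn g.isOpen g.smooth_x hs

lemma dz (g : IsGenerating f I x z Φ) {s : ℝ} (hs : s ∈ I) : HasDerivAt z (deriv z s) s :=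
  hasDerivAt_of_contDiffOn g.isOpen g.smooth_z hs

lemma ddx (g : IsGenerating f I x z Φ) {s : ℝ} (hs : s ∈ I) :
    HasDerivAt (deriv x) (deriv (deriv x) s) s :=
  hasDerivAt_of_contDiffOn g.isOpen (contDiffOn_deriv g.isOpen g.smooth_x) hs

lemma ddz (g : IsGenerating f I x z Φ) {s : ℝ} (hs : s ∈ I) :
    HasDerivAt (deriv z) (deriv (deriv z) s) s :=
  hasDerivAt_of_contDiffOn g.isOpen (contDiffOn_deriv g.isOpen g.smooth_z) hs

/-- The differential of a map that is given by a rotated curve. -/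
lemma diffAt_genDiff (g : IsGenerating f I x z Φ) {h : M → Amb m}
    (hh : ContMDiff (𝓡 (m + 1)) 𝓘(ℝ, Amb m) ∞ h) {a b : ℝ → ℝ} {a' b' s : ℝ} (hs : s ∈ I)
    (ha : HasDerivAt a a' s) (hb : HasDerivAt b b' s)
    (heq : ∀ (w : USphere m), ∀ s ∈ I,
      h (Φ (w, s)) = rotPoint (a s) (b s) (w : EuclideanSpace ℝ (Fin (m + 1))))
    (w : USphere m) (y : EuclideanSpace ℝ (Fin m)) (t : ℝ) :
    diffAt h (Φ (w, s)) (genDiff Φ w s (y, t)) =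
      a s • horIncl m (sphereDiff w y) + t • rotPoint a' b' w := by
  have h1 : HasMFDerivAt (𝓡 (m + 1)) 𝓘(ℝ, Amb m) h (Φ (w, s)) (diffAt h (Φ (w, s))) :=
    ((hh (Φ (w, s))).mdifferentiableAt (by simp)).hasMFDerivAt
  have h2 := ((g.contMDiffAt w hs).mdifferentiableAt (by simp)).hasMFDerivAt
  have h3 := HasMFDerivAt.comp (w, s) h1 h2
  have h4 := (hasMFDerivAt_rotPoint ha hb w).congr_of_eventuallyEq (f₁ := h ∘ Φ) (by
    filter_upwards [g.isOpen_dom.mem_nhds (⟨trivial, hs⟩ : (w, s) ∈ univ ×ˢ I)] with q hq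
    exact heq q.1 q.2 hq.2)
  have h5 := hasMFDerivAt_unique h3 h4
  have h6 := DFunLike.congr_fun h5 (y, t)
  exact h6.trans (rotDiff_apply w (a s) a' b' y t)

lemma diffAt_self (g : IsGenerating f I x z Φ) (hf : IsOrientedImmersion f η) {s : ℝ}
    (hs : s ∈ I) (w : USphere m) (y : EuclideanSpace ℝ (Fin m)) (t : ℝ) :
    diffAt f (Φ (w, s)) (genDiff Φ w s (y, t)) =
      x s • horIncl m (sphereDiff w y) + t • rotPoint (deriv x s) (deriv z s) w :=
  g.diffAt_genDiff hf.smooth hs (g.dx hs) (g.dz hs) g.apply_eq w y t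

/-- After applying `df`, the orbit directions and the unit tangent of the curve become orthogonal,
and `x > 0` keeps the orbit part injective. Equality of dimensions gives surjectivity. -/
lemma genDiff_bijective (g : IsGenerating f I x z Φ) (hf : IsOrientedImmersion f η) {s : ℝ}
    (hs : s ∈ I) (w : USphere m) : Function.Bijective (genDiff Φ w s) := by
  have hinj : Function.Injective (genDiff Φ w s) := by
    rw [injective_iff_map_eq_zero]
    rintro ⟨y, t⟩ h0
    have h1 := g.diffAt_self hf hs w y t
    rw [h0] at h1
    have h1 : x s • horIncl m (sphereDiff w y) + t • rotPoint (deriv x s) (deriv z s) w = 0 :=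
      h1.symm.trans (map_zero (diffAt f (Φ (w, s))))
    have e : horIncl m (sphereDiff w y) = rotPoint 1 0 (sphereDiff w y) := by simp [rotPoint_eq]
    have h2 : t = 0 := by
      have h3 := congrArg (fun q => inner ℝ q
        (rotPoint (deriv x s) (deriv z s) (w : EuclideanSpace ℝ (Fin (m + 1))))) h1
      simp only [e, inner_add_left, inner_smul_left, inner_rotPoint, inner_zero_left,
        real_inner_comm (w : EuclideanSpace ℝ (Fin (m + 1))) (sphereDiff w y),
        inner_sphereDiff, inner_sphere_self] at h3
      have hu := g.unit s hs
      simp only [conj_trivial] at h3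
      nlinarith
    subst h2
    have h4 : sphereDiff w y = 0 := by
      have h5 : horIncl m (sphereDiff w y) = 0 := by
        simpa [(g.pos s hs).ne'] using h1
      have h6 := inner_horIncl (sphereDiff w y) (sphereDiff w y)
      rw [h5, inner_zero_left] at h6
      exact inner_self_eq_zero.1 h6.symm
    have h7 : y = 0 := sphereDiff_injective w (h4.trans (map_zero _).symm)
    rw [h7]; rfl
  refine ⟨hinj, ?_⟩
  have hfin : Module.finrank ℝ (EuclideanSpace ℝ (Fin m) × ℝ) =
      Module.finrank ℝ (EuclideanSpace ℝ (Fin (m + 1))) := by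
    simp
  exact (LinearMap.injective_iff_surjective_of_finrank_eq_finrank hfin
    (f := (genDiff Φ w s : EuclideanSpace ℝ (Fin m) × ℝ →ₗ[ℝ] _))).1 hinj

/-- The unit normal is determined up to sign. -/
lemma normal_eq_smul (g : IsGenerating f I x z Φ) (hf : IsOrientedImmersion f η) {s : ℝ}
    (hs : s ∈ I) (w : USphere m) :
    η (Φ (w, s)) = inner ℝ (η (Φ (w, s))) (curveNormal x z s w) • curveNormal x z s w ∧
      inner ℝ (η (Φ (w, s))) (curveNormal x z s w) ^ 2 = 1 := by
  set q := η (Φ (w, s)) with hq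
  set w' : EuclideanSpace ℝ (Fin (m + 1)) := (w : EuclideanSpace ℝ (Fin (m + 1))) with hw'
  have hww : inner ℝ w' w' = 1 := inner_sphere_self w
  have hdec := eq_horIncl_add_vert q
  set a := hor q with ha
  set b := height q with hb
  have hx := g.pos s hs
  have horth : ∀ y, inner ℝ (sphereDiff w y) a = 0 := by
    intro y
    have h1 := hf.normal (Φ (w, s)) (genDiff Φ w s (y, 0))
    rw [g.diffAt_self hf hs, zero_smul, add_zero, ← hq, hdec, inner_smul_left, inner_add_right,
      inner_horIncl, inner_smul_right, inner_horIncl_vert] at h1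
    simpa [hx.ne'] using h1
  set c := inner ℝ w' a with hc
  -- The horizontal part of the normal is orthogonal to the tangent space of the sphere, hence
  -- radial; orthogonality to the curve then leaves two unit vectors.
  have hac : a = c • w' := by
    have h1 : inner ℝ w' (a - c • w') = 0 := by
      rw [inner_sub_right, inner_smul_right, hww, ← hc]; ring
    obtain ⟨y, hy⟩ := exists_sphereDiff_eq w h1
    have h2 := horth y
    rw [hy] at h2
    have h3 : inner ℝ (a - c • w') (a - c • w') = 0 := by
      rw [inner_sub_right, h2, inner_smul_right, real_inner_comm, h1]; ring
    exact sub_eq_zero.1 (inner_self_eq_zero.1 h3)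
  have hqr : q = rotPoint c b w' := by
    rw [hdec, hac, rotPoint_eq, map_smul]
  have hcb : c ^ 2 + b ^ 2 = 1 := by
    have h1 : inner ℝ q q = 1 := by
      rw [real_inner_self_eq_norm_sq, hq, hf.unit, one_pow]
    rw [hqr, inner_rotPoint, hww] at h1
    linarith
  have htan : deriv x s * c + deriv z s * b = 0 := by
    have h1 := hf.normal (Φ (w, s)) (genDiff Φ w s (0, 1))
    rw [g.diffAt_self hf hs, map_zero, map_zero, smul_zero, zero_add, one_smul, ← hq, hqr,
      inner_rotPoint] at h1
    rw [hww] at h1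
    linarith
  have hu := g.unit s hs
  have hsg : inner ℝ q (curveNormal x z s w) = -(deriv z s * c) + deriv x s * b := by
    rw [curveNormal, hqr, inner_rotPoint, hww]; ring
  rw [hsg]
  constructor
  · have e : ∀ (k a b : ℝ), k • rotPoint a b w' = rotPoint (k * a) (k * b) w' := by
      intro k a b; simp [rotPoint_eq, smul_smul]
    rw [curveNormal, e, hqr]
    congr 1
    · linear_combination (-c) * hu + deriv x s * htan
    · linear_combination (-b) * hu + deriv z s * htan
  · linear_combination hcb * (deriv x s ^ 2 + deriv z s ^ 2) + hu -
      (deriv x s * c + deriv z s * b) * htan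

end IsGenerating

end Generating

/-! ### Choice of side and orientation; the profile equation; injectivity. -/

section Normalization

variable {m : ℕ} {M : Type*} [TopologicalSpace M]
  [ChartedSpace (EuclideanSpace ℝ (Fin (m + 1))) M]
  {f η : M → Amb m} {I : Set ℝ} {x z : ℝ → ℝ} {Φ : USphere m × ℝ → M}

lemma isPreconnected_univ_usphere (hm : 1 ≤ m) : IsPreconnected (univ : Set (USphere m)) := by
  have h : 1 < Module.rank ℝ (EuclideanSpace ℝ (Fin (m + 1))) := by
    rw [← Module.finrank_eq_rank]
    simp only [finrank_euclideanSpace, Fintype.card_fin]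
    exact_mod_cast (by omega : 1 < m + 1)
  have := isPreconnected_iff_preconnectedSpace.1
    (isPreconnected_sphere h (0 : EuclideanSpace ℝ (Fin (m + 1))) 1)
  exact isPreconnected_univ

instance nonempty_usphere : Nonempty (USphere m) :=
  ⟨⟨EuclideanSpace.single 0 1, by simp⟩⟩

/-- A rotational hypersurface that does not meet the axis is generated by a curve on the positive
side of the axis. -/
lemma IsRotational.exists_isGenerating (hrot : IsRotational f) (haxis : ∀ p, hor (f p) ≠ 0) :
    ∃ I x z Φ, IsGenerating f I x z Φ := by
  obtain ⟨I, x, z, Φ, hI, hord, hx, hz, hu, hΦ, honto, hf⟩ := hrot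
  have hne : ∀ s ∈ I, x s ≠ 0 := by
    intro s hs h0
    obtain ⟨w⟩ := (inferInstance : Nonempty (USphere m))
    apply haxis (Φ (w, s))
    rw [hf w s hs, hor_rotPoint, h0, zero_smul]
  have honto' : ∀ p, ∃ w, ∃ s ∈ I, Φ (w, s) = p := by
    intro p
    have hp : p ∈ Φ '' (univ ×ˢ I) := by rw [honto]; trivial
    obtain ⟨⟨w, s⟩, hq, rfl⟩ := hp
    exact ⟨w, s, hq.2, rfl⟩
  have hsign : (∀ s ∈ I, 0 < x s) ∨ ∀ s ∈ I, x s < 0 := by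
    by_contra! hcon
    obtain ⟨⟨s, hs, hs0⟩, t, ht, ht0⟩ := hcon
    obtain ⟨r, hr, hr0⟩ := hord.isPreconnected.intermediate_value hs ht hx.continuousOn
      ⟨hs0, ht0⟩
    exact hne r hr hr0
  rcases hsign with hpos | hneg
  · exact ⟨I, x, z, Φ, hI, hord, hx, hz, hpos, hu, hΦ, honto', hf⟩
  -- A curve on the negative side becomes positive by composing with the antipodal map of the
  -- sphere.
  · refine ⟨I, fun s => -x s, z, fun q => Φ (-q.1, q.2), hI, hord, hx.neg, hz,
      fun s hs => by linarith [hneg s hs], fun s hs => ?_, ?_, fun p => ?_, fun w s hs => ?_⟩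
    · rw [deriv.fun_neg, neg_sq, hu s hs]
    · refine hΦ.comp (t := univ ×ˢ I) ?_ fun q hq => ⟨trivial, hq.2⟩
      exact ((contMDiff_neg_sphere.comp contMDiff_fst).prodMk contMDiff_snd).contMDiffOn
    · obtain ⟨w, s, hs, hp⟩ := honto' p
      exact ⟨-w, s, hs, by simpa using hp⟩
    · rw [hf (-w) s hs]
      exact rotPoint_neg _ _ _

/-- Reversal of the parameter. -/
lemma IsGenerating.reverse (g : IsGenerating f I x z Φ) :
    IsGenerating f (Neg.neg ⁻¹' I) (fun s => x (-s)) (fun s => z (-s))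
      (fun q => Φ (q.1, -q.2)) where
  isOpen := g.isOpen.preimage continuous_neg
  ordConnected := ⟨fun s hs t ht r hr =>
    g.ordConnected.out ht hs ⟨neg_le_neg hr.2, neg_le_neg hr.1⟩⟩
  smooth_x := g.smooth_x.comp contDiff_neg.contDiffOn fun _ hs => hs
  smooth_z := g.smooth_z.comp contDiff_neg.contDiffOn fun _ hs => hs
  pos s hs := g.pos _ hs
  unit s hs := by
    rw [deriv_comp_neg, deriv_comp_neg, neg_sq, neg_sq]
    exact g.unit _ hs
  smooth := by
    refine g.smooth.comp (t := univ ×ˢ I) ?_ fun q hq => ⟨trivial, hq.2⟩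
    exact (contMDiff_fst.prodMk
      ((contDiff_neg (𝕜 := ℝ)).contMDiff.comp contMDiff_snd)).contMDiffOn
  onto p := by
    obtain ⟨w, s, hs, hp⟩ := g.onto p
    exact ⟨w, -s, by simpa using hs, by simpa using hp⟩
  apply_eq w s hs := g.apply_eq w _ hs

lemma curveNormal_reverse (x z : ℝ → ℝ) (s : ℝ) (w : USphere m) :
    curveNormal (fun s => x (-s)) (fun s => z (-s)) s w = -curveNormal x z (-s) w := by
  rw [curveNormal, curveNormal, deriv_comp_neg, deriv_comp_neg, rotPoint_eq, rotPoint_eq]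
  simp
  abel

lemma IsGenerating.continuousOn_curveNormal (g : IsGenerating f I x z Φ) :
    ContinuousOn (fun q : USphere m × ℝ => curveNormal x z q.2 q.1) (univ ×ˢ I) := by
  have hsnd : MapsTo (fun q : USphere m × ℝ => q.2) (univ ×ˢ I) I := fun q hq => hq.2
  have hx := (contDiffOn_deriv g.isOpen g.smooth_x).continuousOn.comp continuousOn_snd hsnd
  have hz := (contDiffOn_deriv g.isOpen g.smooth_z).continuousOn.comp continuousOn_snd hsnd
  simp only [curveNormal, rotPoint_eq]
  refine (hz.neg.smul ?_).add (hx.smul continuousOn_const)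
  exact ((horIncl m).continuous.comp (continuous_subtype_val.comp continuous_fst)).continuousOn

/-- Up to reversal of the parameter, the unit normal is the normal of the curve. -/
lemma IsGenerating.exists_normal_eq (g : IsGenerating f I x z Φ) (hm : 1 ≤ m)
    (hf : IsOrientedImmersion f η) :
    ∃ I x z Φ, IsGenerating f I x z Φ ∧
      ∀ (w : USphere m), ∀ s ∈ I, η (Φ (w, s)) = curveNormal x z s w := by
  have hcon : ContinuousOn (fun q : USphere m × ℝ =>
      inner ℝ (η (Φ q)) (curveNormal x z q.2 q.1)) (univ ×ˢ I) :=
    (hf.smooth_normal.continuous.comp_continuousOn g.smooth.continuousOn).inner (𝕜 := ℝ)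
      g.continuousOn_curveNormal
  have hpre : IsPreconnected (univ ×ˢ I : Set (USphere m × ℝ)) :=
    (isPreconnected_univ_usphere hm).prod g.ordConnected.isPreconnected
  have hsq : EqOn ((fun q : USphere m × ℝ =>
      inner ℝ (η (Φ q)) (curveNormal x z q.2 q.1)) ^ 2) 1 (univ ×ˢ I) := by
    rintro ⟨w, s⟩ hq
    exact (g.normal_eq_smul hf hq.2 w).2
  rcases hpre.eq_one_or_eq_neg_one_of_sq_eq hcon hsq with h | h
  · refine ⟨I, x, z, Φ, g, fun w s hs => ?_⟩
    have h1 : inner ℝ (η (Φ (w, s))) (curveNormal x z s w) = 1 :=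
      h (⟨trivial, hs⟩ : (w, s) ∈ univ ×ˢ I)
    have h2 := (g.normal_eq_smul hf hs w).1
    rwa [h1, one_smul] at h2
  · refine ⟨_, _, _, _, g.reverse, fun w s hs => ?_⟩
    have h1 : inner ℝ (η (Φ (w, -s))) (curveNormal x z (-s) w) = -1 :=
      h (⟨trivial, hs⟩ : (w, -s) ∈ univ ×ˢ I)
    have h2 := (g.normal_eq_smul hf hs w).1
    rw [h1, neg_one_smul] at h2
    rw [curveNormal_reverse]
    exact h2

/-- Frenet equations: the acceleration of a unit-speed plane curve is normal to it. -/
lemma curvature_identities {u v u' v' : ℝ} (h1 : u ^ 2 + v ^ 2 = 1) (h2 : u * u' + v * v' = 0) :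
    u' = -v * (u * v' - u' * v) ∧ v' = u * (u * v' - u' * v) := by
  constructor
  · linear_combination (-u') * h1 + u * h2
  · linear_combination (-v') * h1 + v * h2

/-- The profile curve of an `H_lam`-hypersurface. -/
lemma IsGenerating.isProfileOn (g : IsGenerating f I x z Φ) {lam : ℝ} (hH : IsHHypersurface lam f η)
    (hη : ∀ (w : USphere m), ∀ s ∈ I, η (Φ (w, s)) = curveNormal x z s w) :
    IsProfileOn m lam x (deriv x) (deriv z) z I := by
  have key : ∀ s ∈ I, deriv (deriv x) s = -(deriv z s) * curv m lam (x s) (deriv x s) (deriv z s) ∧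
      deriv (deriv z) s = deriv x s * curv m lam (x s) (deriv x s) (deriv z s) := by
    intro s hs
    obtain ⟨w⟩ := (inferInstance : Nonempty (USphere m))
    have hu := g.unit s hs
    have hx := g.pos s hs
    have horth : deriv x s * deriv (deriv x) s + deriv z s * deriv (deriv z) s = 0 := by
      have h1 := ((g.ddx hs).fun_pow 2).fun_add ((g.ddz hs).fun_pow 2)
      have h2 : HasDerivAt (fun s => deriv x s ^ 2 + deriv z s ^ 2) 0 s :=
        (hasDerivAt_const s (1 : ℝ)).congr_of_eventuallyEq (by
          filter_upwards [g.isOpen.mem_nhds hs] with t ht using g.unit t ht)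
      have h3 := h1.unique h2
      norm_num at h3
      linarith
    obtain ⟨hxx, hzz⟩ := curvature_identities hu horth
    set κ := deriv x s * deriv (deriv z) s - deriv (deriv x) s * deriv z s with hκ
    obtain ⟨S, hS, htr⟩ := hH.meanCurvature (Φ (w, s))
    -- The shape operator is diagonal in the splitting, with eigenvalues `z' / x` on the orbits and
    -- the curvature `κ` along the curve; injectivity of `df` transfers this from the ambient
    -- identity.
    have hSA : ∀ (y : EuclideanSpace ℝ (Fin m)) (t : ℝ), S (genDiff Φ w s (y, t)) =
        genDiff Φ w s ((deriv z s / x s) • y, κ * t) := by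
      intro y t
      apply hH.immersion (Φ (w, s))
      refine (hS _).trans ?_
      rw [g.diffAt_genDiff hH.smooth_normal (a := fun s => -deriv z s) (b := deriv x)
        (a' := -deriv (deriv z) s) (b' := deriv (deriv x) s) hs (g.ddz hs).fun_neg (g.ddx hs) hη,
        g.diffAt_self hH.toIsOrientedImmersion hs, hxx, hzz]
      simp only [rotPoint_eq, map_smul, smul_add, smul_smul, neg_add, neg_smul, smul_neg]
      have : x s * (deriv z s / x s) = deriv z s := by field_simp
      rw [this, neg_neg]
      congr 1
      module
    have h1 := trace_eq_of_splitting
      (genDiff Φ w s : EuclideanSpace ℝ (Fin m) × ℝ →ₗ[ℝ] EuclideanSpace ℝ (Fin (m + 1)))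
      (g.genDiff_bijective hH.toIsOrientedImmersion hs w) S hSA
    have h2 : LinearMap.trace ℝ (EuclideanSpace ℝ (Fin (m + 1))) S =
      m * (deriv z s / x s) + κ := by simpa using h1
    have h3 : inner ℝ (η (Φ (w, s))) (vert m) = deriv x s := by
      rw [hη w s hs, curveNormal, rotPoint_eq, inner_add_left, inner_smul_left, inner_smul_left,
        inner_horIncl_vert, inner_vert_vert]
      simp
    have h4 : inner ℝ (η (Φ (w, s))) (vert m) + lam =
      LinearMap.trace ℝ (EuclideanSpace ℝ (Fin (m + 1))) S / ((m : ℝ) + 1) := htr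
    rw [h2, h3] at h4
    have hm0 : (0 : ℝ) < (m : ℝ) + 1 := by positivity
    have h5 : κ = curv m lam (x s) (deriv x s) (deriv z s) := by
      rw [curv, h4]; field_simp; ring
    rw [← h5]
    exact ⟨hxx, hzz⟩
  refine ⟨g.pos, g.unit, fun s hs => g.dx hs, fun s hs => g.dz hs, fun s hs => ?_, fun s hs => ?_⟩
  · rw [← (key s hs).1]; exact g.ddx hs
  · rw [← (key s hs).2]; exact g.ddz hs

/-- The parametrization is injective. -/
lemma IsGenerating.injOn (g : IsGenerating f I x z Φ) {lam : ℝ} (hm : 1 ≤ m) (hlam : 0 < lam)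
    (hη : ∀ (w : USphere m), ∀ s ∈ I, η (Φ (w, s)) = curveNormal x z s w)
    (hp : IsProfileOn m lam x (deriv x) (deriv z) z I) : InjOn Φ (univ ×ˢ I) := by
  rintro ⟨w, s⟩ ⟨-, hs⟩ ⟨w', t⟩ ⟨-, ht⟩ h
  have h1 := congrArg f h
  rw [g.apply_eq w s hs, g.apply_eq w' t ht] at h1
  obtain ⟨hx, hz, rfl⟩ := rotPoint_inj (g.pos s hs) (g.pos t ht) h1
  -- Equality in `M`, not only of the images, identifies the normals too. The curve therefore
  -- returns with the same `x`, `z` and `v`, which the flux forbids.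
  have h2 := congrArg η h
  rw [hη w s hs, hη w t ht] at h2
  have h3 : deriv z s = deriv z t := by
    have h4 := congrArg (fun q => inner ℝ q (rotPoint 1 0 (w : EuclideanSpace ℝ (Fin (m + 1))))) h2
    simp only [curveNormal, inner_rotPoint, inner_sphere_self] at h4
    linarith
  have hst : s = t := by
    rcases lt_trichotomy s t with hlt | heq | hgt
    · exact (hp.not_closed hm hlam g.ordConnected hs ht hlt hx h3 hz).elim
    · exact heq
    · exact (hp.not_closed hm hlam g.ordConnected ht hs hgt hx.symm h3.symm hz.symm).elim
  rw [hst]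

end Normalization

/-! ### Completeness and the global diffeomorphism. -/

section Completeness

variable {m : ℕ} {M : Type*} [TopologicalSpace M]
  [ChartedSpace (EuclideanSpace ℝ (Fin (m + 1))) M]
  {f η : M → Amb m} {I : Set ℝ} {x z : ℝ → ℝ} {Φ : USphere m × ℝ → M}

lemma norm_rotPoint_sphere (a b : ℝ) (w : USphere m) :
    ‖rotPoint a b (w : EuclideanSpace ℝ (Fin (m + 1)))‖ = √(a ^ 2 + b ^ 2) := by
  rw [norm_eq_sqrt_real_inner, inner_rotPoint, inner_sphere_self]
  congr 1; ring

lemma hasDerivAt_rotPoint {a b : ℝ → ℝ} {a' b' s : ℝ} (ha : HasDerivAt a a' s)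
    (hb : HasDerivAt b b' s) (w : EuclideanSpace ℝ (Fin (m + 1))) :
    HasDerivAt (fun s => rotPoint (a s) (b s) w) (rotPoint a' b' w) s := by
  simp only [rotPoint_eq]
  exact (ha.smul_const _).fun_add (hb.smul_const _)

/-- The length of a piece of a generating curve. -/
lemma IsGenerating.intrinsicEDist_le (g : IsGenerating f I x z Φ) (w : USphere m) {s t : ℝ}
    (hs : s ∈ I) (ht : t ∈ I) : intrinsicEDist f (Φ (w, s)) (Φ (w, t)) ≤ edist s t := by
  have hmem : ∀ τ ∈ Icc (0 : ℝ) 1, s + τ * (t - s) ∈ I := by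
    intro τ hτ
    have h1 := g.ordConnected.convex.add_smul_sub_mem hs ht hτ
    simpa using h1
  unfold intrinsicEDist
  refine iInf_le_of_le (fun τ : ℝ => Φ (w, s + τ * (t - s))) ?_
  refine iInf_le_of_le ?_ (iInf_le_of_le (by simp) (iInf_le_of_le (by simp) ?_))
  · refine (g.smooth.of_le (by simp)).comp (t := univ ×ˢ I) ?_ fun τ hτ => ⟨trivial, hmem τ hτ⟩
    have h1 : ContDiff ℝ 1 fun τ : ℝ => s + τ * (t - s) := by fun_prop
    exact (contMDiff_const.prodMk h1.contMDiff).contMDiffOn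
  · have hder : ∀ τ ∈ Icc (0 : ℝ) 1,
        ‖deriv (fun τ => f (Φ (w, s + τ * (t - s)))) τ‖ₑ = edist s t := by
      intro τ hτ
      have hI := hmem τ hτ
      have hl : HasDerivAt (fun τ : ℝ => s + τ * (t - s)) (t - s) τ := by
        simpa using ((hasDerivAt_id τ).mul_const (t - s)).const_add s
      have hx := (g.dx hI).comp τ hl
      have hz := (g.dz hI).comp τ hl
      have hd := (hasDerivAt_rotPoint hx hz (w : EuclideanSpace ℝ (Fin (m + 1))))
      have hd' := hd.congr_of_eventuallyEq (f₁ := fun τ => f (Φ (w, s + τ * (t - s)))) (by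
        filter_upwards [hl.continuousAt.eventually_mem (g.isOpen.mem_nhds hI)] with r hr
        exact g.apply_eq w _ hr)
      rw [hd'.deriv, ← ofReal_norm, norm_rotPoint_sphere, mul_pow, mul_pow, ← add_mul,
        g.unit _ hI, one_mul, Real.sqrt_sq_eq_abs, edist_comm, edist_dist, Real.dist_eq]
    rw [setLIntegral_congr_fun measurableSet_Icc hder]
    simp

/-- The inverse function theorem gives a local right inverse; global injectivity of `Φ` makes it
recover every preimage, including those not known to be near `(w, s)`. -/
lemma IsGenerating.exists_local_inverse (g : IsGenerating f I x z Φ)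
    (hf : IsOrientedImmersion f η) (hinj : InjOn Φ (univ ×ˢ I)) (w : USphere m) {s : ℝ}
    (hs : s ∈ I) :
    ∃ l : M → USphere m × ℝ, ContMDiffAt (𝓡 (m + 1)) ((𝓡 m).prod 𝓘(ℝ, ℝ)) ∞ l (Φ (w, s)) ∧
      l (Φ (w, s)) = (w, s) ∧
      ∀ᶠ p in 𝓝 (Φ (w, s)), ∀ q ∈ univ ×ˢ I, Φ q = p → l p = q := by
  obtain ⟨l, hl, hlq, hright⟩ := RotHyp.exists_local_inverse (g.contMDiffAt w hs)
    (g.genDiff_bijective hf hs w)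
  refine ⟨l, hl, hlq, ?_⟩
  have h1 : ∀ᶠ p in 𝓝 (Φ (w, s)), l p ∈ univ ×ˢ I := by
    refine hl.continuousAt.eventually_mem ?_
    rw [hlq]
    exact g.isOpen_dom.mem_nhds ⟨trivial, hs⟩
  filter_upwards [h1, hright] with p hp1 hp2 q hq hqp
  exact hinj hp1 hq (hp2.trans hqp.symm)

/-- A complete hypersurface is generated by a curve over the whole real line. -/
lemma IsGenerating.eq_univ (g : IsGenerating f I x z Φ) (hf : IsOrientedImmersion f η)
    (hinj : InjOn Φ (univ ×ˢ I)) (hcomplete : IsCompleteImmersion f) [Nonempty M] :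
    I = univ := by
  obtain ⟨p₀⟩ := (inferInstance : Nonempty M)
  obtain ⟨w, s₀, hs₀, -⟩ := g.onto p₀
  refine IsClopen.eq_univ ⟨?_, g.isOpen⟩ ⟨s₀, hs₀⟩
  -- A parameter sequence in `I` converging to `b` gives a Cauchy sequence along one meridian. Its
  -- limit lies over some `s₁ ∈ I`, and continuity of the local inverse forces `b = s₁`.
  refine IsSeqClosed.isClosed fun u b hu hub => ?_
  obtain ⟨p, hp⟩ := hcomplete (fun k => Φ (w, u k)) (by
    intro ε hε
    obtain ⟨N, hN⟩ := EMetric.cauchySeq_iff.1 hub.cauchySeq ε hε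
    exact ⟨N, fun j hj k hk => (g.intrinsicEDist_le w (hu j) (hu k)).trans_lt (hN j hj k hk)⟩)
  obtain ⟨w₁, s₁, hs₁, rfl⟩ := g.onto p
  obtain ⟨l, hl, hlq, hleft⟩ := g.exists_local_inverse hf hinj w₁ hs₁
  have h1 := hl.continuousAt.tendsto.comp hp
  rw [hlq] at h1
  have h2 : Tendsto (fun k => (w, u k)) atTop (𝓝 (w₁, s₁)) := by
    refine h1.congr' ?_
    filter_upwards [hp.eventually hleft] with k hk
    exact hk (w, u k) ⟨trivial, hu k⟩ rfl
  have h3 : Tendsto u atTop (𝓝 s₁) := (continuous_snd.tendsto _).comp h2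
  rw [tendsto_nhds_unique hub h3]
  exact hs₁

/-- The parametrization is a diffeomorphism. -/
lemma IsGenerating.exists_diffeomorph (g : IsGenerating f univ x z Φ)
    (hf : IsOrientedImmersion f η) (hinj : InjOn Φ (univ ×ˢ univ)) :
    ∃ Ψ : Diffeomorph ((𝓡 m).prod 𝓘(ℝ, ℝ)) (𝓡 (m + 1)) (USphere m × ℝ) M ∞, ⇑Ψ = Φ := by
  have hbij : Function.Bijective Φ := by
    refine ⟨fun q q' h => hinj ⟨trivial, trivial⟩ ⟨trivial, trivial⟩ h, fun p => ?_⟩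
    obtain ⟨w, s, -, h⟩ := g.onto p
    exact ⟨_, h⟩
  refine ⟨⟨Equiv.ofBijective Φ hbij, fun q => g.contMDiffAt q.1 trivial, fun p => ?_⟩, rfl⟩
  obtain ⟨w, s, hs, rfl⟩ := g.onto p
  obtain ⟨l, hl, -, hleft⟩ := g.exists_local_inverse hf hinj w hs
  refine hl.congr_of_eventuallyEq ?_
  filter_upwards [hleft] with p hp
  exact (hp _ ⟨trivial, trivial⟩ ((Equiv.ofBijective Φ hbij).apply_symm_apply p)).symm

/-- The hypersurface in polar form. -/
theorem exists_profile (hm : 1 ≤ m) {lam : ℝ} (hlam : 0 < lam) [Nonempty M]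
    (hH : IsHHypersurface lam f η) (hrot : IsRotational f) (hcomplete : IsCompleteImmersion f)
    (haxis : ∀ p, hor (f p) ≠ 0) :
    ∃ (Ψ : Diffeomorph ((𝓡 m).prod 𝓘(ℝ, ℝ)) (𝓡 (m + 1)) (USphere m × ℝ) M ∞) (x z : ℝ → ℝ),
      IsGenerating f univ x z Ψ ∧ IsProfileOn m lam x (deriv x) (deriv z) z univ ∧
      ∀ (w : USphere m) (s : ℝ), η (Ψ (w, s)) = curveNormal x z s w := by
  obtain ⟨I₀, x₀, z₀, Φ₀, g₀⟩ := hrot.exists_isGenerating haxis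
  obtain ⟨I, x, z, Φ, g, hη⟩ := g₀.exists_normal_eq hm hH.toIsOrientedImmersion
  have hp := g.isProfileOn hH hη
  have hinj := g.injOn hm hlam hη hp
  obtain rfl := g.eq_univ hH.toIsOrientedImmersion hinj hcomplete
  obtain ⟨Ψ, rfl⟩ := g.exists_diffeomorph hH.toIsOrientedImmersion hinj
  exact ⟨Ψ, x, z, g, hp, fun w s => hη w s trivial⟩

end Completeness

/-! ### Geometry of the ends. -/

section Ends

variable {m : ℕ} {M : Type*} [TopologicalSpace M]
  [ChartedSpace (EuclideanSpace ℝ (Fin (m + 1))) M]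
  {f η : M → Amb m} {x z : ℝ → ℝ} {lam : ℝ}
  {Ψ : Diffeomorph ((𝓡 m).prod 𝓘(ℝ, ℝ)) (𝓡 (m + 1)) (USphere m × ℝ) M ∞}

/-- The dichotomy is whether the flux at time `0` is maximal. -/
lemma IsProfileOn.eq_cylinder_or_tendsto_x_atBot {u v : ℝ → ℝ}
    (h : IsProfileOn m lam x u v z univ) (hm : 1 ≤ m) (hlam : 0 < lam) :
    (∀ s, x s = radius m lam ∧ z s = z 0 + s) ∨ Tendsto x atBot atTop := by
  rcases (h.flux_le_max hm hlam 0).lt_or_eq with hlt | heq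
  · exact Or.inr (h.tendsto_x_atBot hm hlam hlt)
  · refine Or.inl fun s => ⟨(h.eq_radius_of_flux_eq hm hlam heq s).1, ?_⟩
    have hd : ∀ s, HasDerivAt (fun s => z s - s) 0 s := fun s =>
      ((h.dz s trivial).fun_sub (hasDerivAt_id s)).congr_deriv (by
        rw [(h.eq_radius_of_flux_eq hm hlam heq s).2, sub_self])
    have h1 := is_const_of_deriv_eq_zero (fun s => (hd s).differentiableAt)
      (fun s => (hd s).deriv) s 0
    linarith

namespace IsGenerating

lemma norm_hor_apply (g : IsGenerating f univ x z Ψ) (w : USphere m) (s : ℝ) :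
    ‖hor (f (Ψ (w, s)))‖ = x s := by
  rw [g.apply_eq w s trivial, norm_hor_rotPoint (g.pos s trivial)]

lemma height_apply (g : IsGenerating f univ x z Ψ) (w : USphere m) (s : ℝ) :
    height (f (Ψ (w, s))) = z s := by
  rw [g.apply_eq w s trivial, height_rotPoint]

lemma apply_eq_apply_iff (g : IsGenerating f univ x z Ψ) {w w' : USphere m} {s t : ℝ} :
    f (Ψ (w, s)) = f (Ψ (w', t)) ↔ x s = x t ∧ z s = z t ∧ w = w' := by
  rw [g.apply_eq w s trivial, g.apply_eq w' t trivial]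
  refine ⟨rotPoint_inj (g.pos s trivial) (g.pos t trivial), ?_⟩
  rintro ⟨h1, h2, h3⟩
  rw [h1, h2, h3]

/-- If the profile curve is a vertical line, the hypersurface is a cylinder. -/
lemma range_eq_cylinder (g : IsGenerating f univ x z Ψ) {r c : ℝ} (hr : 0 < r)
    (h : ∀ s, x s = r ∧ z s = c + s) : range f = cylinder m r := by
  ext q
  constructor
  · rintro ⟨p, rfl⟩
    obtain ⟨w, s, -, rfl⟩ := g.onto p
    exact (g.norm_hor_apply w s).trans (h s).1
  · intro (hq : ‖hor q‖ = r)
    have hw : ‖r⁻¹ • hor q‖ = 1 := by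
      rw [norm_smul, hq, norm_inv, Real.norm_of_nonneg hr.le, inv_mul_cancel₀ hr.ne']
    refine ⟨Ψ (⟨r⁻¹ • hor q, by simpa using hw⟩, height q - c), ?_⟩
    rw [g.apply_eq _ _ trivial]
    refine amb_ext ?_ ?_
    · rw [hor_rotPoint, (h _).1, smul_smul, mul_inv_cancel₀ hr.ne', one_smul]
    · rw [height_rotPoint, (h _).2]; ring

/-- The hypersurface is proper if its profile curve is. -/
lemma isProperMap (g : IsGenerating f univ x z Ψ) (hf : Continuous f)
    (htop : Tendsto z atTop atTop)
    (hbot : Tendsto z atBot atBot ∨ Tendsto x atBot atTop) : IsProperMap f := by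
  refine isProperMap_iff_isCompact_preimage.2 ⟨hf, fun K hK => ?_⟩
  obtain ⟨B, hB⟩ := hK.exists_bound_of_continuousOn continuous_hor.continuousOn
  obtain ⟨C, hC⟩ := hK.exists_bound_of_continuousOn continuous_height.continuousOn
  obtain ⟨b, hb⟩ := eventually_atTop.1 (htop.eventually_gt_atTop C)
  obtain ⟨a, ha⟩ : ∃ a, ∀ s ≤ a, B < x s ∨ z s < -C := by
    rcases hbot with h | h
    · obtain ⟨a, ha⟩ := eventually_atBot.1 (h.eventually_lt_atBot (-C))
      exact ⟨a, fun s hs => Or.inr (ha s hs)⟩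
    · obtain ⟨a, ha⟩ := eventually_atBot.1 (h.eventually_gt_atTop B)
      exact ⟨a, fun s hs => Or.inl (ha s hs)⟩
  have hcomp : IsCompact (Ψ '' (univ ×ˢ Icc a b)) :=
    (isCompact_univ.prod isCompact_Icc).image Ψ.continuous
  refine hcomp.of_isClosed_subset (hK.isClosed.preimage hf) fun p hp => ?_
  obtain ⟨w, s, -, rfl⟩ := g.onto p
  refine ⟨(w, s), ⟨trivial, ?_⟩, rfl⟩
  have h1 := hB _ hp
  have h2 := hC _ hp
  rw [g.norm_hor_apply] at h1
  rw [g.height_apply, Real.norm_eq_abs, abs_le] at h2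
  constructor
  · by_contra! hs
    rcases ha s hs.le with h | h <;> linarith
  · by_contra! hs
    linarith [hb s hs.le]

lemma unboundedDistance (g : IsGenerating f univ x z Ψ) (hlim : Tendsto x atBot atTop) (a : ℝ) :
    UnboundedDistance f (Ψ '' {q | q.2 < a}) := by
  rintro ⟨B, hB⟩
  obtain ⟨w⟩ := (inferInstance : Nonempty (USphere m))
  obtain ⟨s, hs, hsa⟩ := ((hlim.eventually_gt_atTop B).and (eventually_lt_atBot a)).exists
  have h1 : ‖hor (f (Ψ (w, s)))‖ ≤ B := hB ⟨_, ⟨(w, s), hsa, rfl⟩, rfl⟩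
  rw [g.norm_hor_apply] at h1
  linarith

/-- Finitely many orbits would have bounded distance to the axis. -/
lemma infinitelyManySelfIntersections (g : IsGenerating f univ x z Ψ) {a : ℝ}
    (h : ∀ Y, ∃ s t, s < t ∧ t < a ∧ x s = x t ∧ z s = z t ∧ Y < x s) :
    InfinitelyManySelfIntersections f (Ψ '' {q | q.2 < a}) := by
  intro hfin
  obtain ⟨Y, hY⟩ := (hfin.image Prod.fst).bddAbove
  obtain ⟨w⟩ := (inferInstance : Nonempty (USphere m))
  obtain ⟨s, t, hst, hta, hx, hz, hYs⟩ := h Y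
  refine hYs.not_ge (hY ⟨(x s, z s), ⟨Ψ (w, s), ⟨(w, s), hst.trans hta, rfl⟩, Ψ (w, t),
    ⟨(w, t), hta, rfl⟩, fun he => hst.ne (congrArg Prod.snd (Ψ.injective he)),
    g.apply_eq_apply_iff.2 ⟨hx, hz, rfl⟩, ?_⟩, rfl⟩)
  rw [g.norm_hor_apply, g.height_apply]

/-- The radius is a strictly decreasing coordinate on the end, with smooth inverse `l`, so the graph
function is `y ↦ z (l ‖y‖)`, smooth away from `y = 0`. -/
lemma isExteriorGraph (g : IsGenerating f univ x z Ψ) {a : ℝ}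
    (hneg : ∀ s ≤ a, deriv x s < 0) (hlim : Tendsto x atBot atTop) :
    IsExteriorGraph f (Ψ '' {q | q.2 < a}) := by
  have hx : ContDiff ℝ ∞ x := contDiffOn_univ.1 g.smooth_x
  have hz : ContDiff ℝ ∞ z := contDiffOn_univ.1 g.smooth_z
  obtain ⟨l, hl, hlx, hls, -⟩ := exists_smooth_inverse hx hneg hlim
  have hanti : StrictAntiOn x (Iic a) :=
    strictAntiOn_of_deriv_neg (convex_Iic a) hx.continuous.continuousOn fun s hs =>
      hneg s (interior_subset hs : s ∈ Iic a)
  have hpos := g.pos a trivial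
  refine ⟨?_, x a, fun y => z (l ‖y‖), hpos, fun y hy => ?_, ?_⟩
  · rintro _ ⟨⟨w, s⟩, hs, rfl⟩ _ ⟨⟨w', t⟩, ht, rfl⟩ h
    obtain ⟨h1, -, rfl⟩ := g.apply_eq_apply_iff.1 h
    rw [← hlx s hs, h1, hlx t ht]
  · have hy0 : y ≠ 0 := norm_pos_iff.1 (hpos.trans hy)
    exact (hz.contDiffAt.comp y ((hls _ hy).comp y (contDiffAt_norm ℝ hy0))).contDiffWithinAt
  · ext q
    constructor
    · rintro ⟨_, ⟨⟨w, s⟩, hs, rfl⟩, rfl⟩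
      have hs : s < a := hs
      refine ⟨?_, ?_⟩
      · rw [g.norm_hor_apply]
        exact hanti (mem_Iic.2 hs.le) self_mem_Iic hs
      · simp only [g.norm_hor_apply, g.height_apply, hlx s hs]
    · rintro ⟨h1, h2⟩
      obtain ⟨hla, hxl⟩ := hl _ h1
      have hn : 0 < ‖hor q‖ := hpos.trans h1
      have hw : ‖‖hor q‖⁻¹ • hor q‖ = 1 := by
        rw [norm_smul, norm_inv, norm_norm, inv_mul_cancel₀ hn.ne']
      refine ⟨_, ⟨(⟨‖hor q‖⁻¹ • hor q, by simpa using hw⟩, l ‖hor q‖), hla, rfl⟩, ?_⟩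
      rw [g.apply_eq _ _ trivial]
      refine amb_ext ?_ ?_
      · rw [hor_rotPoint, hxl, smul_smul, mul_inv_cancel₀ hn.ne', one_smul]
      · rw [height_rotPoint, h2]

lemma isHorizontalAt (g : IsGenerating f univ x z Ψ) (hf : IsOrientedImmersion f η)
    (w : USphere m) {s : ℝ} (hs : deriv z s = 0) : IsHorizontalAt f (Ψ (w, s)) := by
  intro v
  obtain ⟨⟨y, t⟩, rfl⟩ := (g.genDiff_bijective hf (s := s) trivial w).2 v
  have h1 := g.diffAt_self hf (mem_univ s) w y t
  refine (congrArg height h1).trans ?_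
  rw [hs, rotPoint_eq, zero_smul, add_zero, ← map_smul (horIncl m), ← map_smul (horIncl m),
    ← map_smul (horIncl m), ← map_add, height_horIncl]

end IsGenerating

end Ends

end RotHyp

/-! ### The main theorem. -/

theorem mainTheorem3 (m : ℕ) (hm : 1 ≤ m) (lam : ℝ) (hlam : 0 < lam)
    {M : Type*} [TopologicalSpace M] [T2Space M] [SecondCountableTopology M]
    [ChartedSpace (EuclideanSpace ℝ (Fin (m + 1))) M] [IsManifold (𝓡 (m + 1)) ∞ M] [Nonempty M]
    (f η : M → RotHyp.Amb m)
    (hH : RotHyp.IsHHypersurface lam f η)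
    (hrot : RotHyp.IsRotational f)
    (hcomplete : RotHyp.IsCompleteImmersion f)
    (haxis : ∀ p, RotHyp.hor (f p) ≠ 0) :
    IsProperMap f ∧
    (∃ (Ψ : Diffeomorph ((𝓡 m).prod 𝓘(ℝ, ℝ)) (𝓡 (m + 1)) (RotHyp.USphere m × ℝ) M ∞)
        (x z : ℝ → ℝ),
      ContDiff ℝ ∞ x ∧ ContDiff ℝ ∞ z ∧ (∀ s, 0 < x s) ∧
      (∀ s, deriv x s ^ 2 + deriv z s ^ 2 = 1) ∧
      (∀ (w : RotHyp.USphere m) (s : ℝ), f (Ψ (w, s)) = RotHyp.rotPoint (x s) (z s) w) ∧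
      RotHyp.ConvergesToCylinder x z ((m : ℝ) / (lam * ((m : ℝ) + 1))) ∧
      (range f ≠ RotHyp.cylinder m ((m : ℝ) / (lam * ((m : ℝ) + 1))) →
        (1 < lam → ∀ a : ℝ,
          RotHyp.InfinitelyManySelfIntersections f (Ψ '' {q | q.2 < a}) ∧
          RotHyp.UnboundedDistance f (Ψ '' {q | q.2 < a})) ∧
        (lam ≤ 1 → ∃ a : ℝ, RotHyp.IsExteriorGraph f (Ψ '' {q | q.2 < a})))) ∧
    (lam < 1 → (∀ p, RotHyp.IsHorizontalAt f p → η p = -RotHyp.vert m) →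
      IsEmbedding f) := by
  obtain ⟨Ψ, x, z, g, hp, hη⟩ := RotHyp.exists_profile hm hlam hH hrot hcomplete haxis
  have hx : ContDiff ℝ ∞ x := contDiffOn_univ.1 g.smooth_x
  have hz : ContDiff ℝ ∞ z := contDiffOn_univ.1 g.smooth_z
  have hr := RotHyp.radius_pos hm hlam
  have hends := hp.eq_cylinder_or_tendsto_x_atBot hm hlam
  have hproper : IsProperMap f := by
    refine g.isProperMap hH.smooth.continuous (hp.tendsto_z_atTop hm hlam) (hends.imp_left ?_)
    intro h
    exact (tendsto_atBot_add_const_left _ _ tendsto_id).congr fun s => (h s).2.symm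
  refine ⟨hproper, ⟨Ψ, x, z, hx, hz, fun s => g.pos s trivial, fun s => g.unit s trivial,
    fun w s => g.apply_eq w s trivial, ⟨hp.tendsto_x_atTop hm hlam, hp.tendsto_u_atTop hm hlam,
      hp.tendsto_z_atTop hm hlam⟩, fun hcyl => ?_⟩, fun hlam1 hhor => ?_⟩
  · have hlim : Tendsto x atBot atTop :=
      hends.resolve_left fun h => hcyl (g.range_eq_cylinder hr h)
    refine ⟨fun hlam1 a => ⟨g.infinitelyManySelfIntersections fun Y =>
      hp.exists_self_intersection hlam1 hlim Y a, g.unboundedDistance hlim a⟩, fun hlam1 => ?_⟩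
    obtain ⟨a, ha⟩ := hp.exists_forall_u_neg hm hlam hlam1 hlim
    exact ⟨a, g.isExteriorGraph ha hlim⟩
  · have hinj : Function.Injective f := by
      intro p p' h
      obtain ⟨w, s, -, rfl⟩ := g.onto p
      obtain ⟨w', t, -, rfl⟩ := g.onto p'
      obtain ⟨hxs, hzs, rfl⟩ := g.apply_eq_apply_iff.1 h
      have hst : s = t := by
        -- The vertical component of the normal is `x'`, so a downward normal at horizontal points
        -- says exactly that `z' = 0` implies `x' = -1`.
        refine hp.eq_of_horizontal_inward hm hlam hlam1 hx (fun s hs => ?_) hxs hzs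
        have h1 := hhor _ (g.isHorizontalAt hH.toIsOrientedImmersion w hs)
        have h2 := congrArg RotHyp.height h1
        rw [hη w s, RotHyp.curveNormal, RotHyp.height_rotPoint] at h2
        rw [h2]
        change -RotHyp.height (RotHyp.vert m) = -1
        rw [RotHyp.height_vert]
      rw [hst]
    exact (IsClosedEmbedding.of_continuous_injective_isClosedMap hproper.continuous hinj
      hproper.isClosedMap).isEmbedding
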